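/- Fix an integer $k\ge 2$ and a real number $\tau>0$. Let $\mathscr{G}(k,\tau)$ be the space of all labelled plane metric graphs of the following form: each is a finite connected graph (loops and multiple edges allowed) embedded in the plane, with finite edges of positive length and $k$ infinite rays, in which every vertex has valence at least three; it has a unique cycle $L$, and $L$ has total length $\tau$; the $k$ infinite rays go to infinity and are asymptotic to $k$ fixed directions there, labelled $1,2,\dots,k$ in (counterclockwise) cyclic order. Two such graphs are identified if there is an isomorphism of metric graphs between them that preserves the labels of the rays and the embedding, i.e. the counterclockwise cyclic order of the edges at every vertex. The topology is the one in which two graphs are close if they differ by a small change of edge lengths or by collapsing or expanding short edges: for each combinatorial type the admissible non-negative edge lengths (total length $\tau$ on the cycle) form a closed cell with its Euclidean topology, the cells are glued by identifying a graph having edges of length zero with the graph obtained by collapsing those edges, and $\mathscr{G}(k,\tau)$ carries the quotient topology. Then $\mathscr{G}(k,\tau)$ is homeomorphic to $\mathbb{R}^{k-1}$. -/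

import Mathlib

/-- `FirstReturn g K x y`: iterating the permutation `g` from `x`, the first point of `K` that is
reached after at least one step is `y`. -/
def FirstReturn {X : Type*} (g : Equiv.Perm X) (K : Set X) (x y : X) : Prop :=
  ∃ m : ℕ, 0 < m ∧ (g ^ m) x = y ∧ y ∈ K ∧ ∀ j : ℕ, 0 < j → j < m → (g ^ j) x ∉ K

/-- The number of cycles of a permutation, fixed points included. -/
noncomputable def numCycles {X : Type*} (g : Equiv.Perm X) : ℕ :=
  Nat.card (Quotient (Equiv.Perm.SameCycle.setoid g))

/-- A finite graph (loops and multiple edges allowed) with `k` labelled infinite rays, drawn on an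
oriented surface, given as a rotation system on its darts (= half-edges, = edges with a chosen
end vertex from which they leave):

* `edge` reverses an edge; its 2-cycles are the finite edges, and its fixed points are the rays
  (a ray has only one end vertex);
* `rot` sends a dart to the next dart in counterclockwise order around the vertex that it leaves;
  the vertices are the cycles of `rot`;
* `ray i` is the ray with label `i`. -/
structure RayGraph (k : ℕ) where
  /-- the number of darts -/
  n : ℕ
  edge : Equiv.Perm (Fin n)
  rot : Equiv.Perm (Fin n)
  ray : Fin k → Fin n
  edge_edge : ∀ d, edge (edge d) = d
  ray_injective : Function.Injective ray
  edge_eq_self_iff : ∀ d, edge d = d ↔ ∃ i, ray i = d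

namespace RayGraph

variable {k : ℕ}

/-- Walk along the dart `d` to its far end (for a ray: out to infinity and back on its other side)
and continue with the next dart there.  The cycles of this permutation are the boundary
contours of the complementary faces of the graph with its rays truncated. -/
def face (Γ : RayGraph k) : Equiv.Perm (Fin Γ.n) := Γ.rot * Γ.edge

/-- The darts `d` and `e` leave the same vertex. -/
def SameVertex (Γ : RayGraph k) (d e : Fin Γ.n) : Prop := Γ.rot.SameCycle d e

/-- `L` is the set of darts (both directions of each edge) of an embedded cycle of the graph:
there is a closed path `c 0, …, c m` (indices modulo `m + 1`) through pairwise distinct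
vertices, which traverses no ray and no edge twice. -/
def IsCycle (Γ : RayGraph k) (L : Finset (Fin Γ.n)) : Prop :=
  ∃ (m : ℕ) (c : Fin (m + 1) → Fin Γ.n),
    (∀ i, Γ.SameVertex (Γ.edge (c i)) (c (i + 1))) ∧
    (∀ i j, Γ.SameVertex (c i) (c j) → i = j) ∧
    (∀ i j, Γ.edge (c i) ≠ c j) ∧
    ∀ d, d ∈ L ↔ ∃ i, d = c i ∨ d = Γ.edge (c i)

end RayGraph

/-- A combinatorial type of connected plane graphs with a unique cycle and with `k` rays going to
infinity, labelled in counterclockwise cyclic order. -/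
structure PlaneType (k : ℕ) extends RayGraph k where
  connected : ∀ d e, ∃ g ∈ Subgroup.closure {edge, rot}, g d = e
  /-- Every vertex has valence at least three (a loop counts twice). -/
  three_le_valence : ∀ d, rot d ≠ d ∧ rot (rot d) ≠ d
  /-- Planarity: `V - E + F = 2`, where `E` is the number of finite edges. -/
  euler : (numCycles rot : ℤ) - ((numCycles edge : ℤ) - (k : ℤ)) +
    (numCycles toRayGraph.face : ℤ) = 2
  /-- All rays lie in one face, the one that contains the point at infinity, and going around that
  face they occur in the cyclic order of their labels. -/
  ray_order : ∀ i, FirstReturn toRayGraph.face (Set.range ray) (ray i) (ray (finRotate k i))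
  /-- The set of the darts of the cycle. -/
  cycle : Finset (Fin n)
  /-- There is exactly one cycle. -/
  isCycle_iff : ∀ L, toRayGraph.IsCycle L ↔ L = cycle

/-- `ℓ` assigns lengths to the finite edges of `Γ` so that the cycle has total length `τ`.  Length
zero is allowed here: it represents a collapsed edge.  Rays are infinitely long and have no
length parameter; they carry the placeholder value `0`. -/
structure IsLength {k : ℕ} (Γ : PlaneType k) (τ : ℝ) (ℓ : Fin Γ.n → ℝ) : Prop where
  nonneg : ∀ d, 0 ≤ ℓ d
  edge : ∀ d, ℓ (Γ.edge d) = ℓ d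
  ray : ∀ i, ℓ (Γ.ray i) = 0
  /-- Every edge of the cycle is counted twice, once for each of its two darts. -/
  cycle : ∑ d ∈ Γ.cycle, ℓ d = 2 * τ

/-- The disjoint union over all combinatorial types `Γ` of the closed cells formed by the lengths on
`Γ`, with the disjoint union topology of the Euclidean topologies of the cells. -/
abbrev MetricCells (k : ℕ) (τ : ℝ) : Type :=
  Σ Γ : PlaneType k, {ℓ : Fin Γ.n → ℝ // IsLength Γ τ ℓ}

namespace MetricCells

variable {k : ℕ} {τ : ℝ}

/-- The darts that survive when all edges of length zero are collapsed. -/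
def kept (G : MetricCells k τ) : Set (Fin G.1.n) :=
  {d | G.1.edge d = d ∨ 0 < G.2.1 d}

/-- `Collapses G H`: the plane metric graph `H` is obtained from `G` by collapsing every edge of
length zero to a point.  (Collapsing edges deletes their darts from the face contours and
changes nothing else.)  When no edge of `G` has length zero, this says that `G` and `H` are
isomorphic as labelled plane metric graphs. -/
def Collapses (G H : MetricCells k τ) : Prop :=
  ∃ f : Fin H.1.n → Fin G.1.n,
    Function.Injective f ∧ Set.range f = G.kept ∧
    (∀ d, f (H.1.edge d) = G.1.edge (f d)) ∧
    (∀ i, f (H.1.ray i) = G.1.ray i) ∧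
    (∀ d, FirstReturn G.1.face G.kept (f d) (f (H.1.face d))) ∧
    ∀ d, H.2.1 d = G.2.1 (f d)

end MetricCells

/-- The space of plane metric graphs with a unique cycle, of length `τ`, and with `k` cyclically
labelled infinite rays, up to isomorphism.  It is glued from the cells by the equivalence
relation generated by collapsing edges of length zero (this includes isomorphism), and it
carries the quotient topology: graphs are close when they differ by a small change of edge
lengths and by collapsing or expanding short edges. -/
def MetricGraphSpace (k : ℕ) (τ : ℝ) : Type :=
  Quot (MetricCells.Collapses (k := k) (τ := τ))

instance (k : ℕ) (τ : ℝ) : TopologicalSpace (MetricGraphSpace k τ) :=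
  inferInstanceAs (TopologicalSpace (Quot _))

/-! The rays cut the outer face into `k` gaps, gap `j` lying between ray `j` and the ray before it.
Along the boundary of a gap the contour first descends along bridges, then runs along at most one
edge of the cycle, then ascends along bridges; valence at least three allows nothing else. If a gap
shows a cycle edge, its lowest height above the cycle (its valley) is `0`. So the length of cycle
seen in a gap and its valley are never both nonzero, and their difference `coord` remembers both as
its positive and negative part.

The graph can be recovered from these `k` numbers. Every edge off the cycle is a bridge with both
sides on the outer face, and the inner face runs along the cycle only, so the whole graph is encoded
in the bracket word of its outer contour. A bridge whose sides lie in gaps `a` and `b` starts at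
height `max (h a) (h b)` and ends at the least `h` of the gaps strictly between (`bottom_eq`,
`top`). A bridge of positive length joins `a` and `b` exactly when all gaps between are higher than
both ends, and then only one does (`exists_up`, `unique`). The letters within a gap are ordered by
the gaps on their other sides (`rank_lt`). Hence graphs with equal coordinates agree up to edges of
length zero (`exists_matching`, `collapses_of_coord_eq`). Conversely, the same rules write down a
word for any vector whose positive parts sum to `τ` (`Profile`), and every such word is the contour
of a plane graph (`planeType`); this gives `exists_coord_eq`.

The vectors `x` with `∑ j, max (x j) 0 = τ` form a hypersurface that meets each line parallel to the
diagonal exactly once, so the differences to the last entry identify it with a space of dimension `k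
- 1`. The resulting `chart` is continuous, because on each cell the coordinates are sums and minima
of lengths, and because collapsing does not change them (`Collapses.coord_eq`). It is closed: on
each cell it is proper, the lengths being bounded by the coordinates (`length_le`), and the
representatives found above have boundedly many darts, so finitely many cells suffice. -/

/-! ### Bracket words and the shape of a gap -/

/-- The outer contour of a plane graph with a unique cycle, read from an edge of the cycle:
letters `p < N`, where `σ` pairs the two sides of each bridge, and `L`, `R` are the positions of
the edges of the cycle and of the rays. -/
structure ContourWord where
  N : ℕ
  σ : ℕ → ℕ
  L : Set ℕ
  R : Set ℕ
  zero_mem : 0 ∈ L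
  L_lt : ∀ p ∈ L, p < N
  R_lt : ∀ p ∈ R, p < N
  disj : ∀ p ∈ L, p ∉ R
  σ_ge : ∀ p, N ≤ p → σ p = p
  σσ : ∀ p, σ (σ p) = p
  σ_eq_iff : ∀ p, p < N → (σ p = p ↔ p ∈ L ∨ p ∈ R)
  nest : ∀ p q, p < q → q < σ p → p < σ q ∧ σ q < σ p
  not_L : ∀ p q, p < q → q < σ p → q ∉ L
  -- The last three fields express valence at least three: no bracket is empty, no bracket contains
  -- just one letter or just one bracket, and between consecutive cycle edges something is attached
  -- on the outside. The end of the word counts as a cycle edge because letter `0` follows it.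
  v1 : ∀ p, σ p ≠ p + 1
  v2 : ∀ p, p < σ p → σ (p + 1) + 1 ≠ σ p
  v3 : ∀ p ∈ L, p + 1 ∉ L ∧ p + 1 ≠ N

namespace ContourWord

variable (W : ContourWord)

open Classical in
/-- The number of rays before position `p`. -/
noncomputable def γ (p : ℕ) : ℕ := Nat.count (· ∈ W.R) p

open Classical in
/-- The height above the cycle of the starting point of letter `r`. -/
noncomputable def height (l : ℕ → ℝ) (r : ℕ) : ℝ :=
  ∑ u ∈ (Finset.range W.N).filter (fun u => u < W.σ u ∧ u < r ∧ r ≤ W.σ u), l u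

variable {W}

lemma γ_mono {p q : ℕ} (h : p ≤ q) : W.γ p ≤ W.γ q := by
  classical exact Nat.count_monotone _ h

lemma γ_succ_ray {p : ℕ} (h : p ∈ W.R) : W.γ (p + 1) = W.γ p + 1 := by
  simp [γ, Nat.count_succ, h]

lemma γ_succ {p : ℕ} (h : p ∉ W.R) : W.γ (p + 1) = W.γ p := by
  simp [γ, Nat.count_succ, h]

lemma γ_zero : W.γ 0 = 0 := by simp [γ]

lemma γ_lt {p q r : ℕ} (hr : r ∈ W.R) (h1 : p ≤ r) (h2 : r < q) : W.γ p < W.γ q := by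
  have := γ_mono (W := W) h1
  have h3 := γ_mono (W := W) (Nat.succ_le_of_lt h2)
  rw [Nat.succ_eq_add_one, γ_succ_ray hr] at h3
  omega

lemma lt_of_γ_lt {p q : ℕ} (h : W.γ p < W.γ q) : p < q := by
  by_contra h'
  exact absurd (γ_mono (W := W) (not_lt.1 h')) (by omega)

lemma lt_N_of_ne {p : ℕ} (h : W.σ p ≠ p) : p < W.N := by
  by_contra h'
  exact h (W.σ_ge p (not_lt.1 h'))

lemma σ_lt {p : ℕ} (h : p < W.N) : W.σ p < W.N := by
  by_contra h'
  have := W.σ_ge _ (not_lt.1 h')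
  rw [W.σσ] at this
  omega

lemma σ_L {p : ℕ} (h : p ∈ W.L) : W.σ p = p := (W.σ_eq_iff p (W.L_lt p h)).2 (Or.inl h)

lemma σ_R {p : ℕ} (h : p ∈ W.R) : W.σ p = p := (W.σ_eq_iff p (W.R_lt p h)).2 (Or.inr h)

/-- A letter inside a bracket is not on the cycle and does not close a bracket opened outside. -/
lemma inside_cases {p q : ℕ} (h1 : p < q) (h2 : q < W.σ p) :
    q ∈ W.R ∨ (q < W.σ q ∧ W.σ q < W.σ p) ∨ (W.σ q < q ∧ p < W.σ q) := by
  have hN : q < W.N := by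
    have := σ_lt (lt_N_of_ne (W := W) (p := p) (by omega))
    omega
  have hn := W.nest p q h1 h2
  rcases lt_trichotomy (W.σ q) q with h | h | h
  · exact Or.inr (Or.inr ⟨h, hn.1⟩)
  · rcases (W.σ_eq_iff q hN).1 h with h | h
    · exact absurd h (W.not_L p q h1 h2)
    · exact Or.inl h
  · exact Or.inr (Or.inl ⟨h, hn.2⟩)

/-- An innermost bracket without a ray would be empty, against `v1`; the induction descends through
the letter right after the opening one. -/
lemma ray_in_bracket {p : ℕ} (h : p < W.σ p) : ∃ q ∈ W.R, p < q ∧ q < W.σ p := by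
  induction hn : W.σ p - p using Nat.strong_induction_on generalizing p with
  | _ n ih =>
  have h1 := W.v1 p
  rcases inside_cases (W := W) (p := p) (q := p + 1) (by omega) (by omega) with h2 | h2 | h2
  · exact ⟨p + 1, h2, by omega, by omega⟩
  · obtain ⟨q, hq, h3, h4⟩ := ih _ (by omega) h2.1 rfl
    exact ⟨q, hq, by omega, by omega⟩
  · omega

lemma γ_lt_σ {p : ℕ} (h : p < W.σ p) : W.γ p < W.γ (W.σ p) := by
  obtain ⟨q, hq, h1, h2⟩ := ray_in_bracket h
  exact γ_lt hq h1.le h2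

lemma not_ray_of_γ_eq {p q r : ℕ} (h : W.γ p = W.γ q) (h1 : p ≤ r) (h2 : r < q) : r ∉ W.R :=
  fun hr => absurd (γ_lt hr h1 h2) (by omega)

/-- After an opening bracket, the rest of the gap consists of opening brackets. -/
lemma up_of_up {p q : ℕ} (hp : p < W.σ p) (hpq : p < q) (hg : W.γ p = W.γ q) :
    q < W.σ q ∨ q ∈ W.R := by
  -- The gap cannot extend past the ray inside bracket `p`, so `q` is still inside this bracket. If
  -- `q` closed a bracket, that bracket would have opened after `p` and would have a ray of its own
  -- within the gap.
  obtain ⟨r, hr, h1, h2⟩ := ray_in_bracket hp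
  have h3 : q ≤ r := by
    by_contra h'
    exact not_ray_of_γ_eq hg h1.le (not_le.1 h') hr
  rcases inside_cases (W := W) hpq (by omega) with h | h | h
  · exact Or.inr h
  · exact Or.inl h.1
  · exfalso
    have h4 := γ_lt_σ (W := W) (p := W.σ q) (by rw [W.σσ]; exact h.1)
    rw [W.σσ] at h4
    have := γ_mono (W := W) h.2.le
    omega

/-- A bracket closing at `q` would either enclose the cycle edge `p`, which `not_L` excludes, or
open after `p` and contain a ray, which would end the gap. -/
lemma not_down_of_L {p q : ℕ} (hp : p ∈ W.L) (hpq : p < q) (hg : W.γ p = W.γ q) :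
    ¬ W.σ q < q := by
  intro h
  have h5 : W.σ (W.σ q) = q := W.σσ q
  have h4 := γ_lt_σ (W := W) (p := W.σ q) (by rw [W.σσ]; exact h)
  rw [W.σσ] at h4
  rcases lt_trichotomy (W.σ q) p with h1 | h1 | h1
  · exact W.not_L _ _ h1 (by omega) hp
  · have := σ_L hp
    rw [← h1, W.σσ] at this
    omega
  · have := γ_mono (W := W) h1.le
    omega

/-- With `up_of_up` and `down_of_down` this fixes the shape of a gap: closing brackets, at most one
cycle edge, opening brackets. -/
lemma up_of_L {p q : ℕ} (hp : p ∈ W.L) (hpq : p < q) (hg : W.γ p = W.γ q) (hq : q < W.N) :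
    q < W.σ q ∨ q ∈ W.R := by
  rcases lt_trichotomy (W.σ q) q with h | h | h
  · exact absurd h (not_down_of_L hp hpq hg)
  · rcases (W.σ_eq_iff q hq).1 h with h | h
    · exfalso
      -- A second cycle edge does not follow immediately, by `v3`. The letter before it would
      -- therefore be an opening bracket, after which no cycle edge can come in the same gap.
      obtain ⟨r, rfl⟩ : ∃ r, q = r + 1 := ⟨q - 1, by omega⟩
      have hr : r ∉ W.R := not_ray_of_γ_eq hg (by omega) (by omega)
      have hgr : W.γ r = W.γ (r + 1) := (γ_succ hr).symm
      have hrL : r ∉ W.L := fun h' => (W.v3 r h').1 h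
      have hpr : p < r := by
        rcases Nat.lt_or_ge p r with h' | h'
        · exact h'
        · exact absurd (by rwa [show r = p by omega]) hrL
      have h1 := not_down_of_L hp hpr (by omega)
      have h2 : W.σ r ≠ r := fun h' => by
        rcases (W.σ_eq_iff r (by omega)).1 h' with h' | h' <;> tauto
      rcases up_of_up (W := W) (p := r) (q := r + 1) (by omega) (by omega) hgr with h' | h'
      · omega
      · exact W.disj _ h h'
    · exact Or.inr h
  · exact Or.inl h

/-- Before a closing bracket, its gap consists of closing brackets. -/
lemma down_of_down {p q : ℕ} (hq : W.σ q < q) (hpq : p < q) (hg : W.γ p = W.γ q) :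
    W.σ p < p := by
  have hqN : q < W.N := lt_N_of_ne (by omega)
  have hqR : q ∉ W.R := fun h => by have := σ_R h; omega
  rcases lt_trichotomy (W.σ p) p with h | h | h
  · exact h
  · rcases (W.σ_eq_iff p (by omega)).1 h with h | h
    · rcases up_of_L h hpq hg hqN with h | h
      · omega
      · exact absurd h hqR
    · exact absurd h (not_ray_of_γ_eq hg le_rfl hpq)
  · rcases up_of_up h hpq hg with h | h
    · omega
    · exact absurd h hqR

/-! ### Heights and valleys of a word -/

section Height

variable {l : ℕ → ℝ}

lemma height_up {p : ℕ} (hp : p < W.σ p) : W.height l (p + 1) = W.height l p + l p := by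
  have hN : p < W.N := lt_N_of_ne (by omega)
  unfold height
  rw [add_comm _ (l p), ← Finset.sum_insert (a := p) (by simp)]
  congr 1
  ext u
  simp only [Finset.mem_filter, Finset.mem_range, Finset.mem_insert]
  constructor
  · rintro ⟨h1, h2, h3, h4⟩
    rcases eq_or_ne u p with h | h
    · exact Or.inl h
    · exact Or.inr ⟨h1, h2, by omega, by omega⟩
  · rintro (rfl | ⟨h1, h2, h3, h4⟩)
    · exact ⟨hN, hp, by omega, by omega⟩
    · refine ⟨h1, h2, by omega, ?_⟩
      by_contra h5
      have h6 : W.σ u = p := by omega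
      have := W.σσ u
      rw [h6] at this
      omega

lemma height_same {p : ℕ} (hp : W.σ p = p) : W.height l (p + 1) = W.height l p := by
  unfold height
  congr 1
  ext u
  simp only [Finset.mem_filter, Finset.mem_range]
  have h0 : W.σ u = p → u = p := fun h => by
    have := W.σσ u
    rw [h, hp] at this
    omega
  constructor
  · rintro ⟨h1, h2, h3, h4⟩
    have : u ≠ p := by rintro rfl; omega
    exact ⟨h1, h2, by omega, by omega⟩
  · rintro ⟨h1, h2, h3, h4⟩
    have : W.σ u ≠ p := fun h => by have := h0 h; omega
    exact ⟨h1, h2, by omega, by omega⟩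

/-- By nesting, the brackets around the corner after a bracket are the same as those around the
corner before it. -/
lemma height_end {p : ℕ} (hp : p < W.σ p) : W.height l (W.σ p + 1) = W.height l p := by
  unfold height
  congr 1
  ext u
  simp only [Finset.mem_filter, Finset.mem_range]
  have h0 : W.σ u = p → u = W.σ p := fun h => by
    have := W.σσ u
    rw [h] at this
    omega
  constructor
  · rintro ⟨h1, h2, h3, h4⟩
    refine ⟨h1, h2, ?_, by omega⟩
    by_contra h5
    have h6 : u ≠ p := by rintro rfl; omega
    have h7 : u ≠ W.σ p := by
      rintro rfl
      rw [W.σσ] at h2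
      omega
    have := W.nest p u (by omega) (by omega)
    omega
  · rintro ⟨h1, h2, h3, h4⟩
    have h6 : W.σ u ≠ p := fun h => by have := h0 h; omega
    have := W.nest u p (by omega) (by omega)
    exact ⟨h1, h2, by omega, by omega⟩

lemma height_down {p : ℕ} (hp : W.σ p < p) :
    W.height l p = W.height l (p + 1) + l (W.σ p) := by
  have hN : W.σ p < W.N := σ_lt (lt_N_of_ne (by omega))
  have hpp := W.σσ p
  unfold height
  rw [add_comm _ (l (W.σ p)), ← Finset.sum_insert (a := W.σ p) (by simp [hpp])]
  congr 1
  ext u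
  simp only [Finset.mem_filter, Finset.mem_range, Finset.mem_insert]
  constructor
  · rintro ⟨h1, h2, h3, h4⟩
    rcases eq_or_ne (W.σ u) p with h | h
    · left
      have := W.σσ u
      rw [h] at this
      exact this.symm
    · exact Or.inr ⟨h1, h2, by omega, by omega⟩
  · rintro (rfl | ⟨h1, h2, h3, h4⟩)
    · exact ⟨hN, by omega, by omega, by omega⟩
    · have : u ≠ p := by rintro rfl; omega
      exact ⟨h1, h2, by omega, by omega⟩

variable (hl : ∀ p, 0 ≤ l p)
include hl

lemma height_nonneg (p : ℕ) : 0 ≤ W.height l p := Finset.sum_nonneg fun _ _ => hl _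

/-- A bracket around corner `p + 1` is `p` itself or encloses `p`; in both cases it also surrounds
`r`. -/
lemma height_bracket {p r : ℕ} (h1 : p < r) (h2 : r ≤ W.σ p) :
    W.height l (p + 1) ≤ W.height l r := by
  unfold height
  refine Finset.sum_le_sum_of_subset_of_nonneg ?_ fun _ _ _ => hl _
  intro u
  simp only [Finset.mem_filter, Finset.mem_range]
  rintro ⟨h3, h4, h5, h6⟩
  refine ⟨h3, h4, by omega, ?_⟩
  rcases eq_or_ne u p with rfl | h
  · exact h2
  · have := W.nest u p (by omega) (by omega)
    omega

lemma height_mono {p q : ℕ} (hpq : p ≤ q) (h : ∀ r, p ≤ r → r < q → r ≤ W.σ r) :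
    W.height l p ≤ W.height l q := by
  induction q, hpq using Nat.le_induction with
  | base => exact le_rfl
  | succ q hq ih =>
    refine (ih fun r h1 h2 => h r h1 (by omega)).trans ?_
    rcases (h q hq (by omega)).lt_or_eq with h' | h'
    · rw [height_up h']
      linarith [hl q]
    · rw [height_same h'.symm]

lemma height_anti {p q : ℕ} (hpq : p ≤ q) (h : ∀ r, p ≤ r → r < q → W.σ r ≤ r) :
    W.height l q ≤ W.height l p := by
  induction q, hpq using Nat.le_induction with
  | base => exact le_rfl
  | succ q hq ih =>
    refine le_trans ?_ (ih fun r h1 h2 => h r h1 (by omega))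
    rcases (h q hq (by omega)).lt_or_eq with h' | h'
    · rw [height_down h']
      linarith [hl (W.σ q)]
    · rw [height_same h']

omit hl in
lemma height_L {p : ℕ} (hp : p ∈ W.L) : W.height l p = 0 := by
  unfold height
  rw [Finset.filter_false_of_mem, Finset.sum_empty]
  rintro u - ⟨h1, h2, h3⟩
  refine W.not_L u p h2 (lt_of_le_of_ne h3 fun h => ?_) hp
  have := W.σσ u
  rw [← h, σ_L hp] at this
  omega

omit hl in
lemma height_N : W.height l W.N = 0 := by
  unfold height
  rw [Finset.filter_false_of_mem, Finset.sum_empty]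
  rintro u - ⟨h1, h2, h3⟩
  have := σ_lt (W := W) h2
  omega

/-- A corner of the contour where it does not go up before and does not go down afterwards is a
lowest point of its gap. -/
lemma height_valley {p q : ℕ} (hg : W.γ q = W.γ p)
    (h1 : ∀ r, p = r + 1 → W.σ r ≤ r) (h2 : p ≤ W.σ p) : W.height l p ≤ W.height l q := by
  rcases lt_trichotomy q p with h | rfl | h
  · obtain ⟨r, rfl⟩ : ∃ r, p = r + 1 := ⟨p - 1, by omega⟩
    have h1 := h1 r rfl
    refine height_anti hl h.le fun s h3 h4 => ?_
    by_contra h5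
    have hs : s ≠ r := by rintro rfl; omega
    have hr : r ∉ W.R := not_ray_of_γ_eq hg (by omega) (by omega)
    have e1 := γ_mono (W := W) h3
    have e2 := γ_mono (W := W) (show s ≤ r by omega)
    have e3 := γ_succ hr
    rcases up_of_up (W := W) (p := s) (q := r) (by omega) (by omega) (by omega) with
      h | h
    · omega
    · exact hr h
  · exact le_rfl
  · refine height_mono hl h.le fun s h3 h4 => ?_
    by_contra h5
    have e1 := γ_mono (W := W) h3
    have e2 := γ_mono (W := W) h4.le
    rcases eq_or_ne p s with rfl | hs
    · omega
    · have := down_of_down (W := W) (p := p) (q := s) (by omega) (by omega) (by omega)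
      omega

/-- `h r` is the height of the lowest point of gap `r`. -/
def IsValley (W : ContourWord) (l : ℕ → ℝ) (h : ℕ → ℝ) : Prop :=
  ∀ r ≤ W.γ W.N, IsLeast {x | ∃ p ≤ W.N, W.γ p = r ∧ W.height l p = x} (h r)

variable {h : ℕ → ℝ} (hv : W.IsValley l h)
include hv

omit hl in
lemma IsValley.le {p : ℕ} (hp : p ≤ W.N) : h (W.γ p) ≤ W.height l p :=
  (hv _ (γ_mono hp)).2 ⟨p, hp, rfl, rfl⟩

lemma IsValley.eq_of_valley {p : ℕ} (hp : p ≤ W.N)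
    (h1 : ∀ r, p = r + 1 → W.σ r ≤ r) (h2 : p ≤ W.σ p) : W.height l p = h (W.γ p) := by
  refine le_antisymm ?_ (hv.le hp)
  obtain ⟨q, hq, e1, e2⟩ := (hv _ (γ_mono hp)).1
  rw [← e2]
  exact height_valley hl e1 h1 h2

/-- If neither side had its lowest point at the base of `u`, the contour would ascend right before
`u` and descend right after `W.σ u`. -/
lemma IsValley.bottom {u : ℕ} (hu : u < W.σ u) :
    W.height l u = h (W.γ u) ∨ W.height l u = h (W.γ (W.σ u)) := by
  have hN : u < W.N := lt_N_of_ne (by omega)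
  have hN' := σ_lt hN
  have huu := W.σσ u
  by_contra hcon
  push Not at hcon
  obtain ⟨c1, c2⟩ := hcon
  have a1 : ∃ r, u = r + 1 ∧ r < W.σ r := by
    by_contra h'
    push Not at h'
    exact c1 (hv.eq_of_valley hl hN.le (fun r e => h' r e) hu.le)
  have a2 : W.σ (W.σ u + 1) < W.σ u + 1 := by
    by_contra h'
    apply c2
    have := hv.eq_of_valley hl (p := W.σ u + 1) (by omega)
      (fun r e => by obtain rfl : r = W.σ u := by omega
                     omega) (by omega)
    rw [height_end hu, γ_succ (fun h => by have := σ_R h; omega)] at this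
    exact this
  obtain ⟨p, rfl, hp⟩ := a1
  -- Nesting forces the bracket opened before `u` and the one closed after `W.σ u` to coincide. It
  -- then contains only the bracket `u`, against `v2`.
  have h1 := W.v1 p
  have h2 := W.nest p (p + 1) (by omega) (by omega)
  rcases eq_or_ne (W.σ p) (W.σ (p + 1) + 1) with e | e
  · exact W.v2 p hp e.symm
  · have h3 := W.nest p (W.σ (p + 1) + 1) (by omega) (by omega)
    have e4 := W.σσ (W.σ (p + 1) + 1)
    set w := W.σ (W.σ (p + 1) + 1) with hw
    have : w ≠ p + 1 := by
      intro e'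
      rw [e'] at e4
      omega
    have : w ≠ W.σ (p + 1) := by
      intro e'
      rw [e', huu] at e4
      omega
    have := W.nest (p + 1) w (by omega) (by omega)
    omega

/-- The base of a bridge is a corner of both adjacent gaps, so neither valley is above it, and by
`bottom` one of them is level with it. -/
lemma IsValley.bottom_eq {u : ℕ} (hu : u < W.σ u) :
    W.height l u = max (h (W.γ u)) (h (W.γ (W.σ u))) := by
  have hN : u < W.N := lt_N_of_ne (by omega)
  have hN' := σ_lt hN
  have h1 := hv.le hN.le
  have h2 := hv.le (p := W.σ u + 1) (by omega)
  rw [height_end hu, γ_succ (fun h => by have := σ_R h; rw [W.σσ] at this; omega)] at h2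
  rcases hv.bottom hl hu with e | e
  · rw [max_eq_left (by linarith), e]
  · rw [max_eq_right (by linarith), e]

lemma IsValley.top_le {u r : ℕ} (h1 : W.γ u < r) (h2 : r < W.γ (W.σ u)) :
    W.height l (u + 1) ≤ h r := by
  have hu : u < W.σ u := lt_of_γ_lt (h1.trans h2)
  have hN := σ_lt (lt_N_of_ne (W := W) (p := u) (by omega))
  obtain ⟨p, hp, rfl, e⟩ := (hv r (h2.le.trans (γ_mono hN.le))).1
  rw [← e]
  exact height_bracket hl (lt_of_γ_lt h1) (lt_of_γ_lt h2).le

/-- By `v2` the vertex at the top carries a second branch. The corner `q` after the first branch has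
the height of the top and lies in a gap strictly inside the bracket; by `top_le` no such gap has a
lower valley. -/
lemma IsValley.top {u : ℕ} (hu : u < W.σ u) :
    ∃ r, W.γ u < r ∧ r < W.γ (W.σ u) ∧ h r = W.height l (u + 1) := by
  have hN := σ_lt (lt_N_of_ne (W := W) (p := u) (by omega))
  have h1 := W.v1 u
  have h2 := W.v2 u hu
  have key : ∃ q, u < q ∧ q < W.σ u ∧ W.γ u < W.γ q ∧ W.height l q = W.height l (u + 1) ∧
      (∀ w, W.σ w = q → w < q → w = u) := by
    rcases inside_cases (W := W) (p := u) (q := u + 1) (by omega) (by omega) with h | h | h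
    · have e := σ_R h
      refine ⟨u + 1 + 1, by omega, by omega, γ_lt h (by omega) (by omega), height_same e, ?_⟩
      intro w hw hwq
      rcases lt_trichotomy w u with h' | h' | h'
      · have := W.nest w u h' (by omega)
        omega
      · exact h'
      · rw [show w = u + 1 by omega] at hw
        omega
    · refine ⟨W.σ (u + 1) + 1, by omega, by omega, ?_, height_end h.1, ?_⟩
      · exact (γ_mono (by omega : u ≤ u + 1)).trans_lt ((γ_lt_σ h.1).trans_le (γ_mono (by omega)))
      · intro w hw hwq
        have e := W.σσ (u + 1)
        rcases lt_trichotomy w u with h' | h' | h'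
        · have := W.nest w u h' (by omega)
          omega
        · exact h'
        · rcases eq_or_ne w (u + 1) with rfl | h3
          · omega
          · rcases eq_or_ne w (W.σ (u + 1)) with rfl | h4
            · omega
            · have := W.nest (u + 1) w (by omega) (by omega)
              omega
    · omega
  obtain ⟨q, k1, k2, k3, k4, k5⟩ := key
  have k6 : W.γ q < W.γ (W.σ u) := by
    rcases inside_cases k1 k2 with h | h | h
    · exact γ_lt h le_rfl k2
    · exact (γ_lt_σ h.1).trans_le (γ_mono h.2.le)
    · have := k5 _ (W.σσ q) h.1
      omega
  refine ⟨W.γ q, k3, k6, le_antisymm ?_ (hv.top_le hl k3 k6)⟩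
  rw [← k4]
  exact hv.le (by omega)

/-- An opening bracket of positive length is determined by the gaps of its two ends. -/
lemma IsValley.unique {u v : ℕ} (hu : u < W.σ u) (hv' : v < W.σ v) (lu : 0 < l u) (lv : 0 < l v)
    (h1 : W.γ u = W.γ v) (h2 : W.γ (W.σ u) = W.γ (W.σ v)) : u = v := by
  wlog hlt : u < v generalizing u v
  · rcases eq_or_lt_of_le (not_lt.1 hlt) with h | h
    · exact h.symm
    · exact (this hv' hu lv lu h1.symm h2.symm h).symm
  exfalso
  have h3 : v ≤ W.σ u := by
    by_contra h'
    have := γ_mono (W := W) (not_le.1 h').le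
    have := γ_lt_σ hu
    omega
  -- Both bases have the height `max` of the same two valleys, yet `v` starts inside `u`, hence
  -- higher than the base of `u` by at least `l u`.
  have h4 := height_bracket (W := W) hl hlt h3
  rw [height_up hu, hv.bottom_eq hl hu, hv.bottom_eq hl hv', h1, h2] at h4
  linarith

/-- Walk from the lowest corner of gap `a` until the height first reaches `m`, the least valley
strictly between the two gaps. The letter that gets there is the bracket sought. -/
lemma IsValley.exists_up {a b : ℕ} (hab : a + 1 < b) (hb : b ≤ W.γ W.N)
    (hvis : ∀ r, a < r → r < b → h a < h r ∧ h b < h r) :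
    ∃ u, u < W.σ u ∧ 0 < l u ∧ W.γ u = a ∧ W.γ (W.σ u) = b := by
  -- the lowest level strictly above the two ends
  obtain ⟨m, ⟨hm1, hm2⟩, hm3⟩ : ∃ m, (h a < m ∧ h b < m) ∧ ∀ r, a < r → r < b → m ≤ h r := by
    obtain ⟨r0, hr0, hmin⟩ := Finset.exists_min_image (Finset.Ioo a b) h
      ⟨a + 1, by simp; omega⟩
    rw [Finset.mem_Ioo] at hr0
    exact ⟨h r0, hvis r0 hr0.1 hr0.2, fun r h1 h2 => hmin r (by simp [h1, h2])⟩
  obtain ⟨p, hp, e1, e2⟩ := (hv a (by omega)).1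
  obtain ⟨q, hq, e3, e4⟩ := (hv (a + 1) (by omega)).1
  have hex : ∃ r, p ≤ r ∧ m ≤ W.height l r := ⟨q, (lt_of_γ_lt (W := W) (p := p) (q := q) (by omega)).le, by
    rw [e4]; exact hm3 _ (by omega) hab⟩
  have hfs := Nat.find_spec hex
  have hfm := fun r => Nat.find_min hex (m := r)
  have hfq : Nat.find hex ≤ q := Nat.find_min' hex ⟨(lt_of_γ_lt (W := W) (p := p) (q := q) (by omega)).le, by
    rw [e4]; exact hm3 _ (by omega) hab⟩
  set s := Nat.find hex with hs
  have hps : p ≠ s := by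
    rintro e
    rw [← e, e2] at hfs
    linarith [hfs.2]
  obtain ⟨u, hu⟩ : ∃ u, s = u + 1 := ⟨s - 1, by omega⟩
  have hum : W.height l u < m := by
    have := hfm u (by omega)
    push Not at this
    exact this (by omega)
  have huN : u < W.N := by omega
  have hup : u < W.σ u := by
    by_contra h'
    have h5 : W.height l (u + 1) ≤ W.height l u :=
      height_anti hl (by omega) fun r h1 h2 => by
        obtain rfl : r = u := by omega
        omega
    rw [hu] at hfs
    linarith [hfs.2]
  -- Beyond gap `a` the valleys are at least `m`, but the contour is still below `m` at `u`.
  have hga : W.γ u = a := by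
    have g1 := γ_mono (W := W) (show p ≤ u by omega)
    have g2 := γ_mono (W := W) (show u + 1 ≤ q by omega)
    have g3 : W.γ (u + 1) = W.γ u := γ_succ fun h => by have := σ_R h; omega
    rcases eq_or_ne (W.γ u) a with g | g
    · exact g
    · have := hm3 (W.γ u) (by omega) (by omega)
      have := hv.le huN.le
      linarith
  rw [hu] at hfs
  have hN' := σ_lt huN
  refine ⟨u, hup, ?_, hga, ?_⟩
  · have := height_up (l := l) hup
    linarith [hfs.2]
  -- If the bracket closed before gap `b`, the corner after it would be lower than `m` in a gap
  -- strictly between. If it closed later, gap `b` would lie inside it and its valley would be at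
  -- least `m`.
  · rcases lt_trichotomy (W.γ (W.σ u)) b with g | g | g
    · exfalso
      have g1 := γ_lt_σ hup
      have g2 := hm3 (W.γ (W.σ u)) (by omega) g
      have g3 := hv.le (p := W.σ u + 1) (by omega)
      rw [height_end hup, γ_succ fun h => by have := σ_R h; rw [W.σσ] at this; omega] at g3
      linarith
    · exact g
    · exfalso
      have := hv.top_le hl (u := u) (r := b) (by omega) g
      linarith [hfs.2]

end Height

end ContourWord

/-! ### A word is determined by its valleys up to letters of length zero -/

namespace ContourWord

variable {W W' : ContourWord}

/-- The letters that survive the collapse of the edges of length zero. -/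
def Kept (W : ContourWord) (l : ℕ → ℝ) (p : ℕ) : Prop := p < W.N ∧ (p ∈ W.R ∨ 0 < l p)

open Classical in
/-- The gaps on the two sides of the edge of a letter. -/
noncomputable def far (W : ContourWord) (p : ℕ) : ℕ :=
  if p ∈ W.R then W.γ p + 1 else W.γ (W.σ p)

/-- The order in which the sides of the edges appear in gap `a`, in terms of the gap `b` of the
other side. -/
def rank (k a b : ℕ) : ℕ := if b < a then a - b else if b = a then a + 1 else a + 2 + (k - b)

lemma far_ray {p : ℕ} (hp : p ∈ W.R) : W.far p = W.γ p + 1 := if_pos hp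

lemma far_of_not_ray {p : ℕ} (hp : p ∉ W.R) : W.far p = W.γ (W.σ p) := if_neg hp

lemma not_ray_of_ne {p : ℕ} (h : W.σ p ≠ p) : p ∉ W.R := fun h' => h (σ_R h')

lemma far_L {p : ℕ} (hp : p ∈ W.L) : W.far p = W.γ p := by
  rw [far_of_not_ray (W.disj p hp), σ_L hp]

lemma far_of_ne {p : ℕ} (h : W.σ p ≠ p) : W.far p = W.γ (W.σ p) :=
  far_of_not_ray (not_ray_of_ne h)

lemma cases_letter {p : ℕ} (hp : p < W.N) : p ∈ W.L ∨ p ∈ W.R ∨ p < W.σ p ∨ W.σ p < p := by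
  rcases lt_trichotomy (W.σ p) p with h | h | h
  · tauto
  · have := (W.σ_eq_iff p hp).1 h
    tauto
  · tauto

variable {l l' h : ℕ → ℝ}

section

variable (hl : ∀ p, 0 ≤ l p) (hσ : ∀ p, l (W.σ p) = l p) (hv : W.IsValley l h)

include hl hv

/-- By `top` a bracket has a gap strictly between its two sides. So `far` minus `γ` is `0` for cycle
edges, `1` for rays and at least `2` in absolute value for brackets, which tells the four kinds of
letters apart. -/
lemma IsValley.add_two_le_far {p : ℕ} (hp : p < W.σ p) : W.γ p + 2 ≤ W.far p := by
  obtain ⟨r, h1, h2, -⟩ := hv.top hl hp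
  rw [far_of_ne hp.ne']
  omega

lemma IsValley.far_add_two_le {p : ℕ} (hp : W.σ p < p) : W.far p + 2 ≤ W.γ p := by
  obtain ⟨r, h1, h2, -⟩ := hv.top hl (u := W.σ p) (by rwa [W.σσ])
  rw [W.σσ] at h2
  rw [far_of_ne hp.ne]
  omega

lemma IsValley.mem_L_iff {p : ℕ} (hp : p < W.N) : p ∈ W.L ↔ W.far p = W.γ p := by
  refine ⟨far_L, fun h1 => ?_⟩
  rcases cases_letter hp with h | h | h | h
  · exact h
  · have := far_ray h
    omega
  · have := hv.add_two_le_far hl h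
    omega
  · have := hv.far_add_two_le hl h
    omega

lemma IsValley.mem_R_iff {p : ℕ} (hp : p < W.N) : p ∈ W.R ↔ W.far p = W.γ p + 1 := by
  refine ⟨far_ray, fun h1 => ?_⟩
  rcases cases_letter hp with h | h | h | h
  · have := far_L h
    omega
  · exact h
  · have := hv.add_two_le_far hl h
    omega
  · have := hv.far_add_two_le hl h
    omega

lemma IsValley.up_iff {p : ℕ} (hp : p < W.N) : p < W.σ p ↔ W.γ p + 2 ≤ W.far p := by
  refine ⟨hv.add_two_le_far hl, fun h1 => ?_⟩
  rcases cases_letter hp with h | h | h | h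
  · have := far_L h
    omega
  · have := far_ray h
    omega
  · exact h
  · have := hv.far_add_two_le hl h
    omega

lemma IsValley.down_iff {p : ℕ} (hp : p < W.N) : W.σ p < p ↔ W.far p + 2 ≤ W.γ p := by
  refine ⟨hv.far_add_two_le hl, fun h1 => ?_⟩
  rcases cases_letter hp with h | h | h | h
  · have := far_L h
    omega
  · have := far_ray h
    omega
  · have := hv.add_two_le_far hl h
    omega
  · exact h

omit hl hv in
lemma far_le {p : ℕ} (hp : p < W.N) : W.far p ≤ W.γ W.N := by
  rcases cases_letter hp with h | h | h | h
  · rw [far_L h]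
    exact γ_mono hp.le
  · rw [far_ray h, ← γ_succ_ray h]
    exact γ_mono hp
  all_goals
    rw [far_of_ne (by omega)]
    exact γ_mono (σ_lt hp).le

include hσ in
/-- The order of the letters is determined by the gaps on the two sides of their edges. -/
lemma IsValley.rank_lt {p q : ℕ} (hp : W.Kept l p) (hq : W.Kept l q) (hpq : p < q) :
    W.γ p < W.γ q ∨ W.γ p = W.γ q ∧
      rank (W.γ W.N) (W.γ p) (W.far p) < rank (W.γ W.N) (W.γ q) (W.far q) := by
  rcases (γ_mono (W := W) hpq.le).lt_or_eq with hg | hg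
  · exact Or.inl hg
  refine Or.inr ⟨hg, ?_⟩
  have e1 := far_le hp.1
  have e2 := far_le hq.1
  have hpR : p ∉ W.R := not_ray_of_γ_eq hg le_rfl hpq
  -- Order in a gap: closing brackets with the nearest other side first, then the cycle edge, then
  -- opening brackets with the farthest other side first. The ray, whose `far` is the very next gap,
  -- is last.
  rcases cases_letter hp.1 with h1 | h1 | h1 | h1
  · have hp' := far_L h1
    have : W.γ q < W.far q := by
      rcases up_of_L h1 hpq hg hq.1 with h2 | h2
      · have := hv.add_two_le_far hl h2
        omega
      · have := far_ray h2
        omega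
    unfold rank
    split_ifs <;> omega
  · exact absurd h1 hpR
  · have hp' := hv.add_two_le_far hl h1
    have : W.γ q < W.far q ∧ W.far q < W.far p := by
      rcases up_of_up h1 hpq hg with h2 | h2
      · have := hv.add_two_le_far hl h2
        refine ⟨by omega, ?_⟩
        have lp : 0 < l p := hp.2.resolve_left hpR
        have lq : 0 < l q := hq.2.resolve_left (not_ray_of_ne h2.ne')
        rw [far_of_ne h1.ne', far_of_ne h2.ne']
        have hq' : q < W.σ p := lt_of_γ_lt (hg ▸ γ_lt_σ h1)
        have := W.nest p q hpq hq'
        refine lt_of_le_of_ne (γ_mono this.2.le) fun e => ?_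
        have := hv.unique hl h1 h2 lp lq hg e.symm
        omega
      · have := far_ray h2
        omega
    unfold rank
    split_ifs <;> omega
  · have hp' := hv.far_add_two_le hl h1
    rcases cases_letter hq.1 with h2 | h2 | h2 | h2
    · have := far_L h2
      unfold rank
      split_ifs <;> omega
    · have := far_ray h2
      unfold rank
      split_ifs <;> omega
    · have := hv.add_two_le_far hl h2
      unfold rank
      split_ifs <;> omega
    · have := hv.far_add_two_le hl h2
      have lp : 0 < l p := hp.2.resolve_left hpR
      have lq : 0 < l q := hq.2.resolve_left (not_ray_of_ne h2.ne)
      have h3 : W.far q < W.far p := by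
        have f1 := far_of_ne h1.ne
        have f2 := far_of_ne h2.ne
        have f3 := W.σσ q
        have f4 := W.σσ p
        have hq' : W.σ q < p := lt_of_γ_lt (W := W) (by omega)
        have := W.nest (W.σ q) p hq' (by omega)
        rw [f1, f2]
        refine lt_of_le_of_ne (γ_mono this.1.le) fun e => ?_
        have := hv.unique hl (u := W.σ q) (v := W.σ p) (by omega) (by omega)
          (by rwa [hσ]) (by rwa [hσ]) e (by rw [f3, f4, hg])
        omega
      unfold rank
      split_ifs <;> omega

omit hl hv in
lemma exists_ray {r : ℕ} (hr : r < W.γ W.N) : ∃ p ∈ W.R, W.γ p = r := by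
  have hex : ∃ p, r < W.γ p := ⟨_, hr⟩
  have h1 := Nat.find_spec hex
  obtain ⟨p, hp⟩ : ∃ p, Nat.find hex = p + 1 := by
    rcases h : Nat.find hex with _ | p
    · rw [h, γ_zero] at h1
      omega
    · exact ⟨p, rfl⟩
  have h2 := Nat.find_min hex (m := p) (by omega)
  rw [hp] at h1
  by_cases h3 : p ∈ W.R
  · rw [γ_succ_ray h3] at h1
    exact ⟨p, h3, by omega⟩
  · rw [γ_succ h3] at h1
    omega

/-- Expresses the height of the top through `h` and the two gaps alone, so that it can be compared
between two words. -/
lemma IsValley.top_isLeast {u : ℕ} (hu : u < W.σ u) :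
    IsLeast {x | ∃ r, W.γ u < r ∧ r < W.far u ∧ h r = x} (W.height l (u + 1)) := by
  rw [far_of_ne hu.ne']
  refine ⟨hv.top hl hu, ?_⟩
  rintro x ⟨r, h1, h2, rfl⟩
  exact hv.top_le hl h1 h2

end

section Compare

variable (hl : ∀ p, 0 ≤ l p) (hσ : ∀ p, l (W.σ p) = l p) (hv : W.IsValley l h)
  (hl' : ∀ p, 0 ≤ l' p) (hσ' : ∀ p, l' (W'.σ p) = l' p) (hv' : W'.IsValley l' h)
  (hk : W.γ W.N = W'.γ W'.N)
  (hL : ∀ r, (∃ p ∈ W.L, 0 < l p ∧ W.γ p = r) ↔ ∃ p ∈ W'.L, 0 < l' p ∧ W'.γ p = r)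

include hl hσ hv hl' hv' hk

-- A bracket of positive length in `W'` puts the valleys between its gaps strictly above those at
-- its ends. This is a property of `h` only, and it produces a bracket in `W`.
omit hσ in
lemma exists_matching_up {p : ℕ} (hp : p < W'.σ p) (lp : 0 < l' p) :
    ∃ q, q < W.σ q ∧ 0 < l q ∧ W.γ q = W'.γ p ∧ W.γ (W.σ q) = W'.γ (W'.σ p) := by
  have hN := σ_lt (lt_N_of_ne (W := W') (p := p) (by omega))
  obtain ⟨r, h1, h2, -⟩ := hv'.top hl' hp
  refine hv.exists_up hl (by omega) (by rw [hk]; exact γ_mono hN.le) fun s h3 h4 => ?_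
  have h5 := hv'.top_le hl' h3 h4
  rw [height_up hp, hv'.bottom_eq hl' hp] at h5
  have := le_max_left (h (W'.γ p)) (h (W'.γ (W'.σ p)))
  have := le_max_right (h (W'.γ p)) (h (W'.γ (W'.σ p)))
  constructor <;> linarith

include hσ' hL

lemma exists_matching_letter {p : ℕ} (hp : W'.Kept l' p) :
    ∃ q, W.Kept l q ∧ W.γ q = W'.γ p ∧ W.far q = W'.far p := by
  have hray : p ∉ W'.R → 0 < l' p := fun h' => hp.2.resolve_left h'
  rcases cases_letter hp.1 with h1 | h1 | h1 | h1
  · obtain ⟨q, h2, h3, h4⟩ := (hL _).2 ⟨p, h1, hray (W'.disj p h1), rfl⟩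
    exact ⟨q, ⟨W.L_lt q h2, Or.inr h3⟩, h4, by rw [far_L h1, far_L h2, h4]⟩
  · obtain ⟨q, h2, h3⟩ := exists_ray (W := W) (r := W'.γ p)
      (by rw [hk]; exact γ_lt h1 le_rfl hp.1)
    exact ⟨q, ⟨W.R_lt q h2, Or.inl h2⟩, h3, by rw [far_ray h1, far_ray h2, h3]⟩
  · obtain ⟨q, h2, h3, h4, h5⟩ :=
      exists_matching_up hl hv hl' hv' hk h1 (hray (not_ray_of_ne h1.ne'))
    exact ⟨q, ⟨lt_N_of_ne h2.ne', Or.inr h3⟩, h4, by rw [far_of_ne h1.ne', far_of_ne h2.ne', h5]⟩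
  · obtain ⟨q, h2, h3, h4, h5⟩ :=
      exists_matching_up hl hv hl' hv' hk (p := W'.σ p) (by rwa [W'.σσ])
        (by rw [hσ']; exact hray (not_ray_of_ne h1.ne))
    rw [W'.σσ] at h5
    refine ⟨W.σ q, ⟨σ_lt (lt_N_of_ne h2.ne'), Or.inr (by rwa [hσ])⟩, h5, ?_⟩
    rw [far_of_ne (by rw [W.σσ]; exact h2.ne), far_of_ne h1.ne, W.σσ, h4]

/-- Two contours with the same valleys agree up to letters of length zero. -/
theorem exists_matching : ∃ F : ℕ → ℕ,
    (∀ p, W'.Kept l' p → W.Kept l (F p)) ∧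
    (∀ q, W.Kept l q → ∃ p, W'.Kept l' p ∧ F p = q) ∧
    (∀ p q, W'.Kept l' p → W'.Kept l' q → (p < q ↔ F p < F q)) ∧
    (∀ p, W'.Kept l' p → F (W'.σ p) = W.σ (F p)) ∧
    (∀ p, W'.Kept l' p → (p ∈ W'.L ↔ F p ∈ W.L)) ∧
    (∀ p, W'.Kept l' p → (p ∈ W'.R ↔ F p ∈ W.R)) ∧
    (∀ p, W'.Kept l' p → W.γ (F p) = W'.γ p) ∧
    (∀ p, W'.Kept l' p → p ∉ W'.L → p ∉ W'.R → l (F p) = l' p) := by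
  -- Letters are matched through the code `(γ, far)`. By `rank_lt` the codes of kept letters
  -- determine their order, so the chosen map is monotone and codes are faithful.
  choose F hF1 hF2 hF3 using fun p : {p // W'.Kept l' p} =>
    exists_matching_letter hl hσ hv hl' hσ' hv' hk hL p.2
  have mono : ∀ p q : {p // W'.Kept l' p}, p.1 < q.1 → F p < F q := by
    intro p q hpq
    rcases hv'.rank_lt hl' hσ' p.2 q.2 hpq with h1 | ⟨h1, h2⟩
    · exact lt_of_γ_lt (W := W) (by rw [hF2, hF2]; exact h1)
    · rcases lt_trichotomy (F p) (F q) with h3 | h3 | h3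
      · exact h3
      · rw [← hF3, ← hF3, ← hF2, ← hF2, h3] at h2
        omega
      · rcases hv.rank_lt hl hσ (hF1 q) (hF1 p) h3 with h4 | ⟨h4, h5⟩
        · rw [hF2, hF2] at h4
          omega
        · rw [hF2, hF2, hF3, hF3, hk] at h5
          omega
  have code_inj : ∀ {q q'}, W.Kept l q → W.Kept l q' → W.γ q = W.γ q' → W.far q = W.far q' →
      q = q' := by
    intro q q' h1 h2 h3 h4
    rcases lt_trichotomy q q' with h5 | h5 | h5
    · rcases hv.rank_lt hl hσ h1 h2 h5 with h6 | ⟨-, h6⟩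
      · omega
      · rw [h3, h4] at h6
        omega
    · exact h5
    · rcases hv.rank_lt hl hσ h2 h1 h5 with h6 | ⟨-, h6⟩
      · omega
      · rw [h3, h4] at h6
        omega
  have hLF : ∀ p : {p // W'.Kept l' p}, p.1 ∈ W'.L ↔ F p ∈ W.L := fun p => by
    rw [hv.mem_L_iff hl (hF1 p).1, hv'.mem_L_iff hl' p.2.1, hF2, hF3]
  have hRF : ∀ p : {p // W'.Kept l' p}, p.1 ∈ W'.R ↔ F p ∈ W.R := fun p => by
    rw [hv.mem_R_iff hl (hF1 p).1, hv'.mem_R_iff hl' p.2.1, hF2, hF3]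
  have hUF : ∀ p : {p // W'.Kept l' p}, p.1 < W'.σ p ↔ F p < W.σ (F p) := fun p => by
    rw [hv.up_iff hl (hF1 p).1, hv'.up_iff hl' p.2.1, hF2, hF3]
  have hDF : ∀ p : {p // W'.Kept l' p}, W'.σ p < p.1 ↔ W.σ (F p) < F p := fun p => by
    rw [hv.down_iff hl (hF1 p).1, hv'.down_iff hl' p.2.1, hF2, hF3]
  have keptσ : ∀ {V : ContourWord} {m : ℕ → ℝ}, (∀ p, m (V.σ p) = m p) → ∀ {p}, V.Kept m p →
      V.Kept m (V.σ p) := by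
    intro V m hm p hp
    refine ⟨σ_lt hp.1, ?_⟩
    rcases hp.2 with h1 | h1
    · rw [σ_R h1]
      exact Or.inl h1
    · exact Or.inr (by rwa [hm])
  have hσF : ∀ p : {p // W'.Kept l' p}, F ⟨_, keptσ hσ' p.2⟩ = W.σ (F p) := by
    rintro ⟨p, hp⟩
    by_cases hpp : W'.σ p = p
    · have : W.σ (F ⟨p, hp⟩) = F ⟨p, hp⟩ := by
        rcases (W'.σ_eq_iff p hp.1).1 hpp with h1 | h1
        · exact σ_L ((hLF ⟨p, hp⟩).1 h1)
        · exact σ_R ((hRF ⟨p, hp⟩).1 h1)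
      rw [this]
      congr 1
      exact Subtype.ext hpp
    · have hFF : W.σ (F ⟨p, hp⟩) ≠ F ⟨p, hp⟩ := by
        have h1 := hUF ⟨p, hp⟩
        have h2 := hDF ⟨p, hp⟩
        dsimp only at h1 h2
        omega
      have g2 := hF2 ⟨p, hp⟩
      have g3 := hF3 ⟨p, hp⟩
      have g4 := hF2 ⟨_, keptσ hσ' hp⟩
      have g5 := hF3 ⟨_, keptσ hσ' hp⟩
      dsimp only at g2 g3 g4 g5
      rw [far_of_ne hpp, far_of_ne hFF] at g3
      rw [far_of_ne (p := W'.σ p) (by rw [W'.σσ]; exact fun h => hpp h.symm), W'.σσ] at g5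
      -- Passing to the other side of a bridge interchanges the two entries of the code.
      refine code_inj (hF1 _) (keptσ hσ (hF1 _)) (by rw [g4, g3]) ?_
      rw [g5, far_of_ne (by rw [W.σσ]; exact fun h => hFF h.symm), W.σσ, g2]
  classical
  refine ⟨fun p => if hp : W'.Kept l' p then F ⟨p, hp⟩ else 0, ?_, ?_, ?_, ?_, ?_, ?_, ?_, ?_⟩
  · intro p hp
    simpa only [dif_pos hp] using hF1 _
  · intro q hq
    obtain ⟨p, h1, h2, h3⟩ := exists_matching_letter hl' hσ' hv' hl hσ hv hk.symm
      (fun r => (hL r).symm) hq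
    refine ⟨p, h1, ?_⟩
    simp only [dif_pos h1]
    exact code_inj (hF1 _) hq (by rw [hF2, h2]) (by rw [hF3, h3])
  · intro p q hp hq
    simp only [dif_pos hp, dif_pos hq]
    refine ⟨mono ⟨p, hp⟩ ⟨q, hq⟩, fun h1 => ?_⟩
    rcases lt_trichotomy p q with h2 | rfl | h2
    · exact h2
    · omega
    · have := mono ⟨q, hq⟩ ⟨p, hp⟩ h2
      omega
  · intro p hp
    simp only [dif_pos hp, dif_pos (keptσ hσ' hp)]
    exact hσF ⟨p, hp⟩
  · intro p hp
    simp only [dif_pos hp]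
    exact hLF ⟨p, hp⟩
  · intro p hp
    simp only [dif_pos hp]
    exact hRF ⟨p, hp⟩
  · intro p hp
    simp only [dif_pos hp]
    exact hF2 ⟨p, hp⟩
  · intro p hp hpL hpR
    simp only [dif_pos hp]
    have up : ∀ p : {p // W'.Kept l' p}, p.1 < W'.σ p → l (F p) = l' p := by
      intro p hp
      have hFp := (hUF p).1 hp
      -- The length is the height of the top minus that of the base, and both depend on `h` and the
      -- code only.
      have e1 := height_up (l := l) hFp
      have e2 := height_up (l := l') hp
      have e3 := (hv.top_isLeast hl hFp)
      rw [hF2, hF3] at e3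
      have e4 := e3.unique (hv'.top_isLeast hl' hp)
      have e5 := hv.bottom_eq hl hFp
      have e6 := hv'.bottom_eq hl' hp
      rw [← far_of_ne hFp.ne', hF2, hF3] at e5
      rw [← far_of_ne hp.ne', ← e5] at e6
      linarith
    rcases cases_letter hp.1 with h1 | h1 | h1 | h1
    · exact absurd h1 hpL
    · exact absurd h1 hpR
    · exact up ⟨p, hp⟩ h1
    · have := up ⟨_, keptσ hσ' hp⟩ (by dsimp only; rwa [W'.σσ])
      rw [hσF ⟨p, hp⟩, hσ] at this
      rw [this]
      exact hσ' p

end Compare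

end ContourWord

/-! ### Bridges, faces and the unique cycle of a rotation system -/

lemma Equiv.Perm.SameCycle.exists_pow_eq_of_finite {X : Type*} [Finite X] {g : Equiv.Perm X}
    {x y : X} (h : g.SameCycle x y) : ∃ n, 0 < n ∧ (g ^ n) x = y := by
  obtain ⟨i, h0, -, h1⟩ := h.exists_pow_eq''
  exact ⟨i, h0, h1⟩

/-- A finite cycle is exhausted by forward iteration, so invariance under `g⁻¹` need not be checked.
-/
lemma Equiv.Perm.SameCycle.induct_of_closed {X : Type*} [Finite X] {g : Equiv.Perm X}
    {P : X → Prop} (hP : ∀ x, P x → P (g x)) {x y : X} (h : g.SameCycle x y) (hx : P x) : P y := by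
  obtain ⟨n, -, rfl⟩ := h.exists_pow_eq_of_finite
  clear h
  induction n with
  | zero => exact hx
  | succ n ih =>
    rw [pow_succ', Equiv.Perm.mul_apply]
    exact hP _ ih

lemma Equiv.Perm.sameCycle_apply_self {X : Type*} (g : Equiv.Perm X) (x : X) :
    g.SameCycle x (g x) := ⟨1, by simp⟩

namespace RayGraph

variable {k : ℕ} (Γ : RayGraph k)

/-- The darts that can be reached from the far end of `d` without crossing the edge of `d`. -/
inductive Beyond (d : Fin Γ.n) : Fin Γ.n → Prop
  | base : Beyond d (Γ.edge d)
  | rot (e : Fin Γ.n) : Beyond d e → Beyond d (Γ.rot e)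
  | edge (e : Fin Γ.n) : Beyond d e → e ≠ d → e ≠ Γ.edge d → Beyond d (Γ.edge e)

/-- The darts `d` and `e` lie on the same boundary contour. -/
def SameFace (d e : Fin Γ.n) : Prop := Γ.face.SameCycle d e

variable {Γ}

lemma face_apply (d : Fin Γ.n) : Γ.face d = Γ.rot (Γ.edge d) := rfl

lemma face_edge (d : Fin Γ.n) : Γ.face (Γ.edge d) = Γ.rot d := by
  rw [face_apply, Γ.edge_edge]

lemma edge_inj {d e : Fin Γ.n} : Γ.edge d = Γ.edge e ↔ d = e := Γ.edge.injective.eq_iff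

lemma edge_eq_iff {d e : Fin Γ.n} : Γ.edge d = e ↔ d = Γ.edge e := by
  rw [← edge_inj, Γ.edge_edge]

lemma edge_ray (i : Fin k) : Γ.edge (Γ.ray i) = Γ.ray i := (Γ.edge_eq_self_iff _).2 ⟨i, rfl⟩

lemma Beyond.sameVertex {d e f : Fin Γ.n} (h : Γ.Beyond d e) (h' : Γ.SameVertex e f) :
    Γ.Beyond d f :=
  Equiv.Perm.SameCycle.induct_of_closed (P := Γ.Beyond d) (fun e => Beyond.rot e) h' h

lemma beyond_sameVertex {d e f : Fin Γ.n} (h' : Γ.SameVertex e f) :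
    Γ.Beyond d e ↔ Γ.Beyond d f := ⟨fun h => h.sameVertex h', fun h => h.sameVertex h'.symm⟩

lemma sameVertex_rot (d : Fin Γ.n) : Γ.SameVertex d (Γ.rot d) := Γ.rot.sameCycle_apply_self d

lemma sameFace_face (d : Fin Γ.n) : Γ.SameFace d (Γ.face d) := Γ.face.sameCycle_apply_self d

lemma sameFace_edge_rot (d : Fin Γ.n) : Γ.SameFace (Γ.edge d) (Γ.rot d) := by
  rw [← face_edge]
  exact sameFace_face _

open Classical in
/-- An edge that is not a bridge lies on a cycle. -/
lemma exists_isCycle_of_beyond {d : Fin Γ.n} (hd : Γ.edge d ≠ d) (h : Γ.Beyond d d) :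
    ∃ L, Γ.IsCycle L ∧ d ∈ L := by
  let Q := Quotient (Equiv.Perm.SameCycle.setoid Γ.rot)
  let v : Fin Γ.n → Q := fun e => ⟦e⟧
  have hv : ∀ a b, v a = v b ↔ Γ.SameVertex a b := fun a b => Quotient.eq
  -- The graph on the vertices with the edge of `d` removed. A path in it from the far end of `d`
  -- back to the start of `d` is closed up by `d`.
  let G : SimpleGraph Q :=
    { Adj := fun x y => x ≠ y ∧ ∃ a, a ≠ d ∧ a ≠ Γ.edge d ∧ v a = x ∧ v (Γ.edge a) = y
      symm := ⟨by
        rintro x y ⟨hxy, a, h1, h2, h3, h4⟩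
        refine ⟨hxy.symm, Γ.edge a, fun h => h2 ?_, fun h => h1 ?_, h4, by rwa [Γ.edge_edge]⟩
        · rw [← h, Γ.edge_edge]
        · exact edge_inj.1 h⟩
      loopless := ⟨fun x hx => hx.1 rfl⟩ }
  have hreach : ∀ e, Γ.Beyond d e → G.Reachable (v (Γ.edge d)) (v e) := by
    intro e he
    induction he with
    | base => exact SimpleGraph.Reachable.refl _
    | rot e _ ih =>
      rwa [← (hv e (Γ.rot e)).2 (sameVertex_rot e)]
    | edge e _ h1 h2 ih =>
      by_cases h3 : v e = v (Γ.edge e)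
      · rwa [← h3]
      · exact ih.trans (SimpleGraph.Adj.reachable ⟨h3, e, h1, h2, rfl, rfl⟩)
  obtain ⟨p, hp⟩ := (hreach d h).exists_isPath
  set m := p.length with hm
  have hadj : ∀ i : Fin m, ∃ a, a ≠ d ∧ a ≠ Γ.edge d ∧ v a = p.getVert i ∧
      v (Γ.edge a) = p.getVert (i + 1) := fun i => (p.adj_getVert_succ i.2).2
  choose a ha1 ha2 ha3 ha4 using hadj
  -- The dart `d` comes last; if it is a loop, the path is trivial and `m = 0`.
  let c : Fin (m + 1) → Fin Γ.n := fun i => if hi : (i : ℕ) < m then a ⟨i, hi⟩ else d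
  have hc1 : ∀ i, v (c i) = p.getVert i := by
    intro i
    by_cases hi : (i : ℕ) < m
    · simp only [c, dif_pos hi, ha3]
    · simp only [c, dif_neg hi]
      rw [show (i : ℕ) = p.length by omega, p.getVert_length]
  have hc2 : ∀ i : Fin (m + 1), (i : ℕ) < m → v (Γ.edge (c i)) = p.getVert (i + 1) := by
    intro i hi
    simp only [c, dif_pos hi, ha4]
  have hinj : ∀ i j, v (c i) = v (c j) → i = j := by
    intro i j hij
    rw [hc1, hc1] at hij
    exact Fin.ext (hp.getVert_injOn (by simp; omega) (by simp; omega) hij)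
  have hne : ∀ i j : Fin (m + 1), (i : ℕ) = m → Γ.edge (c i) ≠ c j := by
    intro i j hi hij
    simp only [c, dif_neg (show ¬ (i : ℕ) < m by omega)] at hij
    by_cases hj : (j : ℕ) < m
    · simp only [dif_pos hj] at hij
      exact ha2 _ hij.symm
    · simp only [dif_neg hj] at hij
      exact hd hij
  let L : Finset (Fin Γ.n) := Finset.univ.filter fun e => ∃ i, e = c i ∨ e = Γ.edge (c i)
  refine ⟨L, ⟨m, c, ?_, fun i j hij => hinj i j ((hv _ _).2 hij), ?_, by simp [L]⟩, ?_⟩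
  · intro i
    rw [← hv, hc1]
    by_cases hi : (i : ℕ) < m
    · rw [hc2 i hi, Fin.val_add_one_of_lt' (by omega)]
    · have hil : i = Fin.last m := Fin.ext (by simp; omega)
      have : c i = d := by simp [c, hi]
      rw [this, hil]
      simp
  · intro i j hij
    by_cases hi : (i : ℕ) = m
    · exact hne i j hi hij
    by_cases hj : (j : ℕ) = m
    · exact hne j i hj (edge_eq_iff.2 hij.symm)
    -- An edge traversed in both directions would give `i + 1 = j` and `j + 1 = i`, because a path
    -- visits each vertex once.
    have h1 : p.getVert (i + 1) = p.getVert j := by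
      rw [← hc2 i (by omega), ← hc1, hij]
    have h2 : p.getVert (j + 1) = p.getVert i := by
      rw [← hc2 j (by omega), ← hc1, ← hij, Γ.edge_edge]
    have h3 := hp.getVert_injOn (by simp; omega) (by simp; omega) h1
    have h4 := hp.getVert_injOn (by simp; omega) (by simp; omega) h2
    omega
  · simp only [L, Finset.mem_filter, Finset.mem_univ, true_and]
    exact ⟨Fin.last m, Or.inl (by simp [c])⟩

end RayGraph

namespace PlaneType

open RayGraph

variable {k : ℕ} (Γ : PlaneType k)

/-- An edge whose ends stay connected after its removal lies on a cycle, hence on the only one. All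
finite edges off the cycle are therefore bridges. -/
lemma not_beyond_self {d : Fin Γ.n} (hd : Γ.edge d ≠ d) (hL : d ∉ Γ.cycle) : ¬ Γ.Beyond d d := by
  intro h
  obtain ⟨L, h1, h2⟩ := exists_isCycle_of_beyond hd h
  rw [Γ.isCycle_iff] at h1
  exact hL (h1 ▸ h2)

/-- An enumeration of the cycle by consecutive edges. -/
structure CyclePath (m : ℕ) (c : Fin (m + 1) → Fin Γ.n) : Prop where
  next : ∀ i, Γ.SameVertex (Γ.edge (c i)) (c (i + 1))
  inj : ∀ i j, Γ.SameVertex (c i) (c j) → i = j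
  ne : ∀ i j, Γ.edge (c i) ≠ c j
  mem_iff : ∀ d, d ∈ Γ.cycle ↔ ∃ i, d = c i ∨ d = Γ.edge (c i)

lemma exists_cyclePath : ∃ m c, Γ.CyclePath m c := by
  obtain ⟨m, c, h1, h2, h3, h4⟩ := (Γ.isCycle_iff Γ.cycle).2 rfl
  exact ⟨m, c, h1, h2, h3, h4⟩

variable {Γ}

lemma edge_mem_cycle {d : Fin Γ.n} : Γ.edge d ∈ Γ.cycle ↔ d ∈ Γ.cycle := by
  have key : ∀ d, d ∈ Γ.cycle → Γ.edge d ∈ Γ.cycle := by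
    obtain ⟨m, c, h⟩ := Γ.exists_cyclePath
    intro d hd
    obtain ⟨i, rfl | rfl⟩ := (h.mem_iff d).1 hd
    · exact (h.mem_iff _).2 ⟨i, Or.inr rfl⟩
    · exact (h.mem_iff _).2 ⟨i, Or.inl (Γ.edge_edge _)⟩
  refine ⟨fun h => ?_, key d⟩
  have := key _ h
  rwa [Γ.edge_edge] at this

lemma edge_ne_of_mem_cycle {d : Fin Γ.n} (hd : d ∈ Γ.cycle) : Γ.edge d ≠ d := by
  obtain ⟨m, c, h⟩ := Γ.exists_cyclePath
  obtain ⟨i, rfl | rfl⟩ := (h.mem_iff d).1 hd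
  · exact h.ne i i
  · intro h'
    rw [Γ.edge_edge] at h'
    exact h.ne i i h'.symm

lemma ray_not_mem_cycle (i : Fin k) : Γ.ray i ∉ Γ.cycle :=
  fun h => edge_ne_of_mem_cycle h (edge_ray i)

lemma connected_induct {P : Fin Γ.n → Prop} (h1 : ∀ e, P e → P (Γ.edge e))
    (h2 : ∀ e, P e → P (Γ.rot e)) {d : Fin Γ.n} (hd : P d) (e : Fin Γ.n) : P e := by
  obtain ⟨g, hg, rfl⟩ := Γ.connected d e
  induction hg using Subgroup.closure_induction generalizing d with
  | mem x hx =>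
    rcases hx with rfl | rfl
    · exact h1 _ hd
    · exact h2 _ hd
  | one => exact hd
  | mul x y _ _ hx hy => exact hx (hy hd)
  | inv x hx ih =>
    have : x.SameCycle d (x⁻¹ d) := ⟨-1, by simp⟩
    exact this.induct_of_closed (P := P) (fun e he => ih he) hd

lemma beyond_edge_iff {d e : Fin Γ.n} (h1 : e ≠ d) (h2 : e ≠ Γ.edge d) :
    Γ.Beyond d (Γ.edge e) ↔ Γ.Beyond d e := by
  refine ⟨fun h => ?_, fun h => .edge e h h1 h2⟩
  have := Beyond.edge _ h (fun h => h2 (edge_eq_iff.1 h)) (fun h => h1 (edge_inj.1 h))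
  rwa [Γ.edge_edge] at this

lemma beyond_rot_iff {d e : Fin Γ.n} : Γ.Beyond d (Γ.rot e) ↔ Γ.Beyond d e :=
  (beyond_sameVertex (sameVertex_rot e)).symm

lemma beyond_face_iff {d e : Fin Γ.n} (h1 : e ≠ d) (h2 : e ≠ Γ.edge d) :
    Γ.Beyond d (Γ.face e) ↔ Γ.Beyond d e := by
  rw [face_apply, beyond_rot_iff, beyond_edge_iff h1 h2]

lemma beyond_face_self (d : Fin Γ.n) : Γ.Beyond d (Γ.face d) := .rot _ .base

section Bridge

variable {d : Fin Γ.n} (hd : Γ.edge d ≠ d) (hL : d ∉ Γ.cycle)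
include hd hL

/-- Induction along `Beyond` shows that the two sides of a bridge are disjoint; connectedness shows
that they exhaust the graph. -/
lemma beyond_edge_swap (e : Fin Γ.n) : Γ.Beyond (Γ.edge d) e ↔ ¬ Γ.Beyond d e := by
  have hdd := Γ.not_beyond_self hd hL
  constructor
  · intro h
    induction h with
    | base => rwa [Γ.edge_edge]
    | rot e _ ih => rwa [beyond_rot_iff]
    | edge e _ h1 h2 ih =>
      rw [Γ.edge_edge] at h2
      rwa [beyond_edge_iff h2 h1]
  · have : Γ.Beyond (Γ.edge d) e ∨ Γ.Beyond d e := by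
      refine connected_induct (P := fun e => Γ.Beyond (Γ.edge d) e ∨ Γ.Beyond d e) ?_ ?_
        (Or.inr Beyond.base) e
      · intro e he
        by_cases h1 : e = d
        · rw [h1]
          exact Or.inr .base
        by_cases h2 : e = Γ.edge d
        · rw [h2]
          exact Or.inl .base
        rcases he with he | he
        · exact Or.inl (.edge _ he h2 (by rwa [Γ.edge_edge]))
        · exact Or.inr (.edge _ he h1 h2)
      · rintro e (he | he)
        · exact Or.inl (.rot _ he)
        · exact Or.inr (.rot _ he)
    tauto

/-- After `d` the contour is beyond the bridge, and it can return to `d` only by crossing back along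
`Γ.edge d`. -/
lemma sameFace_edge_of_bridge : Γ.SameFace d (Γ.edge d) := by
  by_contra hcon
  have key : ∀ n, Γ.Beyond d ((Γ.face ^ (n + 1)) d) := by
    intro n
    induction n with
    | zero => simpa using beyond_face_self d
    | succ n ih =>
      rw [pow_succ', Equiv.Perm.mul_apply]
      refine (beyond_face_iff (fun h => ?_) (fun h => ?_)).2 ih
      · rw [h] at ih
        exact Γ.not_beyond_self hd hL ih
      · exact hcon ⟨(n + 1 : ℕ), by rw [zpow_natCast, h]⟩
  obtain ⟨n, hn, h⟩ := (Equiv.Perm.SameCycle.refl Γ.face d).exists_pow_eq_of_finite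
  have := key (n - 1)
  rw [Nat.sub_add_cancel hn] at this
  rw [h] at this
  exact Γ.not_beyond_self hd hL this

-- The darts of the cycle are connected with each other without the bridge, so they all lie on one
-- side of it.
omit hd in
lemma beyond_cycle_iff {a b : Fin Γ.n} (ha : a ∈ Γ.cycle) (hb : b ∈ Γ.cycle) :
    Γ.Beyond d a ↔ Γ.Beyond d b := by
  obtain ⟨m, c, h⟩ := Γ.exists_cyclePath
  have h1 : ∀ i, Γ.Beyond d (Γ.edge (c i)) ↔ Γ.Beyond d (c i) := by
    intro i
    refine beyond_edge_iff ?_ ?_ <;> rintro e <;> apply hL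
    · exact e ▸ (h.mem_iff _).2 ⟨i, Or.inl rfl⟩
    · rw [← edge_mem_cycle, ← e]
      exact (h.mem_iff _).2 ⟨i, Or.inl rfl⟩
  have h2 : ∀ i, Γ.Beyond d (c i) ↔ Γ.Beyond d (c 0) := by
    intro i
    induction i using Fin.induction with
    | zero => rfl
    | succ i ih =>
      rw [← Fin.coeSucc_eq_succ]
      exact (beyond_sameVertex (h.next _)).symm.trans ((h1 _).trans ih)
  have h3 : ∀ a ∈ Γ.cycle, Γ.Beyond d a ↔ Γ.Beyond d (c 0) := by
    intro a ha
    obtain ⟨i, rfl | rfl⟩ := (h.mem_iff a).1 ha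
    · exact h2 i
    · rw [h1, h2]
  rw [h3 a ha, h3 b hb]

end Bridge

lemma sameFace_edge {d : Fin Γ.n} (hL : d ∉ Γ.cycle) : Γ.SameFace d (Γ.edge d) := by
  by_cases hd : Γ.edge d = d
  · rw [hd]
    exact Equiv.Perm.SameCycle.refl _ _
  · exact sameFace_edge_of_bridge hd hL

lemma sameFace_rot {d : Fin Γ.n} (hL : d ∉ Γ.cycle) : Γ.SameFace d (Γ.rot d) :=
  (sameFace_edge hL).trans (sameFace_edge_rot d)

/-- The edge of `d` is a bridge, and `d` points away from the cycle. -/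
def Up (Γ : PlaneType k) (d : Fin Γ.n) : Prop :=
  Γ.edge d ≠ d ∧ d ∉ Γ.cycle ∧ ∀ c ∈ Γ.cycle, ¬ Γ.Beyond d c

lemma cycle_nonempty : Γ.cycle.Nonempty := by
  obtain ⟨m, c, h⟩ := Γ.exists_cyclePath
  exact ⟨c 0, (h.mem_iff _).2 ⟨0, Or.inl rfl⟩⟩

/-- The cycle lies on exactly one side of a bridge, so exactly one of its two darts points away. -/
lemma up_edge_iff {d : Fin Γ.n} (hd : Γ.edge d ≠ d) (hL : d ∉ Γ.cycle) :
    Γ.Up (Γ.edge d) ↔ ¬ Γ.Up d := by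
  obtain ⟨c, hc⟩ := cycle_nonempty (Γ := Γ)
  have h1 : Γ.Up d ↔ ¬ Γ.Beyond d c := by
    refine ⟨fun h => h.2.2 c hc, fun h => ⟨hd, hL, fun c' hc' h' => h ?_⟩⟩
    exact (beyond_cycle_iff hL hc hc').2 h'
  have hd' : Γ.edge (Γ.edge d) ≠ Γ.edge d := by
    rw [Γ.edge_edge]
    exact hd.symm
  have hL' : Γ.edge d ∉ Γ.cycle := by rwa [edge_mem_cycle]
  have h2 : Γ.Up (Γ.edge d) ↔ ¬ Γ.Beyond (Γ.edge d) c := by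
    refine ⟨fun h => h.2.2 c hc, fun h => ⟨hd', hL', fun c' hc' h' => h ?_⟩⟩
    exact (beyond_cycle_iff hL' hc hc').2 h'
  rw [h1, h2, beyond_edge_swap hd hL]

lemma Up.not_edge {d : Fin Γ.n} (h : Γ.Up d) : ¬ Γ.Up (Γ.edge d) := by
  rw [up_edge_iff h.1 h.2.1]
  exact not_not.2 h

lemma Up.not_beyond_self {d : Fin Γ.n} (h : Γ.Up d) : ¬ Γ.Beyond d d :=
  Γ.not_beyond_self h.1 h.2.1

/-- Induction on the number of darts beyond `d`. The next dart `e` of the contour is not the way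
back, by the valence condition; it is a ray, or a bridge pointing away with fewer darts beyond it.
-/
lemma Up.exists_ray {d : Fin Γ.n} (h : Γ.Up d) : ∃ i, Γ.SameFace (Γ.ray i) d := by
  classical
  induction hn : (Finset.univ.filter (Γ.Beyond d)).card using Nat.strong_induction_on
    generalizing d with
  | _ n ih =>
  set e := Γ.face d with he
  have hed : Γ.Beyond d e := beyond_face_self d
  have hne : e ≠ Γ.edge d := (Γ.three_le_valence _).1
  have heL : e ∉ Γ.cycle := fun h' => h.2.2 _ h' hed
  have hde : Γ.SameFace d e := sameFace_face d
  by_cases hee : Γ.edge e = e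
  · obtain ⟨i, hi⟩ := (Γ.edge_eq_self_iff e).1 hee
    exact ⟨i, by rw [hi]; exact hde.symm⟩
  · have h1 := Γ.not_beyond_self hee heL
    have h2 : ¬ Γ.Beyond e (Γ.edge d) := fun h' => h1 (h'.sameVertex (sameVertex_rot _))
    have hed' : e ≠ d := by
      rintro h'
      rw [h'] at hed
      exact h.not_beyond_self hed
    have hsub : ∀ f, Γ.Beyond e f → Γ.Beyond d f := by
      intro f hf
      induction hf with
      | base => exact .edge _ hed hed' hne
      | rot f _ ih => exact .rot _ ih
      | edge f hf h3 h4 ih =>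
        refine .edge _ ih ?_ ?_
        · rintro rfl
          exact h.not_beyond_self ih
        · rintro rfl
          exact h2 hf
    have hup : Γ.Up e := ⟨hee, heL, fun c hc h' => h.2.2 c hc (hsub c h')⟩
    have hcard : (Finset.univ.filter (Γ.Beyond e)).card < n := by
      rw [← hn]
      apply Finset.card_lt_card
      rw [Finset.ssubset_iff_of_subset]
      · exact ⟨e, by simpa using hed, by simpa using h1⟩
      · intro f
        simpa using hsub f
    obtain ⟨i, hi⟩ := ih _ hcard hup rfl
    exact ⟨i, hi.trans hde.symm⟩

lemma exists_ray_of_not_mem_cycle {d : Fin Γ.n} (hL : d ∉ Γ.cycle) :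
    ∃ i, Γ.SameFace (Γ.ray i) d := by
  by_cases hd : Γ.edge d = d
  · obtain ⟨i, rfl⟩ := (Γ.edge_eq_self_iff d).1 hd
    exact ⟨i, Equiv.Perm.SameCycle.refl _ _⟩
  · by_cases hu : Γ.Up d
    · exact hu.exists_ray
    · obtain ⟨i, hi⟩ := ((up_edge_iff hd hL).2 hu).exists_ray
      exact ⟨i, hi.trans (sameFace_edge hL).symm⟩

namespace CyclePath

variable {m : ℕ} {c : Fin (m + 1) → Fin Γ.n} (h : Γ.CyclePath m c)
include h

lemma mem (i : Fin (m + 1)) : c i ∈ Γ.cycle := (h.mem_iff _).2 ⟨i, Or.inl rfl⟩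

lemma reverse : Γ.CyclePath m (fun i => Γ.edge (c (-i))) where
  next i := by
    have := h.next (-(i + 1))
    rw [show -(i + 1) + 1 = -i by rw [neg_add, neg_add_cancel_right]] at this
    rw [Γ.edge_edge]
    exact this.symm
  inj i j hij := by
    have := h.inj (-i + 1) (-j + 1) (((h.next _).symm.trans hij).trans (h.next _))
    simpa using this
  ne i j hij := h.ne (-j) (-i) (by rw [← hij, Γ.edge_edge])
  mem_iff d := by
    rw [h.mem_iff]
    simp only [Γ.edge_edge]
    constructor
    · rintro ⟨i, hi⟩
      exact ⟨-i, by rw [neg_neg]; exact hi.symm⟩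
    · rintro ⟨i, hi⟩
      exact ⟨-i, hi.symm⟩

lemma eq_or_eq {i : Fin (m + 1)} {d : Fin Γ.n} (hd : d ∈ Γ.cycle)
    (hv : Γ.SameVertex (c (i + 1)) d) : d = c (i + 1) ∨ d = Γ.edge (c i) := by
  obtain ⟨j, rfl | rfl⟩ := (h.mem_iff d).1 hd
  · left
    rw [h.inj _ _ hv]
  · right
    have := h.inj _ _ (hv.trans (h.next j))
    rw [add_left_inj] at this
    rw [this]

/-- Turning around a vertex of the cycle from one edge of the cycle to the next one. -/
lemma exists_turn (i : Fin (m + 1)) : ∃ t, 0 < t ∧ (Γ.rot ^ t) (Γ.edge (c i)) = c (i + 1) ∧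
    ∀ l, 0 < l → l < t → (Γ.rot ^ l) (Γ.edge (c i)) ∉ Γ.cycle := by
  classical
  have hex := (h.next i).exists_pow_eq_of_finite
  refine ⟨Nat.find hex, (Nat.find_spec hex).1, (Nat.find_spec hex).2, fun l h0 hl hmem => ?_⟩
  have hv : Γ.SameVertex (c (i + 1)) ((Γ.rot ^ l) (Γ.edge (c i))) :=
    (h.next i).symm.trans ⟨l, by simp⟩
  rcases h.eq_or_eq hmem hv with e | e
  · exact Nat.find_min hex hl ⟨h0, e⟩
  · refine Nat.find_min hex (m := Nat.find hex - l) (by omega) ⟨by omega, ?_⟩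
    have := (Nat.find_spec hex).2
    rw [← Nat.sub_add_cancel hl.le, pow_add, Equiv.Perm.mul_apply, e] at this
    exact this

/-- A combinatorial Jordan curve theorem. `Z` collects one side of the cycle: the darts `c i`, those
met when turning from `Γ.edge (c i)` to `c (i + 1)`, and what lies beyond the bridges among them. It
is closed under `face` and misses the reversed darts. -/
lemma not_sameFace (i j : Fin (m + 1)) : ¬ Γ.SameFace (c i) (Γ.edge (c j)) := by
  choose t ht0 ht1 ht2 using h.exists_turn
  let Z : Fin Γ.n → Prop := fun e => (∃ i, e = c i) ∨ ∃ i l, 0 < l ∧ l < t i ∧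
    (e = (Γ.rot ^ l) (Γ.edge (c i)) ∨ (Γ.edge ((Γ.rot ^ l) (Γ.edge (c i))) ≠
      (Γ.rot ^ l) (Γ.edge (c i)) ∧ Γ.Beyond ((Γ.rot ^ l) (Γ.edge (c i))) e))
  have hturn : ∀ i l, l < t i → Z (Γ.rot ((Γ.rot ^ l) (Γ.edge (c i)))) := by
    intro i l hl
    rw [← Equiv.Perm.mul_apply, ← pow_succ']
    rcases (Nat.succ_le_of_lt hl).lt_or_eq with h1 | h1
    · exact Or.inr ⟨i, l + 1, by omega, h1, Or.inl rfl⟩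
    · rw [Nat.succ_eq_add_one] at h1
      rw [h1, ht1]
      exact Or.inl ⟨i + 1, rfl⟩
  have hZ : ∀ e, Z e → Z (Γ.face e) := by
    rintro e (⟨i, rfl⟩ | ⟨i, l, h0, hl, h1⟩)
    · exact hturn i 0 (ht0 i)
    · set a := (Γ.rot ^ l) (Γ.edge (c i)) with ha
      have haL : a ∉ Γ.cycle := ht2 i l h0 hl
      have haa := fun hh => Γ.not_beyond_self (d := a) hh haL
      by_cases hae : Γ.edge a = a
      · rcases h1 with rfl | h1
        · rw [face_apply, hae]
          exact hturn i l hl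
        · exact absurd hae h1.1
      · rcases h1 with rfl | h1
        · exact Or.inr ⟨i, l, h0, hl, Or.inr ⟨hae, beyond_face_self _⟩⟩
        · by_cases h2 : e = Γ.edge a
          · rw [h2, face_edge]
            exact hturn i l hl
          · refine Or.inr ⟨i, l, h0, hl, Or.inr ⟨hae, (beyond_face_iff ?_ h2).2 h1.2⟩⟩
            intro h3
            rw [h3] at h1
            exact haa hae h1.2
  intro hij
  rcases hij.induct_of_closed hZ (Or.inl ⟨i, rfl⟩) with ⟨i', h1⟩ | ⟨i', l, h0, hl, h1⟩
  · exact h.ne _ _ h1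
  · have haL := ht2 i' l h0 hl
    have hjL : Γ.edge (c j) ∈ Γ.cycle := edge_mem_cycle.2 (h.mem j)
    rcases h1 with h1 | ⟨h1, h2⟩
    · exact haL (h1 ▸ hjL)
    -- If one cycle dart were beyond the bridge, so would be the whole cycle, including the vertex
    -- where the bridge starts.
    · rw [beyond_cycle_iff haL hjL (h.mem (i' + 1))] at h2
      exact Γ.not_beyond_self h1 haL (h2.sameVertex ((h.next i').symm.trans ⟨l, by simp⟩))

/-- The darts met on the turn from one cycle edge to the next are off the cycle, so turning past
them does not leave the face. -/
lemma sameFace_next (i : Fin (m + 1)) : Γ.SameFace (c i) (c (i + 1)) := by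
  obtain ⟨t, h0, h1, h2⟩ := h.exists_turn i
  have key : ∀ l, l < t → Γ.SameFace (c i) ((Γ.rot ^ (l + 1)) (Γ.edge (c i))) := by
    intro l hl
    induction l with
    | zero => simpa [face_apply] using sameFace_face (Γ := Γ.toRayGraph) (c i)
    | succ l ih =>
      refine (ih (by omega)).trans ?_
      rw [pow_succ' _ (l + 1), Equiv.Perm.mul_apply]
      exact sameFace_rot (h2 _ (by omega) hl)
  have := key (t - 1) (by omega)
  rwa [Nat.sub_add_cancel h0, h1] at this

lemma sameFace_zero (i : Fin (m + 1)) : Γ.SameFace (c 0) (c i) := by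
  induction i using Fin.induction with
  | zero => exact Equiv.Perm.SameCycle.refl _ _
  | succ i ih =>
    rw [← Fin.coeSucc_eq_succ]
    exact ih.trans (h.sameFace_next _)

lemma sameFace (i j : Fin (m + 1)) : Γ.SameFace (c i) (c j) :=
  (h.sameFace_zero i).symm.trans (h.sameFace_zero j)

/-- The union of the faces on the two sides of the cycle is closed under `edge` and `rot`, and the
graph is connected. -/
lemma sameFace_or (e : Fin Γ.n) : Γ.SameFace (c 0) e ∨ Γ.SameFace (Γ.edge (c 0)) e := by
  have hr : ∀ i j, Γ.SameFace (Γ.edge (c i)) (Γ.edge (c j)) := by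
    intro i j
    have := h.reverse.sameFace (-i) (-j)
    simpa only [neg_neg] using this
  have hedge : ∀ e, Γ.SameFace (c 0) e ∨ Γ.SameFace (Γ.edge (c 0)) e →
      Γ.SameFace (c 0) (Γ.edge e) ∨ Γ.SameFace (Γ.edge (c 0)) (Γ.edge e) := by
    intro e he
    by_cases heL : e ∈ Γ.cycle
    · obtain ⟨i, rfl | rfl⟩ := (h.mem_iff e).1 heL
      · exact Or.inr (hr _ _)
      · rw [Γ.edge_edge]
        exact Or.inl (h.sameFace _ _)
    · exact he.imp (fun h' => h'.trans (sameFace_edge heL)) fun h' => h'.trans (sameFace_edge heL)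
  refine connected_induct hedge ?_ (Or.inl (Equiv.Perm.SameCycle.refl _ (c 0))) e
  intro e he
  exact (hedge e he).imp (fun h' => h'.trans (sameFace_edge_rot e))
    fun h' => h'.trans (sameFace_edge_rot e)

end CyclePath

end PlaneType

/-! ### Labels of the rays, gaps and the outer face -/

lemma finRotate_pow_val {n : ℕ} (r : ℕ) (i : Fin (n + 1)) :
    (((finRotate (n + 1)) ^ r) i : ℕ) = (i + r) % (n + 1) := by
  induction r with
  | zero => simp [Nat.mod_eq_of_lt i.2]
  | succ r ih =>
    rw [pow_succ', Equiv.Perm.mul_apply, finRotate_apply, Fin.val_add, ih]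
    simp [add_assoc]

lemma finRotate_pow_inj {k : ℕ} (i : Fin k) {r s : ℕ} (hr : r < k) (hs : s < k)
    (h : ((finRotate k) ^ r) i = ((finRotate k) ^ s) i) : r = s := by
  obtain ⟨n, rfl⟩ : ∃ n, k = n + 1 := ⟨k - 1, by omega⟩
  have h1 := congrArg Fin.val h
  rw [finRotate_pow_val, finRotate_pow_val] at h1
  have := Nat.ModEq.add_left_cancel' (i : ℕ) h1
  rwa [Nat.ModEq, Nat.mod_eq_of_lt hr, Nat.mod_eq_of_lt hs] at this

lemma exists_finRotate_pow {k : ℕ} (i j : Fin k) : ∃ r < k, ((finRotate k) ^ r) i = j := by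
  obtain ⟨n, rfl⟩ : ∃ n, k = n + 1 := ⟨k - 1, by have := i.2; omega⟩
  refine ⟨(j + (n + 1 - i)) % (n + 1), Nat.mod_lt _ (by omega), Fin.ext ?_⟩
  rw [finRotate_pow_val, Nat.add_mod_mod,
    show (i : ℕ) + (j + (n + 1 - i)) = j + (n + 1) by have := i.2; omega]
  simp [Nat.mod_eq_of_lt j.2]

lemma finRotate_pow_self {k : ℕ} (i : Fin k) : ((finRotate k) ^ k) i = i := by
  obtain ⟨n, rfl⟩ : ∃ n, k = n + 1 := ⟨k - 1, by have := i.2; omega⟩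
  apply Fin.ext
  rw [finRotate_pow_val]
  simp [Nat.mod_eq_of_lt i.2]

namespace RayGraph

variable {k : ℕ} {Γ : RayGraph k}

/-- Walking along the boundary contour from `e`, the first ray is ray `j`. -/
def NextRay (Γ : RayGraph k) (e : Fin Γ.n) (j : Fin k) : Prop :=
  ∃ m : ℕ, (Γ.face ^ m) e = Γ.ray j ∧ ∀ l < m, (Γ.face ^ l) e ∉ Set.range Γ.ray

lemma nextRay_ray (j : Fin k) : Γ.NextRay (Γ.ray j) j := ⟨0, rfl, by simp⟩

lemma NextRay.unique {e : Fin Γ.n} {i j : Fin k} (hi : Γ.NextRay e i) (hj : Γ.NextRay e j) :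
    i = j := by
  obtain ⟨m, h1, h2⟩ := hi
  obtain ⟨n, h3, h4⟩ := hj
  rcases lt_trichotomy m n with h | rfl | h
  · exact absurd ⟨i, h1.symm⟩ (h4 m h)
  · exact Γ.ray_injective (h1.symm.trans h3)
  · exact absurd ⟨j, h3.symm⟩ (h2 n h)

lemma nextRay_face_iff {e : Fin Γ.n} (he : e ∉ Set.range Γ.ray) {j : Fin k} :
    Γ.NextRay (Γ.face e) j ↔ Γ.NextRay e j := by
  constructor
  · rintro ⟨m, h1, h2⟩
    refine ⟨m + 1, by rwa [pow_succ, Equiv.Perm.mul_apply], fun l hl => ?_⟩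
    rcases l with _ | l
    · exact he
    · rw [pow_succ, Equiv.Perm.mul_apply]
      exact h2 l (by omega)
  · rintro ⟨m, h1, h2⟩
    rcases m with _ | m
    · exact absurd ⟨j, h1.symm⟩ he
    · rw [pow_succ, Equiv.Perm.mul_apply] at h1
      refine ⟨m, h1, fun l hl => ?_⟩
      have := h2 (l + 1) (by omega)
      rwa [pow_succ, Equiv.Perm.mul_apply] at this

lemma NextRay.sameFace {e : Fin Γ.n} {j : Fin k} (h : Γ.NextRay e j) :
    Γ.SameFace (Γ.ray j) e := by
  obtain ⟨m, h1, -⟩ := h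
  refine Equiv.Perm.SameCycle.symm ⟨m, ?_⟩
  rw [zpow_natCast, h1]

lemma exists_nextRay {e : Fin Γ.n} {i : Fin k} (h : Γ.SameFace (Γ.ray i) e) :
    ∃ j, Γ.NextRay e j := by
  classical
  have hex : ∃ m, (Γ.face ^ m) e ∈ Set.range Γ.ray := by
    obtain ⟨m, -, h1⟩ := h.symm.exists_pow_eq_of_finite
    exact ⟨m, i, h1.symm⟩
  obtain ⟨j, hj⟩ := Nat.find_spec hex
  exact ⟨j, Nat.find hex, hj.symm, fun l hl => Nat.find_min hex hl⟩

end RayGraph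

namespace PlaneType

open RayGraph

variable {k : ℕ} {Γ : PlaneType k}

lemma nextRay_face_ray (i : Fin k) : Γ.NextRay (Γ.face (Γ.ray i)) (finRotate k i) := by
  obtain ⟨m, h0, h1, -, h2⟩ := Γ.ray_order i
  rcases m with _ | m
  · omega
  · rw [pow_succ, Equiv.Perm.mul_apply] at h1
    refine ⟨m, h1, fun l hl => ?_⟩
    have := h2 (l + 1) (by omega) (by omega)
    rwa [pow_succ, Equiv.Perm.mul_apply] at this

lemma sameFace_ray (i j : Fin k) : Γ.SameFace (Γ.ray i) (Γ.ray j) := by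
  obtain ⟨r, -, rfl⟩ := exists_finRotate_pow i j
  induction r with
  | zero => exact Equiv.Perm.SameCycle.refl _ _
  | succ r ih =>
    rw [pow_succ', Equiv.Perm.mul_apply]
    exact (ih.trans (sameFace_face _)).trans (nextRay_face_ray _).sameFace.symm

/-- The dart `d` lies on the boundary contour of the face that contains the rays. -/
def Outer (Γ : PlaneType k) (d : Fin Γ.n) : Prop := ∃ i, Γ.SameFace (Γ.ray i) d

lemma outer_of_not_mem_cycle {d : Fin Γ.n} (hd : d ∉ Γ.cycle) : Γ.Outer d :=
  exists_ray_of_not_mem_cycle hd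

lemma Outer.of_sameFace {d e : Fin Γ.n} (hd : Γ.Outer d) (h : Γ.SameFace d e) : Γ.Outer e := by
  obtain ⟨i, hi⟩ := hd
  exact ⟨i, hi.trans h⟩

lemma outer_face {d : Fin Γ.n} : Γ.Outer (Γ.face d) ↔ Γ.Outer d :=
  ⟨fun h => h.of_sameFace (sameFace_face d).symm, fun h => h.of_sameFace (sameFace_face d)⟩

lemma Outer.sameFace {d e : Fin Γ.n} (hd : Γ.Outer d) (he : Γ.Outer e) : Γ.SameFace d e := by
  obtain ⟨i, hi⟩ := hd
  obtain ⟨j, hj⟩ := he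
  exact hi.symm.trans ((sameFace_ray i j).trans hj)

/-- The rays lie in the face on one of the two sides of the cycle; the orientation is reversed if
necessary. -/
lemma exists_outer_cyclePath (i₀ : Fin k) :
    ∃ m c, Γ.CyclePath m c ∧ ∀ i, Γ.Outer (c i) ∧ ¬ Γ.Outer (Γ.edge (c i)) := by
  have key : ∀ m c, Γ.CyclePath m c → Γ.SameFace (c 0) (Γ.ray i₀) →
      ∀ i, Γ.Outer (c i) ∧ ¬ Γ.Outer (Γ.edge (c i)) := by
    intro m c h h1 i
    have h2 : Γ.Outer (c i) := ⟨i₀, h1.symm.trans (h.sameFace _ _)⟩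
    exact ⟨h2, fun h3 => h.not_sameFace i i (h2.sameFace h3)⟩
  obtain ⟨m, c, h⟩ := Γ.exists_cyclePath
  rcases h.sameFace_or (Γ.ray i₀) with h1 | h1
  · exact ⟨m, c, h, key m c h h1⟩
  · exact ⟨m, _, h.reverse, key m _ h.reverse (by simpa using h1)⟩

lemma outer_edge_iff [NeZero k] {d : Fin Γ.n} (hd : d ∈ Γ.cycle) :
    Γ.Outer (Γ.edge d) ↔ ¬ Γ.Outer d := by
  obtain ⟨m, c, h, hc⟩ := exists_outer_cyclePath (Γ := Γ) 0
  obtain ⟨i, rfl | rfl⟩ := (h.mem_iff d).1 hd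
  · have := hc i
    tauto
  · rw [Γ.edge_edge]
    have := hc i
    tauto

/-- Of the two cycle darts at a vertex of the cycle, one belongs to the outer face and one to the
inner face. -/
lemma eq_of_sameVertex [NeZero k] {d e : Fin Γ.n} (hd : d ∈ Γ.cycle) (he : e ∈ Γ.cycle)
    (hv : Γ.SameVertex d e) (ho : Γ.Outer d ↔ Γ.Outer e) : d = e := by
  obtain ⟨m, c, h, hc⟩ := exists_outer_cyclePath (Γ := Γ) 0
  obtain ⟨i, hi⟩ : ∃ i, Γ.SameVertex (c (i + 1)) d := by
    obtain ⟨i, rfl | rfl⟩ := (h.mem_iff d).1 hd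
    · exact ⟨i - 1, by rw [sub_add_cancel]; exact Equiv.Perm.SameCycle.refl _ _⟩
    · exact ⟨i, (h.next i).symm⟩
  have h1 := hc i
  have h2 := hc (i + 1)
  rcases h.eq_or_eq hd hi with rfl | rfl <;> rcases h.eq_or_eq he (hi.trans hv) with rfl | rfl
  · rfl
  · tauto
  · tauto
  · rfl

/-! ### Heights, cycle gaps and valleys of a graph -/

section Height

open Classical in
/-- The distance of the starting point of `e` from the cycle. -/
noncomputable def ht (Γ : PlaneType k) (ℓ : Fin Γ.n → ℝ) (e : Fin Γ.n) : ℝ :=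
  ∑ d with Γ.Up d ∧ Γ.Beyond d e, ℓ d

variable {ℓ : Fin Γ.n → ℝ}

lemma ht_rot (e : Fin Γ.n) : Γ.ht ℓ (Γ.rot e) = Γ.ht ℓ e := by
  unfold ht
  congr 1
  ext d
  simp only [Finset.mem_filter, beyond_rot_iff]

/-- Crossing the edge of `e` affects `Beyond d` only for the two darts `d` of this edge, and only
one of them is `Up`. -/
lemma ht_edge_of_up {e : Fin Γ.n} (h : Γ.Up e) : Γ.ht ℓ (Γ.edge e) = Γ.ht ℓ e + ℓ e := by
  classical
  unfold ht
  rw [add_comm _ (ℓ e), ← Finset.sum_insert (by simp [h.not_beyond_self])]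
  congr 1
  ext d
  simp only [Finset.mem_filter, Finset.mem_univ, true_and, Finset.mem_insert]
  constructor
  · rintro ⟨h1, h2⟩
    by_cases hde : d = e
    · exact Or.inl hde
    · refine Or.inr ⟨h1, (beyond_edge_iff (Ne.symm hde) fun h' => ?_).1 h2⟩
      rw [h'] at h
      exact h1.not_edge h
  · rintro (rfl | ⟨h1, h2⟩)
    · exact ⟨h, .base⟩
    · refine ⟨h1, .edge _ h2 ?_ ?_⟩
      · rintro rfl
        exact h1.not_beyond_self h2
      · rintro rfl
        exact h1.not_edge h

lemma ht_cycle {e : Fin Γ.n} (h : e ∈ Γ.cycle) : Γ.ht ℓ e = 0 := by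
  classical
  unfold ht
  rw [Finset.filter_false_of_mem, Finset.sum_empty]
  rintro d - ⟨h1, h2⟩
  exact h1.2.2 e h h2

lemma ht_nonneg (h : ∀ d, 0 ≤ ℓ d) (e : Fin Γ.n) : 0 ≤ Γ.ht ℓ e :=
  Finset.sum_nonneg fun _ _ => h _

lemma up_or (e : Fin Γ.n) : e ∈ Γ.cycle ∨ e ∈ Set.range Γ.ray ∨ Γ.Up e ∨ Γ.Up (Γ.edge e) := by
  by_cases h1 : e ∈ Γ.cycle
  · exact Or.inl h1
  by_cases h2 : Γ.edge e = e
  · exact Or.inr (Or.inl ((Γ.edge_eq_self_iff e).1 h2))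
  · rw [up_edge_iff h2 h1]
    tauto

/-- The height is the only function that is constant on vertices, vanishes on the cycle, and
grows along the bridges by their lengths. -/
lemma eq_ht {η : Fin Γ.n → ℝ} (h1 : ∀ e, η (Γ.rot e) = η e) (h2 : ∀ e ∈ Γ.cycle, η e = 0)
    (h3 : ∀ e, Γ.Up e → η (Γ.edge e) = η e + ℓ e) (e : Fin Γ.n) : η e = Γ.ht ℓ e := by
  obtain ⟨c, hc⟩ := cycle_nonempty (Γ := Γ)
  refine connected_induct (P := fun e => η e = Γ.ht ℓ e) ?_ ?_
    ((h2 c hc).trans (ht_cycle hc).symm) e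
  · intro e he
    rcases up_or e with h | ⟨i, rfl⟩ | h | h
    · rw [h2 _ (edge_mem_cycle.2 h), ht_cycle (edge_mem_cycle.2 h)]
    · rwa [edge_ray]
    · rw [h3 e h, ht_edge_of_up h, he]
    · have h4 := h3 _ h
      have h5 := ht_edge_of_up (ℓ := ℓ) h
      rw [Γ.edge_edge] at h4 h5
      linarith
  · intro e he
    rw [h1, ht_rot, he]

lemma ht_face (e : Fin Γ.n) : Γ.ht ℓ (Γ.face e) = Γ.ht ℓ (Γ.edge e) := ht_rot _

end Height

open Classical in
/-- The length of the part of the cycle that is seen between ray `j` and the ray before it. -/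
noncomputable def cycleGap (Γ : PlaneType k) (ℓ : Fin Γ.n → ℝ) (j : Fin k) : ℝ :=
  ∑ e with e ∈ Γ.cycle ∧ Γ.NextRay e j, ℓ e

open Classical in
lemma nextRay_nonempty (j : Fin k) :
    (Finset.univ.filter fun e => Γ.NextRay e j).Nonempty :=
  ⟨Γ.ray j, by simpa using nextRay_ray j⟩

open Classical in
/-- The height of the lowest point between ray `j` and the ray before it. -/
noncomputable def valley (Γ : PlaneType k) (ℓ : Fin Γ.n → ℝ) (j : Fin k) : ℝ :=
  (Finset.univ.filter fun e => Γ.NextRay e j).inf' (nextRay_nonempty j) (Γ.ht ℓ)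

lemma valley_isLeast (ℓ : Fin Γ.n → ℝ) (j : Fin k) :
    IsLeast {x | ∃ e, Γ.NextRay e j ∧ Γ.ht ℓ e = x} (Γ.valley ℓ j) := by
  classical
  constructor
  · obtain ⟨e, he, h⟩ := Finset.exists_mem_eq_inf' (nextRay_nonempty (Γ := Γ) j) (Γ.ht ℓ)
    exact ⟨e, by simpa using he, h.symm⟩
  · rintro x ⟨e, he, rfl⟩
    exact Finset.inf'_le _ (by simpa using he)

/-! ### The contour word of a graph -/

section Word

variable [NeZero k] (s : Fin Γ.n)

/-- The dart at position `p` of the boundary contour that starts at `s`. -/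
def letter (s : Fin Γ.n) (p : ℕ) : Fin Γ.n := (Γ.face ^ p) s

/-- The length of the boundary contour of `s`. -/
noncomputable def contourLength (s : Fin Γ.n) : ℕ := Function.minimalPeriod Γ.face s

omit [NeZero k] in
lemma letter_zero : letter s 0 = s := rfl

omit [NeZero k] in
lemma letter_succ (p : ℕ) : letter s (p + 1) = Γ.face (letter s p) := by
  rw [letter, pow_succ', Equiv.Perm.mul_apply, letter]

omit [NeZero k] in
lemma letter_eq_iterate (p : ℕ) : letter s p = Γ.face^[p] s := by
  rw [letter, Equiv.Perm.iterate_eq_pow]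

omit [NeZero k] in
lemma contourLength_pos : 0 < contourLength s := by
  obtain ⟨n, h0, h1⟩ := (Equiv.Perm.SameCycle.refl Γ.face s).exists_pow_eq_of_finite
  refine Function.IsPeriodicPt.minimalPeriod_pos h0 ?_
  rw [Function.IsPeriodicPt, Function.IsFixedPt, Equiv.Perm.iterate_eq_pow, h1]

omit [NeZero k] in
lemma letter_length : letter s (contourLength s) = s := by
  rw [letter_eq_iterate]
  exact Function.iterate_minimalPeriod

variable {s}

omit [NeZero k] in
lemma letter_inj {p q : ℕ} (hp : p < contourLength s) (hq : q < contourLength s)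
    (h : letter s p = letter s q) : p = q := by
  rw [letter_eq_iterate, letter_eq_iterate] at h
  exact Function.iterate_injOn_Iio_minimalPeriod hp hq h

omit [NeZero k] in
lemma outer_letter (hs : Γ.Outer s) (p : ℕ) : Γ.Outer (letter s p) :=
  hs.of_sameFace ⟨p, by simp [letter]⟩

omit [NeZero k] in
lemma exists_letter (hs : Γ.Outer s) {d : Fin Γ.n} (hd : Γ.Outer d) :
    ∃ p < contourLength s, letter s p = d := by
  obtain ⟨n, -, h⟩ := (hs.sameFace hd).exists_pow_eq_of_finite
  refine ⟨n % contourLength s, Nat.mod_lt _ (contourLength_pos s), ?_⟩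
  rw [letter_eq_iterate, contourLength, Function.iterate_mod_minimalPeriod_eq,
    Equiv.Perm.iterate_eq_pow, h]

omit [NeZero k] in
/-- The part of the contour beyond a bridge is an interval. -/
lemma beyond_letter_iff (hsL : s ∈ Γ.cycle) {p q r : ℕ} (hp : p < contourLength s)
    (hq : q < contourLength s) (hr : r ≤ contourLength s) (hup : Γ.Up (letter s p))
    (hpq : letter s q = Γ.edge (letter s p)) :
    Γ.Beyond (letter s p) (letter s r) ↔ p < r ∧ r ≤ q := by
  set d := letter s p with hd
  have hdd := hup.not_beyond_self
  -- The contour starts on the cycle, hence not beyond the bridge, and only letter `p` leads across.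
  have c1 : ∀ r ≤ p, ¬ Γ.Beyond d (letter s r) := by
    intro r
    induction r with
    | zero => exact fun _ => hup.2.2 s hsL
    | succ r ih =>
      intro hr
      have ih := ih (by omega)
      rw [letter_succ, beyond_face_iff]
      · exact ih
      · intro h
        have := letter_inj (by omega) hp h
        omega
      · intro h
        rw [h] at ih
        exact ih .base
  have hlt : p < q := by
    by_contra h
    apply c1 q (by omega)
    rw [hpq]
    exact .base
  have c2 : ∀ r, p < r → r ≤ q → Γ.Beyond d (letter s r) := by
    intro r hr
    induction r, hr using Nat.le_induction with
    | base =>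
      intro _
      rw [Nat.succ_eq_add_one, letter_succ]
      exact beyond_face_self d
    | succ r hr ih =>
      intro h1
      have ih := ih (by omega)
      rw [letter_succ, beyond_face_iff]
      · exact ih
      · intro h
        rw [h] at ih
        exact hdd ih
      · intro h
        rw [← hpq] at h
        have := letter_inj (by omega) hq h
        omega
  -- After the return at `q`, the dart `d` would have to occur a second time within the period.
  have c3 : ∀ r, q < r → r ≤ contourLength s → ¬ Γ.Beyond d (letter s r) := by
    intro r hr
    induction r, hr using Nat.le_induction with
    | base =>
      intro _
      rw [Nat.succ_eq_add_one, letter_succ, hpq, face_edge, beyond_rot_iff]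
      exact hdd
    | succ r hr ih =>
      intro h1
      have ih := ih (by omega)
      rw [letter_succ, beyond_face_iff]
      · exact ih
      · intro h
        have := letter_inj (by omega) hp h
        omega
      · intro h
        rw [h] at ih
        exact ih .base
  constructor
  · intro h
    constructor
    · by_contra h1
      exact c1 r (by omega) h
    · by_contra h1
      exact c3 r (by omega) hr h
  · rintro ⟨h1, h2⟩
    exact c2 r h1 h2

open Classical in
/-- The position of the other side of the edge of a bridge. -/
noncomputable def partner (s : Fin Γ.n) (p : ℕ) : ℕ :=
  if h : p < contourLength s ∧ letter s p ∉ Γ.cycle ∧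
    ∃ q < contourLength s, letter s q = Γ.edge (letter s p) then h.2.2.choose else p

omit [NeZero k] in
lemma partner_spec (hs : Γ.Outer s) {p : ℕ} (hp : p < contourLength s)
    (hL : letter s p ∉ Γ.cycle) :
    partner s p < contourLength s ∧ letter s (partner s p) = Γ.edge (letter s p) := by
  have h : p < contourLength s ∧ letter s p ∉ Γ.cycle ∧
      ∃ q < contourLength s, letter s q = Γ.edge (letter s p) :=
    ⟨hp, hL, exists_letter hs (outer_of_not_mem_cycle (by rwa [edge_mem_cycle]))⟩
  rw [partner, dif_pos h]
  exact h.2.2.choose_spec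

omit [NeZero k] in
lemma partner_of_mem {p : ℕ} (h : letter s p ∈ Γ.cycle) : partner s p = p := by
  rw [partner, dif_neg (by tauto)]

omit [NeZero k] in
lemma partner_of_ge {p : ℕ} (h : contourLength s ≤ p) : partner s p = p := by
  rw [partner, dif_neg (by omega)]

-- The interval beyond a bridge begins after the dart that points away. If letter `p` pointed
-- towards the cycle, its partner would be that dart and would come first.
omit [NeZero k] in
lemma up_of_lt_partner (hs : Γ.Outer s) (hsL : s ∈ Γ.cycle) {p : ℕ} (h : p < partner s p) :
    p < contourLength s ∧ Γ.Up (letter s p) ∧ partner s p < contourLength s ∧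
      letter s (partner s p) = Γ.edge (letter s p) := by
  have hp : p < contourLength s := by
    by_contra h'
    have := partner_of_ge (s := s) (not_lt.1 h')
    omega
  have hL : letter s p ∉ Γ.cycle := by
    intro h'
    have := partner_of_mem h'
    omega
  obtain ⟨h1, h2⟩ := partner_spec hs hp hL
  have hne : Γ.edge (letter s p) ≠ letter s p := by
    intro h3
    rw [h3] at h2
    have := letter_inj h1 hp h2
    omega
  refine ⟨hp, ?_, h1, h2⟩
  by_contra h3
  rw [← up_edge_iff hne hL, ← h2] at h3
  have h4 := (beyond_letter_iff hsL h1 hp hp.le h3 (by rw [h2, Γ.edge_edge])).1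
    (by rw [h2]; simpa only [Γ.edge_edge] using Beyond.base (Γ := Γ.toRayGraph)
          (d := Γ.edge (letter s p)))
  omega

/-- The outer contour of a plane graph, read from the dart `s` of the cycle. -/
noncomputable def word (s : Fin Γ.n) (hs : Γ.Outer s) (hsL : s ∈ Γ.cycle) : ContourWord where
  N := contourLength s
  σ := partner s
  L := {p | p < contourLength s ∧ letter s p ∈ Γ.cycle}
  R := {p | p < contourLength s ∧ letter s p ∈ Set.range Γ.ray}
  zero_mem := ⟨contourLength_pos s, hsL⟩
  L_lt _ hp := hp.1
  R_lt _ hp := hp.1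
  disj := by
    rintro p ⟨-, hp⟩ ⟨-, i, hi⟩
    rw [← hi] at hp
    exact ray_not_mem_cycle i hp
  σ_ge _ hp := partner_of_ge hp
  σσ := by
    intro p
    by_cases hp : p < contourLength s
    · by_cases hL : letter s p ∈ Γ.cycle
      · rw [partner_of_mem hL, partner_of_mem hL]
      · obtain ⟨h1, h2⟩ := partner_spec hs hp hL
        obtain ⟨h3, h4⟩ := partner_spec hs h1 (by rwa [h2, edge_mem_cycle])
        refine letter_inj h3 hp ?_
        rw [h4, h2, Γ.edge_edge]
    · rw [partner_of_ge (not_lt.1 hp), partner_of_ge (not_lt.1 hp)]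
  σ_eq_iff := by
    intro p hp
    by_cases hL : letter s p ∈ Γ.cycle
    · simp [partner_of_mem hL, hL, hp]
    · obtain ⟨h1, h2⟩ := partner_spec hs hp hL
      simp only [Set.mem_ofPred_eq, hL, hp, and_false, true_and, false_or, Set.mem_range]
      rw [← Γ.edge_eq_self_iff, ← h2]
      exact ⟨fun h => by rw [h], fun h => letter_inj h1 hp h⟩
  nest := by
    intro p q h1 h2
    obtain ⟨hp, hup, hσ, e⟩ := up_of_lt_partner hs hsL (h1.trans h2)
    have hb := (beyond_letter_iff hsL hp hσ (h2.trans hσ).le hup e).2 ⟨h1, h2.le⟩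
    have hqL : letter s q ∉ Γ.cycle := fun h => hup.2.2 _ h hb
    obtain ⟨h3, h4⟩ := partner_spec hs (h2.trans hσ) hqL
    have hb' : Γ.Beyond (letter s p) (letter s (partner s q)) := by
      rw [h4]
      refine .edge _ hb ?_ ?_
      · intro h
        rw [h] at hb
        exact hup.not_beyond_self hb
      · intro h
        rw [← e] at h
        have := letter_inj (h2.trans hσ) hσ h
        omega
    have h5 := (beyond_letter_iff hsL hp hσ h3.le hup e).1 hb'
    refine ⟨h5.1, lt_of_le_of_ne h5.2 fun h => ?_⟩
    rw [h, e, edge_inj] at h4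
    have := letter_inj hp (h2.trans hσ) h4
    omega
  not_L := by
    rintro p q h1 h2 ⟨-, h3⟩
    obtain ⟨hp, hup, hσ, e⟩ := up_of_lt_partner hs hsL (h1.trans h2)
    exact hup.2.2 _ h3 ((beyond_letter_iff hsL hp hσ (h2.trans hσ).le hup e).2 ⟨h1, h2.le⟩)
  -- An immediate return along the bridge would mean a vertex of valence one.
  v1 := by
    intro p h
    obtain ⟨hp, hup, hσ, e⟩ := up_of_lt_partner hs hsL (p := p) (by omega)
    rw [h, letter_succ, face_apply] at e
    exact (Γ.three_le_valence _).1 e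
  -- A single branch beyond the bridge would mean a vertex of valence two.
  v2 := by
    intro p h1 h2
    obtain ⟨hp, hup, hσ, e⟩ := up_of_lt_partner hs hsL h1
    have h3 : p + 1 ≠ partner s p := by
      intro h
      rw [letter_eq_iterate, ← h, ← letter_eq_iterate, letter_succ, face_apply] at e
      exact (Γ.three_le_valence _).1 e
    have hb := (beyond_letter_iff hsL hp hσ (r := p + 1) (by omega) hup e).2 ⟨by omega, by omega⟩
    obtain ⟨h4, h5⟩ := partner_spec hs (p := p + 1) (by omega) fun h => hup.2.2 _ h hb
    rw [letter_eq_iterate, ← h2, ← letter_eq_iterate, letter_succ, h5, face_edge, letter_succ,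
      face_apply] at e
    exact (Γ.three_le_valence _).2 e
  -- If two outer cycle darts follow each other, the rotation of the second is an inner cycle dart
  -- at their common vertex, hence the reverse of the first; then this vertex has valence two.
  v3 := by
    rintro p ⟨hp, hL⟩
    have key : letter s (p + 1) ∉ Γ.cycle := by
      intro h
      have h1 : ¬ Γ.Outer (Γ.edge (letter s p)) := by
        rw [outer_edge_iff hL, not_not]
        exact outer_letter hs p
      have h2 : ¬ Γ.Outer (Γ.rot (letter s (p + 1))) := by
        rw [← face_edge, outer_face, outer_edge_iff h, not_not]
        exact outer_letter hs _
      have h3 : Γ.rot (letter s (p + 1)) ∈ Γ.cycle := by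
        by_contra h4
        exact h2 (outer_of_not_mem_cycle h4)
      have h4 := eq_of_sameVertex h3 (edge_mem_cycle.2 hL) (by
        rw [letter_succ, face_apply]
        exact ((sameVertex_rot _).trans (sameVertex_rot _)).symm) (by tauto)
      rw [letter_succ, face_apply] at h4
      exact (Γ.three_le_valence _).2 h4
    refine ⟨fun h => key h.2, fun h => key ?_⟩
    rw [h, letter_length]
    exact hsL

end Word

end PlaneType

/-! ### Coordinates of a metric graph -/

namespace PlaneType

open RayGraph

variable {k : ℕ} {Γ : PlaneType k} [NeZero k] {s : Fin Γ.n} (hs : Γ.Outer s) (hsL : s ∈ Γ.cycle)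

open Classical in
/-- The lengths of the letters of the contour. -/
noncomputable def wordLength (s : Fin Γ.n) (ℓ : Fin Γ.n → ℝ) (p : ℕ) : ℝ :=
  if p < contourLength s then ℓ (letter s p) else 0

variable {ℓ : Fin Γ.n → ℝ}

omit [NeZero k] in
lemma wordLength_of_lt {p : ℕ} (hp : p < contourLength s) :
    wordLength s ℓ p = ℓ (letter s p) := if_pos hp

omit [NeZero k] in
lemma wordLength_nonneg (h : ∀ d, 0 ≤ ℓ d) (p : ℕ) : 0 ≤ wordLength s ℓ p := by
  unfold wordLength
  split_ifs
  · exact h _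
  · exact le_rfl

include hs in
omit [NeZero k] in
lemma wordLength_partner (h : ∀ d, ℓ (Γ.edge d) = ℓ d) (p : ℕ) :
    wordLength s ℓ (partner s p) = wordLength s ℓ p := by
  by_cases hp : p < contourLength s
  · by_cases hL : letter s p ∈ Γ.cycle
    · rw [partner_of_mem hL]
    · obtain ⟨h1, h2⟩ := partner_spec hs hp hL
      rw [wordLength_of_lt h1, wordLength_of_lt hp, h2, h]
  · rw [partner_of_ge (not_lt.1 hp)]

lemma height_word {p : ℕ} (hp : p ≤ contourLength s) :
    (word s hs hsL).height (wordLength s ℓ) p = Γ.ht ℓ (letter s p) := by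
  induction p with
  | zero => rw [ContourWord.height_L (word s hs hsL).zero_mem, letter_zero, ht_cycle hsL]
  | succ p ih =>
    have ih := ih (by omega)
    rw [letter_succ, ht_face]
    rcases ContourWord.cases_letter (W := word s hs hsL) (p := p) hp with h | h | h | h
    · rw [ContourWord.height_same (ContourWord.σ_L h), ih, ht_cycle h.2,
        ht_cycle (edge_mem_cycle.2 h.2)]
    · rw [ContourWord.height_same (ContourWord.σ_R h), ih]
      obtain ⟨-, i, hi⟩ := h
      rw [← hi, edge_ray]
    · obtain ⟨-, h1, -⟩ := up_of_lt_partner hs hsL h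
      rw [ContourWord.height_up h, ih, ht_edge_of_up h1, wordLength_of_lt (by omega)]
    · obtain ⟨h2, h1, h3, h4⟩ := up_of_lt_partner hs hsL (p := partner s p)
        (by rw [show partner s (partner s p) = p from (word s hs hsL).σσ p]; exact h)
      rw [show partner s (partner s p) = p from (word s hs hsL).σσ p] at h4
      have h5 := ContourWord.height_down (l := wordLength s ℓ) h
      have h6 := ht_edge_of_up (ℓ := ℓ) h1
      have h7 : Γ.edge (letter s p) = letter s (partner s p) := by rw [h4, Γ.edge_edge]
      rw [ih, show (word s hs hsL).σ p = partner s p from rfl, wordLength_of_lt h2] at h5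
      rw [← h4] at h6
      rw [h7]
      linarith

/-- Passing a ray advances the next label by one, passing another letter keeps it. So `γ` numbers
the gaps relative to the gap `j₀` of the start. -/
lemma nextRay_letter {j₀ : Fin k} (hj : Γ.NextRay s j₀) {p : ℕ} (hp : p ≤ contourLength s) :
    Γ.NextRay (letter s p) ((finRotate k ^ (word s hs hsL).γ p) j₀) := by
  induction p with
  | zero => simpa [ContourWord.γ_zero, letter_zero] using hj
  | succ p ih =>
    have ih := ih (by omega)
    by_cases h : letter s p ∈ Set.range Γ.ray
    · rw [ContourWord.γ_succ_ray (W := word s hs hsL) ⟨hp, h⟩, letter_succ, pow_succ',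
        Equiv.Perm.mul_apply]
      obtain ⟨i, hi⟩ := h
      rw [← hi] at ih ⊢
      rw [ih.unique (nextRay_ray i)]
      exact nextRay_face_ray i
    · rw [ContourWord.γ_succ (W := word s hs hsL) (fun h' => h h'.2), letter_succ,
        nextRay_face_iff h]
      exact ih

lemma γ_word : (word s hs hsL).γ (word s hs hsL).N = k := by
  classical
  have h1 : ∀ j, ∃ p < contourLength s, letter s p = Γ.ray j := fun j =>
    exists_letter hs ⟨j, Equiv.Perm.SameCycle.refl _ _⟩
  choose f hf1 hf2 using h1
  rw [ContourWord.γ, Nat.count_eq_card_filter_range]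
  refine Eq.trans (Eq.symm ?_) (Finset.card_fin k)
  refine Finset.card_bij (fun j _ => f j) ?_ ?_ ?_
  · intro j _
    rw [Finset.mem_filter, Finset.mem_range]
    exact ⟨hf1 j, hf1 j, j, (hf2 j).symm⟩
  · intro i _ j _ hij
    apply Γ.ray_injective
    rw [← hf2, ← hf2, hij]
  · intro p hp
    obtain ⟨-, h2, i, hi⟩ := Finset.mem_filter.1 hp
    exact ⟨i, Finset.mem_univ _, letter_inj (hf1 i) h2 (by rw [hf2, hi])⟩

/-- The valleys of the gaps are the lowest points of the contour. -/
lemma isValley_word (hℓ : ∀ d, 0 ≤ ℓ d) {j₀ : Fin k} (hj : Γ.NextRay s j₀) :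
    (word s hs hsL).IsValley (wordLength s ℓ) fun r => Γ.valley ℓ ((finRotate k ^ r) j₀) := by
  have hlen := wordLength_nonneg (s := s) hℓ
  have h0 : Γ.valley ℓ j₀ = 0 := by
    obtain ⟨⟨e, he, h1⟩, h2⟩ := valley_isLeast ℓ j₀
    refine le_antisymm (h2 ⟨s, hj, ht_cycle hsL⟩) ?_
    rw [← h1]
    exact ht_nonneg hℓ e
  intro r hr
  rw [γ_word] at hr
  have hNγ := γ_word hs hsL
  -- The contour is cut open inside gap `j₀`. Gaps `0` and `k` of the word are the two pieces, both
  -- with valley `0` since the cut is on the cycle.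
  by_cases hr0 : r = 0 ∨ r = k
  · have : Γ.valley ℓ ((finRotate k ^ r) j₀) = 0 := by
      rcases hr0 with rfl | rfl
      · simpa using h0
      · rw [finRotate_pow_self, h0]
    beta_reduce
    rw [this]
    constructor
    · rcases hr0 with rfl | rfl
      · exact ⟨0, Nat.zero_le _, ContourWord.γ_zero,
          ContourWord.height_L (word s hs hsL).zero_mem⟩
      · exact ⟨_, le_rfl, hNγ, ContourWord.height_N⟩
    · rintro x ⟨p, -, -, rfl⟩
      exact ContourWord.height_nonneg hlen p
  · push Not at hr0
    obtain ⟨⟨e, he, h1⟩, h2⟩ := valley_isLeast ℓ ((finRotate k ^ r) j₀)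
    have hγ : ∀ p < contourLength s, Γ.NextRay (letter s p) ((finRotate k ^ r) j₀) →
        (word s hs hsL).γ p = r := by
      intro p hp hn
      have h3 := (nextRay_letter hs hsL hj hp.le).unique hn
      have h4 := ContourWord.γ_mono (W := word s hs hsL) (show p ≤ (word s hs hsL).N from hp.le)
      rcases (hNγ ▸ h4).lt_or_eq with h5 | h5
      · exact finRotate_pow_inj j₀ h5 (by omega) h3
      · exfalso
        rw [h5, finRotate_pow_self] at h3
        have := finRotate_pow_inj (k := k) j₀ (r := 0) (s := r) (by omega) (by omega)
          (by simpa using h3)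
        omega
    constructor
    · obtain ⟨p, hp, rfl⟩ := exists_letter hs (d := e) ⟨_, he.sameFace⟩
      exact ⟨p, hp.le, hγ p hp he, by rw [height_word hs hsL hp.le, h1]⟩
    · rintro x ⟨p, hp, rfl, rfl⟩
      rw [height_word hs hsL hp]
      exact h2 ⟨_, nextRay_letter hs hsL hj hp, rfl⟩

/-- After the last ray no bracket opens any more, since it would contain a ray. But a cycle edge is
not the last letter, by `v3`, and is followed by an opening bracket or a ray. So the final piece of
gap `j₀` shows no cycle edge. -/
lemma γ_L_lt {p : ℕ} (hp : p < contourLength s) (hpL : letter s p ∈ Γ.cycle) :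
    (word s hs hsL).γ p < k := by
  have h3 := ContourWord.γ_mono (W := word s hs hsL) (show p ≤ (word s hs hsL).N from hp.le)
  rw [γ_word] at h3
  refine lt_of_le_of_ne h3 fun h4 => ?_
  have h5 : p + 1 ≠ contourLength s := ((word s hs hsL).v3 p ⟨hp, hpL⟩).2
  have key : ∀ q, p < q → q < contourLength s → q ∉ (word s hs hsL).R ∧ ¬ q < partner s q := by
    intro q hpq hq
    have h6 : ∀ r, p ≤ r → r < contourLength s → r ∉ (word s hs hsL).R := by
      intro r hpr hr
      refine ContourWord.not_ray_of_γ_eq (W := word s hs hsL) (p := p) (q := contourLength s)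
        ?_ hpr hr
      rw [h4]
      exact (γ_word hs hsL).symm
    refine ⟨h6 q hpq.le hq, fun h7 => ?_⟩
    obtain ⟨r, h8, h9, h10⟩ := ContourWord.ray_in_bracket (W := word s hs hsL) h7
    exact h6 r (by omega) ((word s hs hsL).R_lt r h8) h8
  have hg : (word s hs hsL).γ p = (word s hs hsL).γ (p + 1) := by
    rw [ContourWord.γ_succ]
    exact (word s hs hsL).disj p ⟨hp, hpL⟩
  have h7 := key (p + 1) (by omega) (by omega)
  rcases ContourWord.up_of_L (W := word s hs hsL) ⟨hp, hpL⟩ (by omega) hg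
    (show p + 1 < contourLength s by omega) with h8 | h8
  · exact h7.2 h8
  · exact h7.1 h8

include hs hsL in
/-- At most one edge of the cycle is seen between two consecutive rays. -/
lemma word_L_unique {j₀ : Fin k} (hj : Γ.NextRay s j₀) {p q : ℕ} (hp : p < contourLength s)
    (hq : q < contourLength s) (hpL : letter s p ∈ Γ.cycle) (hqL : letter s q ∈ Γ.cycle)
    {j : Fin k} (h1 : Γ.NextRay (letter s p) j) (h2 : Γ.NextRay (letter s q) j) : p = q := by
  have e := finRotate_pow_inj j₀ (γ_L_lt hs hsL hp hpL) (γ_L_lt hs hsL hq hqL)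
    (((nextRay_letter hs hsL hj hp.le).unique h1).trans
      ((nextRay_letter hs hsL hj hq.le).unique h2).symm)
  rcases lt_trichotomy p q with h | h | h
  · rcases ContourWord.up_of_L (W := word s hs hsL) ⟨hp, hpL⟩ h e hq with h3 | h3
    · have := ContourWord.σ_L (W := word s hs hsL) ⟨hq, hqL⟩
      omega
    · exact absurd h3 ((word s hs hsL).disj q ⟨hq, hqL⟩)
  · exact h
  · rcases ContourWord.up_of_L (W := word s hs hsL) ⟨hq, hqL⟩ h e.symm hp with h3 | h3
    · have := ContourWord.σ_L (W := word s hs hsL) ⟨hp, hpL⟩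
      omega
    · exact absurd h3 ((word s hs hsL).disj p ⟨hp, hpL⟩)

lemma exists_outer_mem_cycle : ∃ s ∈ Γ.cycle, Γ.Outer s := by
  obtain ⟨m, c, h, hc⟩ := exists_outer_cyclePath (Γ := Γ) 0
  exact ⟨c 0, h.mem 0, (hc 0).1⟩

/-- At most one edge of the cycle is seen between two consecutive rays. -/
lemma cycle_nextRay_unique {d e : Fin Γ.n} (hd : d ∈ Γ.cycle) (he : e ∈ Γ.cycle) {j : Fin k}
    (h1 : Γ.NextRay d j) (h2 : Γ.NextRay e j) : d = e := by
  obtain ⟨s, hsL, hs⟩ := exists_outer_mem_cycle (Γ := Γ)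
  obtain ⟨i, hi⟩ := hs
  obtain ⟨j₀, hj⟩ := exists_nextRay hi
  have hs : Γ.Outer s := ⟨i, hi⟩
  obtain ⟨p, hp, rfl⟩ := exists_letter hs (d := d) ⟨_, h1.sameFace⟩
  obtain ⟨q, hq, rfl⟩ := exists_letter hs (d := e) ⟨_, h2.sameFace⟩
  rw [word_L_unique hs hsL hj hp hq hd he h1 h2]

lemma cycleGap_eq {d : Fin Γ.n} (hd : d ∈ Γ.cycle) {j : Fin k} (h : Γ.NextRay d j) :
    Γ.cycleGap ℓ j = ℓ d := by
  classical
  unfold cycleGap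
  rw [Finset.sum_eq_single_of_mem d (by simp [hd, h])]
  intro e he hne
  simp only [Finset.mem_filter, Finset.mem_univ, true_and] at he
  exact absurd (cycle_nextRay_unique he.1 hd he.2 h) hne

omit [NeZero k] in
lemma exists_of_cycleGap_ne_zero {j : Fin k} (h : Γ.cycleGap ℓ j ≠ 0) :
    ∃ d ∈ Γ.cycle, Γ.NextRay d j := by
  classical
  by_contra hcon
  push Not at hcon
  apply h
  unfold cycleGap
  rw [Finset.filter_false_of_mem, Finset.sum_empty]
  rintro d - ⟨h1, h2⟩
  exact hcon d h1 h2

omit [NeZero k] in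
lemma cycleGap_nonneg (hℓ : ∀ d, 0 ≤ ℓ d) (j : Fin k) : 0 ≤ Γ.cycleGap ℓ j :=
  Finset.sum_nonneg fun _ _ => hℓ _

omit [NeZero k] in
lemma valley_nonneg (hℓ : ∀ d, 0 ≤ ℓ d) (j : Fin k) : 0 ≤ Γ.valley ℓ j := by
  obtain ⟨⟨e, he, h1⟩, h2⟩ := valley_isLeast ℓ j
  rw [← h1]
  exact ht_nonneg hℓ e

omit [NeZero k] in
lemma valley_eq_zero (hℓ : ∀ d, 0 ≤ ℓ d) {d : Fin Γ.n} (hd : d ∈ Γ.cycle) {j : Fin k}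
    (h : Γ.NextRay d j) : Γ.valley ℓ j = 0 :=
  le_antisymm ((valley_isLeast ℓ j).2 ⟨d, h, ht_cycle hd⟩) (valley_nonneg hℓ j)

/-- The coordinates of a metric graph: the gap between ray `j` and the ray before it on the cycle,
or minus the height above the cycle at which these rays separate. -/
noncomputable def coord (Γ : PlaneType k) (ℓ : Fin Γ.n → ℝ) (j : Fin k) : ℝ :=
  Γ.cycleGap ℓ j - Γ.valley ℓ j

-- A gap that shows a cycle edge has valley `0`. The two terms of `coord` are therefore never both
-- nonzero and are its positive and negative part.
omit [NeZero k] in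
lemma cycleGap_eq_max (hℓ : ∀ d, 0 ≤ ℓ d) (j : Fin k) :
    Γ.cycleGap ℓ j = max (Γ.coord ℓ j) 0 := by
  unfold coord
  by_cases h : Γ.cycleGap ℓ j = 0
  · rw [h, max_eq_right]
    linarith [valley_nonneg hℓ j]
  · obtain ⟨d, hd, hj⟩ := exists_of_cycleGap_ne_zero h
    rw [valley_eq_zero hℓ hd hj, sub_zero, max_eq_left (cycleGap_nonneg hℓ j)]

omit [NeZero k] in
lemma valley_eq_max (hℓ : ∀ d, 0 ≤ ℓ d) (j : Fin k) :
    Γ.valley ℓ j = max (- Γ.coord ℓ j) 0 := by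
  unfold coord
  by_cases h : Γ.cycleGap ℓ j = 0
  · rw [h, max_eq_left]
    · ring
    · linarith [valley_nonneg hℓ j]
  · obtain ⟨d, hd, hj⟩ := exists_of_cycleGap_ne_zero h
    rw [valley_eq_zero hℓ hd hj, max_eq_right]
    linarith [cycleGap_nonneg hℓ j]

/-- Every cycle edge has exactly one outer side, and this side lies in exactly one gap; the inner
sides account for the other half of `2 * τ`. -/
lemma sum_cycleGap {τ : ℝ} (h : IsLength Γ τ ℓ) : ∑ j, Γ.cycleGap ℓ j = τ := by
  classical
  have h1 : ∑ j, Γ.cycleGap ℓ j = ∑ d ∈ Γ.cycle with Γ.Outer d, ℓ d := by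
    unfold cycleGap
    rw [← Finset.sum_biUnion]
    · congr 1
      ext d
      simp only [Finset.mem_biUnion, Finset.mem_univ, true_and, Finset.mem_filter]
      constructor
      · rintro ⟨j, h1, h2⟩
        exact ⟨h1, _, h2.sameFace⟩
      · rintro ⟨h1, i, hi⟩
        obtain ⟨j, hj⟩ := exists_nextRay hi
        exact ⟨j, h1, hj⟩
    · intro i _ j _ hij
      rw [Function.onFun, Finset.disjoint_left]
      intro d hd hd'
      simp only [Finset.mem_filter, Finset.mem_univ, true_and] at hd hd'
      exact hij (hd.2.unique hd'.2)
  have h2 : ∑ d ∈ Γ.cycle with ¬ Γ.Outer d, ℓ d = ∑ d ∈ Γ.cycle with Γ.Outer d, ℓ d := by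
    refine Finset.sum_bij (fun d _ => Γ.edge d) ?_ ?_ ?_ ?_
    · intro d hd
      simp only [Finset.mem_filter] at hd ⊢
      exact ⟨edge_mem_cycle.2 hd.1, (outer_edge_iff hd.1).2 hd.2⟩
    · intro d _ e _ h
      exact edge_inj.1 h
    · intro d hd
      simp only [Finset.mem_filter] at hd
      refine ⟨Γ.edge d, ?_, Γ.edge_edge d⟩
      simp only [Finset.mem_filter]
      exact ⟨edge_mem_cycle.2 hd.1, by rw [outer_edge_iff hd.1]; tauto⟩
    · intro d _
      exact (h.edge d).symm
  have h3 := Finset.sum_filter_add_sum_filter_not Γ.cycle (Γ.Outer ·) ℓ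
  rw [h.cycle, h2] at h3
  rw [h1]
  linarith

lemma sum_max_coord {τ : ℝ} (h : IsLength Γ τ ℓ) : ∑ j, max (Γ.coord ℓ j) 0 = τ := by
  rw [← sum_cycleGap h]
  exact Finset.sum_congr rfl fun j _ => (cycleGap_eq_max h.nonneg j).symm

/-- The lengths of the edges are bounded in terms of the coordinates. -/
lemma length_le {τ : ℝ} (h : IsLength Γ τ ℓ) (d : Fin Γ.n) : ∃ j, ℓ d ≤ |Γ.coord ℓ j| := by
  have houter : ∀ d, Γ.Outer d → d ∈ Γ.cycle → ∃ j, ℓ d ≤ |Γ.coord ℓ j| := by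
    rintro d ⟨i, hi⟩ hd
    obtain ⟨j, hj⟩ := exists_nextRay hi
    refine ⟨j, ?_⟩
    rw [← cycleGap_eq (ℓ := ℓ) hd hj, cycleGap_eq_max h.nonneg]
    exact max_le (le_abs_self _) (abs_nonneg _)
  have hup : ∀ d, Γ.Up d → ∃ j, ℓ d ≤ |Γ.coord ℓ j| := by
    intro d hd
    obtain ⟨s, hsL, hs⟩ := exists_outer_mem_cycle (Γ := Γ)
    obtain ⟨i, hi⟩ := hs
    obtain ⟨j₀, hj⟩ := exists_nextRay hi
    have hs : Γ.Outer s := ⟨i, hi⟩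
    obtain ⟨p, hp, rfl⟩ := exists_letter hs (d := d) (outer_of_not_mem_cycle hd.2.1)
    have hpp : p < partner s p := by
      obtain ⟨h1, h2⟩ := partner_spec hs hp hd.2.1
      exact ((beyond_letter_iff hsL hp h1 h1.le hd h2).1 (h2 ▸ .base)).1
    have hl := wordLength_nonneg (s := s) h.nonneg
    -- A bridge is no longer than its top is high, and that height is the valley of some gap beyond
    -- it.
    obtain ⟨r, -, -, hr⟩ := (isValley_word hs hsL h.nonneg hj).top hl
      (u := p) hpp
    refine ⟨(finRotate k ^ r) j₀, ?_⟩
    have h1 := ContourWord.height_up (W := word s hs hsL) (l := wordLength s ℓ) hpp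
    have h2 := ContourWord.height_nonneg (W := word s hs hsL) hl p
    rw [wordLength_of_lt hp] at h1
    have h3 : ℓ (letter s p) ≤ Γ.valley ℓ ((finRotate k ^ r) j₀) := by
      rw [hr]
      linarith
    refine h3.trans ?_
    rw [valley_eq_max h.nonneg]
    exact max_le (neg_le_abs _) (abs_nonneg _)
  rcases up_or d with h1 | ⟨i, rfl⟩ | h1 | h1
  · by_cases h2 : Γ.Outer d
    · exact houter d h2 h1
    · rw [← h.edge]
      exact houter _ ((outer_edge_iff h1).2 h2) (edge_mem_cycle.2 h1)
  · rw [h.ray]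
    exact ⟨0, abs_nonneg _⟩
  · exact hup d h1
  · rw [← h.edge]
    exact hup _ h1

end PlaneType

/-! ### Collapsing does not change the coordinates -/

/-- Carries a property through the points skipped before the return; in the application these are
the darts of collapsed edges. -/
lemma FirstReturn.induct {X : Type*} {g : Equiv.Perm X} {K : Set X} {x y : X} {P : X → Prop}
    (h : FirstReturn g K x y) (h0 : P (g x)) (hs : ∀ z ∉ K, P z → P (g z)) : P y := by
  obtain ⟨m, hm, rfl, -, h2⟩ := h
  obtain ⟨m, rfl⟩ : ∃ n, m = n + 1 := ⟨m - 1, by omega⟩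
  have key : ∀ j ≤ m, P ((g ^ (j + 1)) x) := by
    intro j
    induction j with
    | zero => exact fun _ => by simpa using h0
    | succ j ih =>
      intro hj
      rw [pow_succ', Equiv.Perm.mul_apply]
      exact hs _ (h2 _ (by omega) (by omega)) (ih (by omega))
  exact key m le_rfl

lemma FirstReturn.sameCycle {X : Type*} {g : Equiv.Perm X} {K : Set X} {x y : X}
    (h : FirstReturn g K x y) : g.SameCycle x y := by
  obtain ⟨m, -, h, -⟩ := h
  exact ⟨m, by rw [zpow_natCast, h]⟩

namespace MetricCells

open RayGraph PlaneType

variable {k : ℕ} {τ : ℝ} {G H : MetricCells k τ}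

lemma not_ray_of_not_kept {z : Fin G.1.n} (hz : z ∉ G.kept) : z ∉ Set.range G.1.ray := by
  rintro ⟨i, rfl⟩
  exact hz (Or.inl (edge_ray i))

lemma length_of_not_kept {z : Fin G.1.n} (hz : z ∉ G.kept) : G.2.1 z = 0 := by
  by_contra h
  exact hz (Or.inr ((G.2.2.nonneg z).lt_of_ne' h))

lemma edge_mem_kept {z : Fin G.1.n} : G.1.edge z ∈ G.kept ↔ z ∈ G.kept := by
  unfold kept
  simp only [Set.mem_ofPred_eq, G.2.2.edge, G.1.edge_edge]
  rw [eq_comm]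

lemma ht_face_of_not_kept {z : Fin G.1.n} (hz : z ∉ G.kept) :
    G.1.ht G.2.1 (G.1.face z) = G.1.ht G.2.1 z := by
  rw [ht_face]
  have hz0 := length_of_not_kept hz
  rcases up_or z with h | ⟨i, rfl⟩ | h | h
  · rw [ht_cycle h, ht_cycle (edge_mem_cycle.2 h)]
  · rw [edge_ray]
  · rw [ht_edge_of_up h, hz0, add_zero]
  · have := ht_edge_of_up (ℓ := G.2.1) h
    rw [G.1.edge_edge, G.2.2.edge, hz0, add_zero] at this
    exact this.symm

/-- Describes the cycle by faces alone, a description that a collapse preserves. -/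
lemma _root_.PlaneType.mem_cycle_iff [NeZero k] {Γ : PlaneType k} {d : Fin Γ.n} :
    d ∈ Γ.cycle ↔ ¬ Γ.SameFace d (Γ.edge d) := by
  constructor
  · intro hd h
    by_cases ho : Γ.Outer d
    · exact (outer_edge_iff hd).1 (ho.of_sameFace h) ho
    · exact ho (((outer_edge_iff hd).2 ho).of_sameFace h.symm)
  · intro h
    by_contra h1
    exact h (sameFace_edge h1)

section Collapse

variable [NeZero k] {f : Fin H.1.n → Fin G.1.n} (hf : Function.Injective f)
  (hrange : Set.range f = G.kept) (hedge : ∀ d, f (H.1.edge d) = G.1.edge (f d))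
  (hray : ∀ i, f (H.1.ray i) = G.1.ray i)
  (hface : ∀ d, FirstReturn G.1.face G.kept (f d) (f (H.1.face d)))
  (hlen : ∀ d, H.2.1 d = G.2.1 (f d))

include hf hrange hface

omit [NeZero k] in
lemma sameFace_iff {d e : Fin H.1.n} : G.1.SameFace (f d) (f e) ↔ H.1.SameFace d e := by
  constructor
  · intro h
    obtain ⟨n, -, hn⟩ := h.exists_pow_eq_of_finite
    clear h
    induction n using Nat.strong_induction_on generalizing d with
    | _ n ih =>
    rcases n with _ | n
    · rw [hf hn]
      exact Equiv.Perm.SameCycle.refl _ _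
    · obtain ⟨m, hm, h1, -, h2⟩ := hface d
      have hmn : m ≤ n + 1 := by
        by_contra h
        apply h2 (n + 1) (by omega) (by omega)
        rw [hn, ← hrange]
        exact ⟨e, rfl⟩
      refine (sameFace_face d).trans (ih (n + 1 - m) (by omega) ?_)
      rw [← h1, ← Equiv.Perm.mul_apply, ← pow_add, Nat.sub_add_cancel hmn, hn]
  · intro h
    exact h.induct_of_closed (P := fun e => G.1.SameFace (f d) (f e))
      (fun e he => he.trans (hface e).sameCycle) (Equiv.Perm.SameCycle.refl _ _)

include hedge

lemma mem_cycle_iff {d : Fin H.1.n} : f d ∈ G.1.cycle ↔ d ∈ H.1.cycle := by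
  rw [PlaneType.mem_cycle_iff, PlaneType.mem_cycle_iff, ← hedge,
    sameFace_iff hf hrange hface]

-- A turn in `H` is a first return in `G`. It skips collapsed edges only, never the edge of `f d`,
-- and so stays on the same side of it.
omit [NeZero k] in
lemma beyond_of_beyond {d e : Fin H.1.n} (h : H.1.Beyond d e) : G.1.Beyond (f d) (f e) := by
  have hk : ∀ d, f d ∈ G.kept := fun d => hrange ▸ ⟨d, rfl⟩
  induction h with
  | base =>
    rw [hedge]
    exact .base
  | rot e _ ih =>
    have := hface (H.1.edge e)
    rw [face_edge] at this
    refine this.induct (P := G.1.Beyond (f d)) ?_ fun z hz h => ?_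
    · rw [hedge, face_edge]
      exact .rot _ ih
    · refine (beyond_face_iff ?_ ?_).2 h
      · rintro rfl
        exact hz (hk d)
      · rintro rfl
        exact hz (edge_mem_kept.2 (hk d))
  | edge e h h1 h2 ih =>
    rw [hedge]
    refine .edge _ ih (fun h3 => h1 (hf h3)) fun h3 => h2 (hf ?_)
    rw [h3, hedge]

/-- One direction is `beyond_of_beyond`; the other follows by applying it to the reversed dart. -/
lemma up_iff {d : Fin H.1.n} : H.1.Up d ↔ G.1.Up (f d) := by
  have key : ∀ d, G.1.Up (f d) → H.1.Up d := by
    rintro d ⟨h1, h2, h3⟩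
    refine ⟨fun h => h1 (by rw [← hedge, h]), fun h => h2 ?_, fun c hc h => h3 (f c) ?_ ?_⟩
    · rwa [mem_cycle_iff hf hrange hedge hface]
    · rwa [mem_cycle_iff hf hrange hedge hface]
    · exact beyond_of_beyond hf hrange hedge hface h
  refine ⟨fun h => ?_, key d⟩
  by_contra h1
  rw [← up_edge_iff, ← hedge] at h1
  · exact h.not_edge (key _ h1)
  · rw [← hedge]
    exact fun h' => h.1 (hf h')
  · rw [mem_cycle_iff hf hrange hedge hface]
    exact h.2.1

include hlen

/-- The height of `G`, pulled back along `f`, has the properties that characterise the height of `H`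
by `eq_ht`. -/
lemma ht_eq (e : Fin H.1.n) : G.1.ht G.2.1 (f e) = H.1.ht H.2.1 e := by
  refine eq_ht (η := fun e => G.1.ht G.2.1 (f e)) ?_ ?_ ?_ e
  · intro e
    have := hface (H.1.edge e)
    rw [face_edge] at this
    refine this.induct (P := fun z => G.1.ht G.2.1 z = G.1.ht G.2.1 (f e)) ?_ fun z hz h => ?_
    · rw [hedge, face_edge, ht_rot]
    · rw [ht_face_of_not_kept hz, h]
  · intro e he
    exact ht_cycle ((mem_cycle_iff hf hrange hedge hface).2 he)
  · intro e he
    rw [hedge, ht_edge_of_up ((up_iff hf hrange hedge hface).1 he), hlen]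

omit hlen hedge
include hray

omit [NeZero k] hrange in
lemma nextRay_map {e : Fin H.1.n} {j : Fin k} (h : H.1.NextRay e j) : G.1.NextRay (f e) j := by
  obtain ⟨n, h1, h2⟩ := h
  induction n generalizing e with
  | zero =>
    obtain rfl : e = H.1.ray j := h1
    rw [hray]
    exact nextRay_ray j
  | succ n ih =>
    have he : e ∉ Set.range H.1.ray := h2 0 (by omega)
    have h3 := ih (e := H.1.face e) (by rw [← h1, pow_succ, Equiv.Perm.mul_apply])
      fun l hl => by
        have := h2 (l + 1) (by omega)
        rwa [pow_succ, Equiv.Perm.mul_apply] at this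
    refine ((hface e).induct (P := fun z => G.1.NextRay z j ↔ G.1.NextRay (f e) j) ?_
      fun z hz h => ?_).1 h3
    · refine nextRay_face_iff ?_
      rintro ⟨i, hi⟩
      rw [← hray] at hi
      exact he ⟨i, hf hi⟩
    · rw [nextRay_face_iff (not_ray_of_not_kept hz), h]

omit [NeZero k] in
lemma nextRay_iff {e : Fin H.1.n} {j : Fin k} : G.1.NextRay (f e) j ↔ H.1.NextRay e j := by
  refine ⟨fun h => ?_, nextRay_map hf hray hface⟩
  have h1 := h.sameFace
  rw [← hray, sameFace_iff hf hrange hface] at h1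
  obtain ⟨i, hi⟩ := exists_nextRay h1
  rwa [h.unique (nextRay_map hf hray hface hi)]

-- Skipping collapsed darts changes neither the height nor the next ray, and a kept dart is met at
-- the ray at the latest.
omit [NeZero k] in
lemma exists_nextRay_of_nextRay {z : Fin G.1.n} {j : Fin k} (h : G.1.NextRay z j) :
    ∃ e, H.1.NextRay e j ∧ G.1.ht G.2.1 (f e) = G.1.ht G.2.1 z := by
  have h' := h
  obtain ⟨n, h1, h2⟩ := h
  induction n generalizing z with
  | zero =>
    obtain rfl : z = G.1.ray j := h1
    exact ⟨H.1.ray j, nextRay_ray j, by rw [hray]⟩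
  | succ n ih =>
    by_cases hz : z ∈ G.kept
    · rw [← hrange] at hz
      obtain ⟨e, rfl⟩ := hz
      exact ⟨e, (nextRay_iff hf hrange hray hface).1 h', rfl⟩
    · obtain ⟨e, he1, he2⟩ := ih (z := G.1.face z)
        ((nextRay_face_iff (not_ray_of_not_kept hz)).2 h')
        (by rw [← h1, pow_succ, Equiv.Perm.mul_apply])
        fun l hl => by
          have := h2 (l + 1) (by omega)
          rwa [pow_succ, Equiv.Perm.mul_apply] at this
      exact ⟨e, he1, by rw [he2, ht_face_of_not_kept hz]⟩

include hedge hlen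

lemma valley_collapse (j : Fin k) : G.1.valley G.2.1 j = H.1.valley H.2.1 j := by
  refine (valley_isLeast G.2.1 j).unique ?_
  have h := valley_isLeast H.2.1 j
  constructor
  · obtain ⟨e, he, h1⟩ := h.1
    exact ⟨f e, nextRay_map hf hray hface he,
      by rw [ht_eq hf hrange hedge hface hlen, h1]⟩
  · rintro x ⟨z, hz, rfl⟩
    obtain ⟨e, he, h1⟩ := exists_nextRay_of_nextRay hf hrange hray hface hz
    rw [← h1, ht_eq hf hrange hedge hface hlen]
    exact h.2 ⟨e, he, rfl⟩

/-- Collapsed cycle edges have length zero and drop out of the sum. -/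
lemma cycleGap_collapse (j : Fin k) : G.1.cycleGap G.2.1 j = H.1.cycleGap H.2.1 j := by
  classical
  unfold cycleGap
  symm
  refine Finset.sum_bij_ne_zero (fun e _ _ => f e) ?_ ?_ ?_ ?_
  · intro e he _
    simp only [Finset.mem_filter, Finset.mem_univ, true_and] at he ⊢
    rwa [mem_cycle_iff hf hrange hedge hface, nextRay_iff hf hrange hray hface]
  · intro e _ _ e' _ _ h
    exact hf h
  · intro z hz hne
    have hzk : z ∈ G.kept := by
      by_contra h
      exact hne (length_of_not_kept h)
    rw [← hrange] at hzk
    obtain ⟨e, rfl⟩ := hzk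
    simp only [Finset.mem_filter, Finset.mem_univ, true_and] at hz
    rw [mem_cycle_iff hf hrange hedge hface, nextRay_iff hf hrange hray hface] at hz
    exact ⟨e, by simpa using hz, by rwa [hlen], rfl⟩
  · intro e _ _
    exact hlen e

end Collapse

/-- The coordinates of a metric graph. -/
noncomputable def coord (G : MetricCells k τ) : Fin k → ℝ := G.1.coord G.2.1

lemma Collapses.coord_eq [NeZero k] (h : Collapses G H) : G.coord = H.coord := by
  obtain ⟨f, hf, hrange, hedge, hray, hface, hlen⟩ := h
  funext j
  unfold coord PlaneType.coord
  rw [valley_collapse hf hrange hedge hray hface hlen,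
    cycleGap_collapse hf hrange hedge hray hface hlen]

end MetricCells

/-! ### The inner contour, and injectivity of the coordinates -/

namespace PlaneType

open RayGraph

variable {k : ℕ} {Γ : PlaneType k} [NeZero k] {s : Fin Γ.n} (hs : Γ.Outer s) (hsL : s ∈ Γ.cycle)

lemma word_letter_σ {p : ℕ} (hp : p < contourLength s) (hL : p ∉ (word s hs hsL).L) :
    letter s ((word s hs hsL).σ p) = Γ.edge (letter s p) :=
  (partner_spec hs hp fun h => hL ⟨hp, h⟩).2

/-- The part of the outer contour between two consecutive edges of the cycle returns to the
same vertex. -/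
lemma sameVertex_letter {a b : ℕ} (ha : a ∈ (word s hs hsL).L) (hab : a < b)
    (hb : b ∈ (word s hs hsL).L ∨ b = contourLength s)
    (hno : ∀ r, a < r → r < b → r ∉ (word s hs hsL).L) :
    Γ.SameVertex (Γ.edge (letter s a)) (letter s b) := by
  set W := word s hs hsL with hW
  have hσa : W.σ a = a := ContourWord.σ_L ha
  have hbN : b ≤ W.N := by
    rcases hb with hb | rfl
    · exact (W.L_lt b hb).le
    · exact le_rfl
  -- The position `r` runs through the corners at which no bracket is open. Each step jumps over a
  -- ray or a whole bracket and so returns to the same vertex.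
  have key : ∀ n r, b - r = n → a < r → r ≤ b → (∀ u < r, W.σ u < r) →
      Γ.SameVertex (Γ.edge (letter s a)) (letter s r) →
      Γ.SameVertex (Γ.edge (letter s a)) (letter s b) := by
    intro n
    induction n using Nat.strong_induction_on with
    | _ n ih =>
    intro r hn har hrb htop hv
    rcases hrb.lt_or_eq with hlt | rfl
    swap
    · exact hv
    have hσr : W.σ r < b ∧ r ≤ W.σ r := by
      constructor
      · by_contra h
        rcases hb with hb | rfl
        · rcases (not_lt.1 h).lt_or_eq with h1 | h1
          · exact W.not_L r b hlt h1 hb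
          · have h2 := W.σσ r
            rw [← h1, ContourWord.σ_L hb] at h2
            omega
        · exact h (ContourWord.σ_lt (W := W) (show r < W.N by omega))
      · by_contra h
        have := htop _ (not_le.1 h)
        rw [W.σσ] at this
        omega
    refine ih (b - (W.σ r + 1)) (by omega) (W.σ r + 1) rfl (by omega) (by omega) ?_ ?_
    · intro u hu
      by_contra h1
      have hu1 : ¬ u < r := fun h => by
        have := htop u h
        omega
      rcases eq_or_ne u r with rfl | h2
      · omega
      · rcases eq_or_ne u (W.σ r) with rfl | h3
        · rw [W.σσ] at h1
          omega
        · have := W.nest r u (by omega) (by omega)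
          omega
    · have hrL := hno r har hlt
      rw [letter_succ, face_apply, word_letter_σ hs hsL (show r < W.N by omega) hrL,
        Γ.edge_edge]
      exact hv.trans (sameVertex_rot _)
  refine key _ (a + 1) rfl (by omega) hab ?_ ?_
  · intro u hu
    by_contra h
    rcases eq_or_ne u a with rfl | h1
    · omega
    · exact W.not_L u a (by omega) (by omega) ha
  · rw [letter_succ, face_apply]
    exact sameVertex_rot _

/-- The inner contour runs through the cycle in the opposite direction. -/
lemma face_edge_letter {a b : ℕ} (ha : a ∈ (word s hs hsL).L) (hab : a < b)
    (hb : b ∈ (word s hs hsL).L ∨ b = contourLength s)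
    (hno : ∀ r, a < r → r < b → r ∉ (word s hs hsL).L) :
    Γ.face (Γ.edge (letter s b)) = Γ.edge (letter s a) := by
  have hv := sameVertex_letter hs hsL ha hab hb hno
  have hbL : letter s b ∈ Γ.cycle := by
    rcases hb with hb | rfl
    · exact hb.2
    · rwa [letter_length]
  have h1 : ¬ Γ.Outer (Γ.edge (letter s b)) := by
    rw [outer_edge_iff hbL, not_not]
    exact outer_letter hs b
  have h2 : ¬ Γ.Outer (Γ.edge (letter s a)) := by
    rw [outer_edge_iff ha.2, not_not]
    exact outer_letter hs a
  have h3 : ¬ Γ.Outer (Γ.face (Γ.edge (letter s b))) := by rwa [outer_face]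
  have h4 : Γ.face (Γ.edge (letter s b)) ∈ Γ.cycle := by
    by_contra h
    exact h3 (outer_of_not_mem_cycle h)
  -- Both are inner cycle darts at one vertex.
  refine eq_of_sameVertex h4 (edge_mem_cycle.2 ha.2) ?_ (by tauto)
  rw [face_edge]
  exact (hv.trans (sameVertex_rot _)).symm

lemma exists_prev_L {b : ℕ} (h0 : 0 < b) : ∃ a ∈ (word s hs hsL).L, a < b ∧
    ∀ r, a < r → r < b → r ∉ (word s hs hsL).L := by
  classical
  have h1 := Nat.findGreatest_spec (P := (· ∈ (word s hs hsL).L)) (n := b - 1) (Nat.zero_le _)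
    (word s hs hsL).zero_mem
  have h2 := Nat.findGreatest_le (P := (· ∈ (word s hs hsL).L)) (b - 1)
  refine ⟨_, h1, by omega, fun r hr1 hr2 hr => ?_⟩
  have := Nat.le_findGreatest (P := (· ∈ (word s hs hsL).L)) (n := b - 1) (m := r) (by omega) hr
  omega

/-- The first return to a set of edges along the inner contour. -/
lemma firstReturn_edge_letter {K : Set (Fin Γ.n)} (hK : ∀ z, Γ.edge z ∈ K ↔ z ∈ K) {a b : ℕ}
    (ha : a ∈ (word s hs hsL).L) (hab : a < b)
    (hb : b ∈ (word s hs hsL).L ∨ b = contourLength s) (haK : letter s a ∈ K)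
    (hno : ∀ r, a < r → r < b → r ∈ (word s hs hsL).L → letter s r ∉ K) :
    FirstReturn Γ.face K (Γ.edge (letter s b)) (Γ.edge (letter s a)) := by
  induction b using Nat.strong_induction_on with
  | _ b ih =>
  obtain ⟨c, hc, hcb, hc1⟩ := exists_prev_L hs hsL (b := b) (by omega)
  have hf := face_edge_letter hs hsL hc hcb hb hc1
  have hac : a ≤ c := by
    by_contra h
    exact hc1 a (by omega) hab ha
  rcases hac.lt_or_eq with h | rfl
  · obtain ⟨m, hm, h1, h2, h3⟩ := ih c hcb h (Or.inl hc)
      fun r h1 h2 => hno r h1 (by omega)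
    refine ⟨m + 1, by omega, by rw [pow_succ, Equiv.Perm.mul_apply, hf, h1], h2, ?_⟩
    intro j hj0 hj
    obtain ⟨j, rfl⟩ : ∃ i, j = i + 1 := ⟨j - 1, by omega⟩
    rw [pow_succ, Equiv.Perm.mul_apply, hf]
    rcases Nat.eq_zero_or_pos j with rfl | hj1
    · rw [pow_zero, Equiv.Perm.one_apply, hK]
      exact hno c h hcb hc
    · exact h3 j hj1 (by omega)
  · exact ⟨1, one_pos, by rw [pow_one, hf], (hK _).2 haK, fun j h1 h2 => by omega⟩

end PlaneType

namespace MetricCells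

open RayGraph PlaneType

variable {k : ℕ} {τ : ℝ} {G H : MetricCells k τ} [NeZero k]

omit [NeZero k] in
lemma exists_start {j : Fin k} (hj : 0 < G.coord j) :
    ∃ s ∈ G.1.cycle, G.1.NextRay s j ∧ G.1.Outer s := by
  have h1 : G.1.cycleGap G.2.1 j ≠ 0 := by
    rw [cycleGap_eq_max G.2.2.nonneg]
    exact (lt_max_of_lt_left hj).ne'
  obtain ⟨s, h2, h3⟩ := exists_of_cycleGap_ne_zero h1
  exact ⟨s, h2, h3, _, h3.sameFace⟩

lemma exists_coord_pos (hτ : 0 < τ) (G : MetricCells k τ) : ∃ j, 0 < G.coord j := by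
  by_contra h
  push Not at h
  have h1 := sum_max_coord G.2.2
  have h2 : ∀ j ∈ Finset.univ, max (G.1.coord G.2.1 j) 0 = 0 := fun j _ => max_eq_right (h j)
  rw [Finset.sum_eq_zero h2] at h1
  exact hτ.ne h1

variable {s : Fin G.1.n} (hs : G.1.Outer s) (hsL : s ∈ G.1.cycle)

lemma mem_R_iff {p : ℕ} (hp : p < contourLength s) :
    p ∈ (word s hs hsL).R ↔ G.1.edge (letter s p) = letter s p := by
  rw [G.1.edge_eq_self_iff]
  exact ⟨fun h => h.2, fun h => ⟨hp, h⟩⟩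

lemma kept_word_iff {p : ℕ} : (word s hs hsL).Kept (wordLength s G.2.1) p ↔
    p < contourLength s ∧ letter s p ∈ G.kept := by
  refine and_congr_right fun (hp : p < contourLength s) => ?_
  rw [mem_R_iff hs hsL hp, wordLength_of_lt hp]
  rfl

lemma exists_L_iff {j₀ : Fin k} (hj : G.1.NextRay s j₀) (r : ℕ) :
    (∃ p ∈ (word s hs hsL).L, 0 < wordLength s G.2.1 p ∧ (word s hs hsL).γ p = r) ↔
      r < k ∧ 0 < G.coord ((finRotate k ^ r) j₀) := by
  have hpos : ∀ j, 0 < G.coord j ↔ 0 < G.1.cycleGap G.2.1 j := fun j => by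
    rw [cycleGap_eq_max G.2.2.nonneg]
    simp [coord]
  constructor
  · rintro ⟨p, ⟨hp, hpL⟩, h1, rfl⟩
    refine ⟨γ_L_lt hs hsL hp hpL, ?_⟩
    rw [hpos, cycleGap_eq hpL (nextRay_letter hs hsL hj hp.le)]
    rwa [wordLength_of_lt hp] at h1
  · rintro ⟨hr, h1⟩
    rw [hpos] at h1
    obtain ⟨d, hd, hd1⟩ := exists_of_cycleGap_ne_zero h1.ne'
    obtain ⟨p, hp, rfl⟩ := exists_letter hs ⟨_, hd1.sameFace⟩
    refine ⟨p, ⟨hp, hd⟩, ?_, ?_⟩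
    · rw [cycleGap_eq hd hd1] at h1
      rwa [wordLength_of_lt hp]
    · exact finRotate_pow_inj j₀ (γ_L_lt hs hsL hp hd) hr
        ((nextRay_letter hs hsL hj hp.le).unique hd1)

/-- A metric graph is obtained by collapsing edges from every metric graph with the same
coordinates. -/
theorem collapses_of_coord_eq (hτ : 0 < τ) (hpos : ∀ d, d ∈ H.kept) (hGH : G.coord = H.coord) :
    Collapses G H := by
  -- Both contours start in the same gap, one with a positive coordinate, so that it shows a cycle
  -- edge in both graphs.
  obtain ⟨j₀, hj₀⟩ := exists_coord_pos hτ G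
  obtain ⟨s, hsL, hsj, hs⟩ := exists_start hj₀
  obtain ⟨t, htL, htj, ht⟩ := exists_start (hGH ▸ hj₀)
  set W := word s hs hsL with hW
  set V := word t ht htL with hV
  have hVal : G.1.valley G.2.1 = H.1.valley H.2.1 := by
    funext j
    rw [valley_eq_max G.2.2.nonneg, valley_eq_max H.2.2.nonneg]
    exact congrArg (fun x => max (- x) 0) (congrFun hGH j)
  have hGap : G.1.cycleGap G.2.1 = H.1.cycleGap H.2.1 := by
    funext j
    rw [cycleGap_eq_max G.2.2.nonneg, cycleGap_eq_max H.2.2.nonneg]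
    exact congrArg (fun x => max x 0) (congrFun hGH j)
  have hv := isValley_word hs hsL G.2.2.nonneg hsj
  have hv' := isValley_word ht htL H.2.2.nonneg htj
  rw [← hVal] at hv'
  have hlG := wordLength_nonneg (s := s) G.2.2.nonneg
  have hlH := wordLength_nonneg (s := t) H.2.2.nonneg
  obtain ⟨F, F1, F2, F3, F4, F5, F6, F7, F8⟩ := ContourWord.exists_matching (W := W) (W' := V)
    hlG (wordLength_partner hs G.2.2.edge) hv hlH (wordLength_partner ht H.2.2.edge) hv'
    (by rw [hW, hV, γ_word, γ_word])
    (fun r => by rw [exists_L_iff hs hsL hsj, exists_L_iff ht htL htj, hGH])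
  have hkV : ∀ {p}, p < contourLength t → V.Kept (wordLength t H.2.1) p := fun hp =>
    (kept_word_iff ht htL).2 ⟨hp, hpos _⟩
  have hFN : ∀ {p}, p < contourLength t → F p < contourLength s := fun hp => (F1 _ (hkV hp)).1
  have hFk : ∀ {p}, p < contourLength t → letter s (F p) ∈ G.kept := fun hp =>
    ((kept_word_iff hs hsL).1 (F1 _ (hkV hp))).2
  have hFsurj : ∀ {q}, q < contourLength s → letter s q ∈ G.kept →
      ∃ p < contourLength t, F p = q := by
    intro q hq hqk
    obtain ⟨p, hp, h⟩ := F2 q ((kept_word_iff hs hsL).2 ⟨hq, hqk⟩)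
    exact ⟨p, hp.1, h⟩
  have hlabel : ∀ {p}, p < contourLength t → ∀ {j}, H.1.NextRay (letter t p) j →
      G.1.NextRay (letter s (F p)) j := by
    intro p hp j hj
    rw [← (nextRay_letter ht htL htj hp.le).unique hj, ← F7 _ (hkV hp)]
    exact nextRay_letter hs hsL hsj (hFN hp).le
  have ht0 := contourLength_pos t
  -- Gap `j₀` shows only one cycle edge, so the start is matched with the start.
  have hF0 : F 0 = 0 := by
    have h0 : F 0 ∈ W.L := (F5 _ (hkV ht0)).1 V.zero_mem
    have h1 := cycle_nextRay_unique h0.2 hsL (hlabel ht0 htj) hsj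
    exact letter_inj (hFN ht0) (contourLength_pos s) h1
  -- the positions of the darts of `H`
  have hpt : ∀ d, ∃ p < contourLength t, letter t p = d ∨
      (p ∈ V.L ∧ H.1.edge (letter t p) = d) := by
    intro d
    by_cases ho : H.1.Outer d
    · obtain ⟨p, hp, h⟩ := exists_letter ht ho
      exact ⟨p, hp, Or.inl h⟩
    · have hdL : d ∈ H.1.cycle := by
        by_contra h
        exact ho (outer_of_not_mem_cycle h)
      obtain ⟨p, hp, h⟩ := exists_letter ht ((outer_edge_iff hdL).2 ho)
      exact ⟨p, hp, Or.inr ⟨⟨hp, h ▸ edge_mem_cycle.2 hdL⟩, by rw [h, H.1.edge_edge]⟩⟩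
  have hVo : ∀ {p}, p ∈ V.L → ¬ H.1.Outer (H.1.edge (letter t p)) := fun {p} hp => by
    rw [outer_edge_iff hp.2, not_not]
    exact outer_letter ht p
  have hWo : ∀ {p}, p ∈ W.L → ¬ G.1.Outer (G.1.edge (letter s p)) := fun {p} hp => by
    rw [outer_edge_iff hp.2, not_not]
    exact outer_letter hs p
  -- Outer darts are mapped by `F`; the inner side of a cycle edge follows its outer side.
  have hex : ∃ f : Fin H.1.n → Fin G.1.n, (∀ p < contourLength t, f (letter t p) =
      letter s (F p)) ∧ ∀ p ∈ V.L, f (H.1.edge (letter t p)) = G.1.edge (letter s (F p)) := by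
    classical
    choose P hP1 hP2 using hpt
    refine ⟨fun d => if H.1.Outer d then letter s (F (P d)) else G.1.edge (letter s (F (P d))),
      fun p hp => ?_, fun p hp => ?_⟩
    · have ho : H.1.Outer (letter t p) := outer_letter ht p
      simp only [if_pos ho]
      rcases hP2 (letter t p) with h | ⟨h1, h⟩
      · rw [letter_inj (hP1 _) hp h]
      · rw [← h] at ho
        exact absurd ho (hVo h1)
    · have ho := hVo hp
      simp only [if_neg ho]
      rcases hP2 (H.1.edge (letter t p)) with h | ⟨h1, h⟩
      · rw [← h] at ho
        exact absurd (outer_letter ht _) ho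
      · rw [edge_inj] at h
        rw [letter_inj (hP1 _) hp.1 h]
  obtain ⟨f, fA, fB⟩ := hex
  have fB' : ∀ p < contourLength t, f (H.1.edge (letter t p)) = G.1.edge (letter s (F p)) := by
    intro p hp
    by_cases hpL : p ∈ V.L
    · exact fB p hpL
    · have hσp : V.σ p < contourLength t := ContourWord.σ_lt (W := V) hp
      rw [← word_letter_σ ht htL hp hpL, fA _ hσp, F4 _ (hkV hp),
        word_letter_σ hs hsL (hFN hp) fun h => hpL ((F5 _ (hkV hp)).2 h)]
  have hFinj : ∀ {p q}, p < contourLength t → q < contourLength t → F p = F q → p = q := by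
    intro p q hp hq h
    rcases lt_trichotomy p q with h1 | h1 | h1
    · have := (F3 _ _ (hkV hp) (hkV hq)).1 h1
      omega
    · exact h1
    · have := (F3 _ _ (hkV hq) (hkV hp)).1 h1
      omega
  have hLF : ∀ {p}, p ∈ V.L → F p ∈ W.L := fun hp => (F5 _ (hkV hp.1)).1 hp
  have hedge : ∀ d, f (H.1.edge d) = G.1.edge (f d) := by
    intro d
    obtain ⟨p, hp, rfl | ⟨h1, rfl⟩⟩ := hpt d
    · rw [fB' p hp, fA p hp]
    · rw [H.1.edge_edge, fB p h1, fA p hp, G.1.edge_edge]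
  have hlen : ∀ d, H.2.1 d = G.2.1 (f d) := by
    have h1 : ∀ p < contourLength t, H.2.1 (letter t p) = G.2.1 (letter s (F p)) := by
      intro p hp
      by_cases hpL : p ∈ V.L
      · have h2 := nextRay_letter ht htL htj hp.le
        rw [← cycleGap_eq (ℓ := H.2.1) hpL.2 h2, ← cycleGap_eq (ℓ := G.2.1) (hLF hpL).2 (hlabel hp h2), hGap]
      by_cases hpR : p ∈ V.R
      · obtain ⟨i, hi⟩ := hpR.2
        obtain ⟨i', hi'⟩ := ((F6 _ (hkV hp)).1 hpR).2
        rw [← hi, ← hi', H.2.2.ray, G.2.2.ray]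
      · have := F8 _ (hkV hp) hpL hpR
        rw [wordLength_of_lt (hFN hp), wordLength_of_lt hp] at this
        exact this.symm
    intro d
    obtain ⟨p, hp, rfl | ⟨-, rfl⟩⟩ := hpt d
    · rw [fA p hp, h1 p hp]
    · rw [fB' p hp, H.2.2.edge, G.2.2.edge, h1 p hp]
  have hkept : ∀ d, f d ∈ G.kept := by
    intro d
    obtain ⟨p, hp, rfl | ⟨-, rfl⟩⟩ := hpt d
    · rw [fA p hp]
      exact hFk hp
    · rw [fB' p hp, edge_mem_kept]
      exact hFk hp
  refine ⟨f, ?_, ?_, hedge, ?_, ?_, hlen⟩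
  · intro d e hde
    obtain ⟨p, hp, rfl | ⟨h1, rfl⟩⟩ := hpt d <;> obtain ⟨q, hq, rfl | ⟨h2, rfl⟩⟩ := hpt e
    · rw [fA p hp, fA q hq] at hde
      rw [hFinj hp hq (letter_inj (hFN hp) (hFN hq) hde)]
    · rw [fA p hp, fB q h2] at hde
      exact absurd (hde ▸ outer_letter hs _) (hWo (hLF h2))
    · rw [fA q hq, fB p h1] at hde
      exact absurd (hde ▸ outer_letter hs _) (hWo (hLF h1))
    · rw [fB p h1, fB q h2, edge_inj] at hde
      rw [hFinj hp hq (letter_inj (hFN hp) (hFN hq) hde)]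
  · refine Set.Subset.antisymm (Set.range_subset_iff.2 hkept) fun z hz => ?_
    by_cases ho : G.1.Outer z
    · obtain ⟨q, hq, rfl⟩ := exists_letter hs ho
      obtain ⟨p, hp, rfl⟩ := hFsurj hq hz
      exact ⟨_, fA p hp⟩
    · have hzL : z ∈ G.1.cycle := by
        by_contra h
        exact ho (outer_of_not_mem_cycle h)
      obtain ⟨q, hq, h⟩ := exists_letter hs ((outer_edge_iff hzL).2 ho)
      obtain ⟨p, hp, rfl⟩ := hFsurj hq (by rw [h]; exact edge_mem_kept.2 hz)
      exact ⟨_, by rw [fB' p hp, h, G.1.edge_edge]⟩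
  · intro i
    obtain ⟨p, hp, h⟩ := exists_letter ht (d := H.1.ray i) ⟨i, Equiv.Perm.SameCycle.refl _ _⟩
    obtain ⟨-, i', hi'⟩ := (F6 _ (hkV hp)).1 ⟨hp, i, h.symm⟩
    rw [← h, fA p hp, ← hi']
    congr 1
    have h1 := hlabel hp (h ▸ nextRay_ray i)
    rw [← hi'] at h1
    exact (nextRay_ray i').unique h1
  · intro d
    obtain ⟨p, hp, rfl | ⟨h1, rfl⟩⟩ := hpt d
    -- `q` is the next kept position of `G`. After the last letter of `H` it is the end of the
    -- contour, which is the start again.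
    · obtain ⟨q, hq1, hqN, hq2, hq3⟩ : ∃ q, F p < q ∧ q ≤ contourLength s ∧
          letter s q = f (letter t (p + 1)) ∧ ∀ r < contourLength t, p < r → q ≤ F r := by
        by_cases h : p + 1 < contourLength t
        · refine ⟨F (p + 1), (F3 _ _ (hkV hp) (hkV h)).1 (by omega), (hFN h).le, (fA _ h).symm,
            fun r hr hpr => ?_⟩
          rcases (Nat.succ_le_of_lt hpr).lt_or_eq with h2 | rfl
          · exact ((F3 _ _ (hkV h) (hkV hr)).1 h2).le
          · exact le_rfl
        · refine ⟨contourLength s, hFN hp, le_rfl, ?_, fun r hr hpr => by omega⟩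
          have h2 := fA 0 ht0
          rw [hF0, letter_zero, letter_zero] at h2
          rw [show p + 1 = contourLength t by omega, letter_length, letter_length, h2]
      have hadd : ∀ j, (G.1.face ^ j) (letter s (F p)) = letter s (F p + j) := fun j => by
        rw [letter, letter, ← Equiv.Perm.mul_apply, ← pow_add, add_comm]
      rw [fA p hp, ← letter_succ]
      refine ⟨q - F p, by omega, ?_, hkept _, fun j hj0 hj hjk => ?_⟩
      · rw [hadd, ← hq2]
        congr 1
        omega
      · rw [hadd] at hjk
        obtain ⟨r, hr, hFr⟩ := hFsurj (by omega) hjk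
        have h2 := (F3 _ _ (hkV hp) (hkV hr)).2 (by omega)
        have := hq3 r hr h2
        omega
    · -- the inner contour
      -- Position `0` is replaced by the end of the contour, so that there is a cycle edge at a
      -- smaller position.
      obtain ⟨b, hb0, hbp, hb⟩ : ∃ b, 0 < b ∧ letter t b = letter t p ∧
          (b ∈ V.L ∧ b = p ∨ b = contourLength t ∧ p = 0) := by
        rcases Nat.eq_zero_or_pos p with rfl | h
        · exact ⟨_, ht0, letter_length t, Or.inr ⟨rfl, rfl⟩⟩
        · exact ⟨p, h, rfl, Or.inl ⟨h1, rfl⟩⟩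
      obtain ⟨a, haL, hab, hno⟩ := exists_prev_L ht htL hb0
      rw [← hbp, face_edge_letter ht htL haL hab (hb.imp And.left And.left) hno, fB a haL, hbp,
        fB p h1]
      have haN := V.L_lt a haL
      obtain ⟨c, hc1, hc2, hc3, hc4⟩ : ∃ c, letter s c = letter s (F p) ∧ F a < c ∧
          (c ∈ W.L ∨ c = contourLength s) ∧
          ∀ r < contourLength t, F a < F r → F r < c → a < r ∧ r < b := by
        rcases hb with ⟨hbL, rfl⟩ | ⟨rfl, rfl⟩
        · exact ⟨F b, rfl, (F3 _ _ (hkV haN) (hkV hp)).1 hab, Or.inl (hLF hbL), fun r hr h2 h3 =>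
            ⟨(F3 _ _ (hkV haN) (hkV hr)).2 h2, (F3 _ _ (hkV hr) (hkV hp)).2 h3⟩⟩
        · exact ⟨contourLength s, by rw [letter_length, hF0, letter_zero], hFN haN, Or.inr rfl,
            fun r hr h2 _ => ⟨(F3 _ _ (hkV haN) (hkV hr)).2 h2, hr⟩⟩
      rw [← hc1]
      refine firstReturn_edge_letter hs hsL (fun z => edge_mem_kept) (hLF haL) hc2 hc3 (hFk haN)
        fun r hr1 hr2 hrL hrk => ?_
      obtain ⟨r', hr', rfl⟩ := hFsurj (W.L_lt r hrL) hrk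
      obtain ⟨h2, h3⟩ := hc4 r' hr' hr1 hr2
      exact hno r' h2 h3 ((F5 _ (hkV hr')).2 hrL)

end MetricCells

/-! ### The plane graph of a contour word -/

lemma finRotate_pow_val_of_fin {N : ℕ} (r : ℕ) (p : Fin N) :
    (((finRotate N) ^ r) p : ℕ) = (p + r) % N := by
  obtain ⟨n, rfl⟩ : ∃ n, N = n + 1 := ⟨N - 1, by have := p.2; omega⟩
  exact finRotate_pow_val r p

lemma finRotate_val {N : ℕ} (p : Fin N) : (finRotate N p : ℕ) = (p + 1) % N := by
  simpa using finRotate_pow_val_of_fin 1 p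

lemma numCycles_eq_card {X T : Type*} [Fintype T] {g : Equiv.Perm X} (t : T → X)
    (h1 : ∀ a b, g.SameCycle (t a) (t b) → a = b) (h2 : ∀ x, ∃ a, g.SameCycle x (t a)) :
    numCycles g = Fintype.card T := by
  rw [numCycles, ← Nat.card_eq_fintype_card]
  symm
  refine Nat.card_congr (Equiv.ofBijective (fun a => Quotient.mk (Equiv.Perm.SameCycle.setoid g)
    (t a)) ⟨fun a b hab => h1 a b (Quotient.exact hab), fun q => ?_⟩)
  induction q using Quotient.inductionOn with
  | h x =>
    obtain ⟨a, ha⟩ := h2 x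
    exact ⟨a, Quotient.sound ha.symm⟩

lemma Equiv.permCongr_pow_apply {X Y : Type*} (e : X ≃ Y) (g : Equiv.Perm X) (n : ℕ) (x : X) :
    ((e.permCongr g) ^ n) (e x) = e ((g ^ n) x) := by
  induction n generalizing x with
  | zero => rfl
  | succ n ih =>
    rw [pow_succ, pow_succ, Equiv.Perm.mul_apply, Equiv.Perm.mul_apply, ← ih]
    simp

lemma Equiv.permCongr_sameCycle_iff {X Y : Type*} [Finite X] (e : X ≃ Y) {g : Equiv.Perm X}
    {x y : X} : (e.permCongr g).SameCycle (e x) (e y) ↔ g.SameCycle x y := by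
  have : Finite Y := Finite.of_equiv X e
  constructor
  · intro h
    obtain ⟨n, -, hn⟩ := h.exists_pow_eq_of_finite
    rw [e.permCongr_pow_apply] at hn
    exact ⟨n, by rw [zpow_natCast]; exact e.injective hn⟩
  · intro h
    obtain ⟨n, -, rfl⟩ := h.exists_pow_eq_of_finite
    exact ⟨n, by rw [zpow_natCast, e.permCongr_pow_apply]⟩

namespace ContourWord

variable (W : ContourWord)

lemma N_pos : 0 < W.N := W.L_lt 0 W.zero_mem

/-- The edges of the cycle. -/
abbrev CycleEdge : Type := {p : Fin W.N // (p : ℕ) ∈ W.L}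

/-- The darts of the graph with outer contour `W`: the sides of the edges that lie in the outer
face, and the inner sides of the edges of the cycle. -/
abbrev Dart : Type := Fin W.N ⊕ W.CycleEdge

open Classical in
noncomputable instance : Fintype W.Dart := inferInstance

variable {W}

open Classical in
lemma exists_prev (p : ℕ) (hp : 0 < p) : ∃ q ∈ W.L, q < p ∧ ∀ r ∈ W.L, r < p → r ≤ q := by
  have h1 := Nat.findGreatest_spec (P := (· ∈ W.L)) (n := p - 1) (Nat.zero_le _) W.zero_mem
  have h2 := Nat.findGreatest_le (P := (· ∈ W.L)) (p - 1)
  exact ⟨_, h1, by omega, fun r hr hrp => Nat.le_findGreatest (by omega) hr⟩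

/-- The contour position of a letter, where the first letter also counts as the last one. -/
def corner (W : ContourWord) (p : ℕ) : ℕ := if p = 0 then W.N else p

lemma corner_pos (p : ℕ) : 0 < W.corner p := by
  unfold corner
  split_ifs with h
  · exact W.N_pos
  · omega

lemma corner_succ {p : ℕ} (hp : p < W.N) : W.corner ((p + 1) % W.N) = p + 1 := by
  unfold corner
  rcases (Nat.succ_le_of_lt hp).lt_or_eq with h | h
  · rw [Nat.mod_eq_of_lt h, if_neg (by omega)]
  · rw [Nat.succ_eq_add_one] at h
    rw [h, Nat.mod_self, if_pos rfl]

/-- The previous edge of the cycle. -/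
noncomputable def prevFun (p : W.CycleEdge) : W.CycleEdge :=
  ⟨⟨(exists_prev (W := W) (W.corner p.1) (corner_pos _)).choose,
    W.L_lt _ (exists_prev (W := W) (W.corner p.1) (corner_pos _)).choose_spec.1⟩,
    (exists_prev (W := W) (W.corner p.1) (corner_pos _)).choose_spec.1⟩

lemma prevFun_spec (p : W.CycleEdge) : ((prevFun p).1 : ℕ) < W.corner p.1 ∧
    ∀ r ∈ W.L, r < W.corner p.1 → r ≤ (prevFun p).1 :=
  (exists_prev (W := W) (W.corner p.1) (corner_pos _)).choose_spec.2

lemma prevFun_injective : Function.Injective (prevFun (W := W)) := by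
  have key : ∀ p q : W.CycleEdge, W.corner p.1 < W.corner q.1 → prevFun p ≠ prevFun q := by
    intro p q h h'
    have h1 := (prevFun_spec p).1
    have h2 := (prevFun_spec q).2 p.1 p.2
    rw [h'] at h1
    have hp0 : W.corner p.1 = p.1 := by
      unfold corner at h ⊢
      have := p.1.2
      have := q.1.2
      split_ifs at h ⊢ <;> omega
    omega
  intro p q h
  have h1 : W.corner p.1 = W.corner q.1 := by
    rcases lt_trichotomy (W.corner p.1) (W.corner q.1) with h1 | h1 | h1
    · exact absurd h (key _ _ h1)
    · exact h1
    · exact absurd h.symm (key _ _ h1)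
  apply Subtype.ext
  apply Fin.ext
  unfold corner at h1
  have := p.1.2
  have := q.1.2
  split_ifs at h1 <;> omega

/-- The previous edge of the cycle. -/
noncomputable def prev : Equiv.Perm W.CycleEdge :=
  Equiv.ofBijective prevFun (Finite.injective_iff_bijective.1 prevFun_injective)

lemma prev_lt (p : W.CycleEdge) : ((prev p).1 : ℕ) < W.corner p.1 := (prevFun_spec p).1

lemma le_prev (p : W.CycleEdge) {r : ℕ} (hr : r ∈ W.L) (h : r < W.corner p.1) :
    r ≤ (prev p).1 := (prevFun_spec p).2 r hr h

/-- The edge of the cycle where the contour starts. -/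
def start (W : ContourWord) : W.CycleEdge := ⟨⟨0, W.N_pos⟩, W.zero_mem⟩

/-- `prev` lowers the position until the start is reached, so there is a single inner face. -/
lemma prev_sameCycle (p : W.CycleEdge) : prev.SameCycle p W.start := by
  obtain ⟨⟨p, hp⟩, hL⟩ := p
  induction p using Nat.strong_induction_on with
  | _ p ih =>
  rcases Nat.eq_zero_or_pos p with rfl | h0
  · exact Equiv.Perm.SameCycle.refl _ _
  · have h1 := prev_lt ⟨⟨p, hp⟩, hL⟩
    rw [corner, if_neg (by simp; omega)] at h1
    exact (Equiv.Perm.sameCycle_apply_self _ _).trans (ih _ h1 (prev ⟨⟨p, hp⟩, hL⟩).1.2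
      (prev ⟨⟨p, hp⟩, hL⟩).2)

open Classical in
/-- The other dart of an edge. -/
noncomputable def edgeFun : W.Dart → W.Dart
  | .inl p => if h : (p : ℕ) ∈ W.L then .inr ⟨p, h⟩ else .inl ⟨W.σ p, σ_lt p.2⟩
  | .inr p => .inl p.1

lemma edgeFun_L {p : Fin W.N} (h : (p : ℕ) ∈ W.L) : edgeFun (.inl p) = .inr ⟨p, h⟩ := dif_pos h

lemma edgeFun_of_not {p : Fin W.N} (h : (p : ℕ) ∉ W.L) :
    edgeFun (.inl p) = .inl ⟨W.σ p, σ_lt p.2⟩ := dif_neg h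

lemma σ_not_L {p : ℕ} (h : p ∉ W.L) : W.σ p ∉ W.L := fun h' => by
  have h1 := W.σσ p
  rw [σ_L h'] at h1
  exact h (h1 ▸ h')

lemma edgeFun_involutive : Function.Involutive (edgeFun (W := W)) := by
  rintro (p | p)
  · by_cases h : (p : ℕ) ∈ W.L
    · rw [edgeFun_L h]
      rfl
    · rw [edgeFun_of_not h, edgeFun_of_not (σ_not_L h)]
      simp [W.σσ]
  · exact edgeFun_L p.2

/-- The other dart of an edge. -/
noncomputable def edgePerm : Equiv.Perm W.Dart := edgeFun_involutive.toPerm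

/-- The boundary contours. -/
noncomputable def facePerm : Equiv.Perm W.Dart := Equiv.sumCongr (finRotate W.N) prev

/-- Turning around a vertex. -/
noncomputable def rotPerm : Equiv.Perm W.Dart := facePerm * edgePerm

lemma edgePerm_L {p : Fin W.N} (h : (p : ℕ) ∈ W.L) : edgePerm (.inl p) = .inr ⟨p, h⟩ :=
  edgeFun_L h

lemma edgePerm_of_not {p : Fin W.N} (h : (p : ℕ) ∉ W.L) :
    edgePerm (.inl p) = .inl ⟨W.σ p, σ_lt p.2⟩ := edgeFun_of_not h

lemma edgePerm_inr (p : W.CycleEdge) : edgePerm (.inr p) = .inl p.1 := rfl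

lemma edgePerm_edgePerm (d : W.Dart) : edgePerm (edgePerm d) = d := edgeFun_involutive d

lemma facePerm_inl (p : Fin W.N) : facePerm (.inl p) = .inl (finRotate W.N p) := rfl

lemma facePerm_inr (p : W.CycleEdge) : facePerm (.inr p) = .inr (prev p) := rfl

lemma facePerm_pow_inl (p : Fin W.N) (n : ℕ) :
    (facePerm ^ n) (.inl p : W.Dart) = .inl ((finRotate W.N ^ n) p) := by
  induction n with
  | zero => rfl
  | succ n ih => rw [pow_succ', pow_succ', Equiv.Perm.mul_apply, ih, facePerm_inl]; rfl

lemma rotPerm_edgePerm : rotPerm * edgePerm = (facePerm : Equiv.Perm W.Dart) := by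
  ext1 d
  simp [rotPerm, edgePerm_edgePerm]

lemma rotPerm_L {p : Fin W.N} (h : (p : ℕ) ∈ W.L) :
    rotPerm (.inl p) = .inr (prev ⟨p, h⟩) := by
  rw [rotPerm, Equiv.Perm.mul_apply, edgePerm_L h, facePerm_inr]

lemma rotPerm_of_not {p : Fin W.N} (h : (p : ℕ) ∉ W.L) :
    rotPerm (.inl p) = .inl (finRotate W.N ⟨W.σ p, σ_lt p.2⟩) := by
  rw [rotPerm, Equiv.Perm.mul_apply, edgePerm_of_not h, facePerm_inl]

lemma rotPerm_inr (p : W.CycleEdge) : rotPerm (.inr p) = .inl (finRotate W.N p.1) := rfl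

lemma finRotate_eq_mk {p : ℕ} (hp : p + 1 < W.N) :
    finRotate W.N ⟨p, by omega⟩ = ⟨p + 1, hp⟩ := by
  apply Fin.ext
  rw [finRotate_val]
  exact Nat.mod_eq_of_lt hp

lemma succ_lt_of_L {p : ℕ} (hp : p ∈ W.L) : p + 1 < W.N := by
  have := W.L_lt p hp
  have := (W.v3 p hp).2
  omega

/-- After a letter that does not lie on the cycle. -/
lemma rotPerm_cases {p : Fin W.N} (h : (p : ℕ) ∉ W.L) :
    (∃ h' : W.σ p + 1 < W.N, rotPerm (.inl p) = .inl ⟨W.σ p + 1, h'⟩) ∨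
      W.σ p + 1 = W.N ∧ rotPerm (.inl p) = .inl ⟨0, W.N_pos⟩ := by
  rw [rotPerm_of_not h]
  have h1 := σ_lt p.2
  by_cases h2 : W.σ p + 1 < W.N
  · exact Or.inl ⟨h2, by rw [finRotate_eq_mk h2]⟩
  · refine Or.inr ⟨by omega, ?_⟩
    congr 1
    apply Fin.ext
    rw [finRotate_val]
    dsimp only
    rw [show W.σ p + 1 = W.N by omega, Nat.mod_self]

/-- The conditions `v1`, `v2`, `v3` turn back into valence at least three. When the turn arrives at
the end of the word, the next dart is letter `0`, which is on the cycle. -/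
lemma rotPerm_ne (d : W.Dart) : rotPerm d ≠ d ∧ rotPerm (rotPerm d) ≠ d := by
  rcases d with p | p
  · by_cases h : (p : ℕ) ∈ W.L
    · rw [rotPerm_L h]
      refine ⟨by simp, ?_⟩
      rw [rotPerm_inr]
      intro h1
      rw [Sum.inl.injEq, ← Fin.val_inj, finRotate_val,
        Nat.mod_eq_of_lt (succ_lt_of_L (prev ⟨p, h⟩).2)] at h1
      exact (W.v3 _ (prev ⟨p, h⟩).2).1 (h1 ▸ h)
    · rcases rotPerm_cases h with ⟨h', e⟩ | ⟨h', e⟩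
      · have h1 := W.v1 (W.σ p)
        rw [W.σσ] at h1
        rw [e]
        refine ⟨fun h2 => h1 ?_, ?_⟩
        · rw [Sum.inl.injEq, ← Fin.val_inj] at h2
          exact h2.symm
        by_cases h2 : W.σ p + 1 ∈ W.L
        · rw [rotPerm_L (p := ⟨W.σ p + 1, h'⟩) h2]
          simp
        · rcases rotPerm_cases (p := ⟨W.σ p + 1, h'⟩) h2 with ⟨h'', e'⟩ | ⟨h'', e'⟩
          · rw [e', ne_eq, Sum.inl.injEq, ← Fin.val_inj]
            dsimp only at h'' ⊢
            intro h3
            rcases lt_or_ge (W.σ p) p with h4 | h4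
            · have h5 := W.v2 (W.σ p) (by rw [W.σσ]; exact h4)
              rw [W.σσ] at h5
              exact h5 h3
            -- Here the bracket `q` around `p` would contain nothing but `p` and its partner.
            · set q := W.σ (W.σ p + 1) with hq
              have hqq : W.σ q = W.σ p + 1 := W.σσ _
              have h5 := W.v2 q (by omega)
              rw [hqq, h3] at h5
              exact h5 rfl
          · rw [e', ne_eq, Sum.inl.injEq, ← Fin.val_inj]
            intro h3
            exact h (by rw [← h3]; exact W.zero_mem)
      · rw [e]
        refine ⟨fun h2 => ?_, ?_⟩
        · rw [Sum.inl.injEq, ← Fin.val_inj] at h2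
          exact h (by rw [← h2]; exact W.zero_mem)
        · rw [rotPerm_L (p := ⟨0, W.N_pos⟩) W.zero_mem]
          simp
  · rw [rotPerm_inr]
    have h1 := succ_lt_of_L p.2
    have h2 : ((finRotate W.N p.1 : Fin W.N) : ℕ) = p.1 + 1 := by
      rw [finRotate_val, Nat.mod_eq_of_lt h1]
    have h3 : ((finRotate W.N p.1 : Fin W.N) : ℕ) ∉ W.L := by
      rw [h2]
      exact (W.v3 _ p.2).1
    refine ⟨by simp, ?_⟩
    rw [rotPerm_of_not h3]
    simp

/-- `q` is an edge of the cycle before position `p`, or a bridge below position `p`. -/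
def Open (W : ContourWord) (p q : ℕ) : Prop := q < p ∧ (q ∈ W.L ∨ q < W.σ q ∧ p ≤ W.σ q)

/-- A turn leads from corner `p` to corner `W.σ p + 1`. What lies between the two corners consists
of rays and complete brackets, so the cycle edges passed and the bridges below remain the same, and
the last of them can name the vertex. -/
lemma open_σ_succ {p q : ℕ} (hp : p ∉ W.L) (hpN : p < W.N) :
    W.Open (W.σ p + 1) q ↔ W.Open p q := by
  have hpp := W.σσ p
  have hqq := W.σσ q
  have hσN := σ_lt hpN
  unfold Open
  rcases lt_trichotomy (W.σ p) p with h | h | h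
  · -- a closing bracket
    constructor
    · rintro ⟨h1, h2 | ⟨h2, h3⟩⟩
      · exact ⟨by omega, Or.inl h2⟩
      · refine ⟨by omega, Or.inr ⟨h2, ?_⟩⟩
        rcases (show q ≤ W.σ p by omega).lt_or_eq with h4 | rfl
        · have := W.nest q (W.σ p) h4 (by omega)
          omega
        · omega
    · rintro ⟨h1, h2 | ⟨h2, h3⟩⟩
      · refine ⟨?_, Or.inl h2⟩
        by_contra h4
        exact W.not_L (W.σ p) q (by omega) (by omega) h2
      · rcases h3.lt_or_eq with h4 | h4
        · have := W.nest q p h1 h4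
          exact ⟨by omega, Or.inr ⟨h2, by omega⟩⟩
        · have : W.σ p = q := by rw [h4, hqq]
          exact ⟨by omega, Or.inr ⟨h2, by omega⟩⟩
  · rw [h]
    constructor
    · rintro ⟨h1, h2 | ⟨h2, h3⟩⟩
      · have : q ≠ p := fun h => hp (h ▸ h2)
        exact ⟨by omega, Or.inl h2⟩
      · have : q ≠ p := by rintro rfl; omega
        exact ⟨by omega, Or.inr ⟨h2, by omega⟩⟩
    · rintro ⟨h1, h2 | ⟨h2, h3⟩⟩
      · exact ⟨by omega, Or.inl h2⟩
      · have : p ≠ W.σ q := by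
          intro h4
          have : W.σ p = q := by rw [h4, hqq]
          omega
        exact ⟨by omega, Or.inr ⟨h2, by omega⟩⟩
  · constructor
    · rintro ⟨h1, h2 | ⟨h2, h3⟩⟩
      · have : q ≠ p := fun h => hp (h ▸ h2)
        have : q ≠ W.σ p := fun h => σ_not_L hp (h ▸ h2)
        refine ⟨?_, Or.inl h2⟩
        by_contra h4
        exact W.not_L p q (by omega) (by omega) h2
      · have h5 : q ≠ p := by rintro rfl; omega
        have h6 : q ≠ W.σ p := by rintro rfl; omega
        rcases lt_or_ge q p with h4 | h4
        · exact ⟨h4, Or.inr ⟨h2, by omega⟩⟩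
        · have := W.nest p q (by omega) (by omega)
          omega
    · rintro ⟨h1, h2 | ⟨h2, h3⟩⟩
      · exact ⟨by omega, Or.inl h2⟩
      · have : p ≠ W.σ q := by
          intro h4
          have : W.σ p = q := by rw [h4, hqq]
          omega
        have := W.nest q p h1 (by omega)
        exact ⟨by omega, Or.inr ⟨h2, by omega⟩⟩

/-- A name for the vertex at the start of a dart. -/
noncomputable def vertexName : W.Dart → ℕ
  | .inl p => sSup {q | W.Open (W.corner p) q}
  | .inr p => p.1

lemma vertexName_eq {p : Fin W.N} {q : ℕ} (h1 : W.Open (W.corner p) q)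
    (h2 : ∀ r, W.Open (W.corner p) r → r ≤ q) : vertexName (.inl p) = q :=
  IsGreatest.csSup_eq ⟨h1, h2⟩

lemma vertexName_inr (p : W.CycleEdge) : vertexName (.inr p) = p.1 := rfl

lemma vertexName_L {p : Fin W.N} (h : (p : ℕ) ∈ W.L) :
    vertexName (.inl p) = (prev ⟨p, h⟩).1 := by
  refine vertexName_eq ⟨prev_lt _, Or.inl (prev _).2⟩ ?_
  rintro r ⟨h1, h2 | ⟨h2, h3⟩⟩
  · exact le_prev ⟨p, h⟩ h2 h1
  · exfalso
    unfold corner at h1 h3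
    have h5 := σ_lt (lt_N_of_ne (W := W) (p := r) (by omega))
    split_ifs at h1 h3
    · omega
    · rcases h3.lt_or_eq with h4 | h4
      · exact W.not_L r p h1 h4 h
      · have := W.σσ r
        rw [← h4, σ_L h] at this
        omega

lemma vertexName_rot (d : W.Dart) : vertexName (rotPerm d) = vertexName d := by
  rcases d with p | p
  · by_cases h : (p : ℕ) ∈ W.L
    · rw [rotPerm_L h, vertexName_L h, vertexName_inr]
    · have hp0 : (p : ℕ) ≠ 0 := fun h0 => h (h0 ▸ W.zero_mem)
      rw [rotPerm_of_not h]
      change sSup {q | W.Open (W.corner (finRotate W.N ⟨W.σ p, σ_lt p.2⟩ : Fin W.N)) q} =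
        sSup {q | W.Open (W.corner p) q}
      rw [finRotate_val, corner_succ (σ_lt p.2), corner, if_neg hp0]
      congr 1
      ext q
      exact open_σ_succ h p.2
  · rw [rotPerm_inr, vertexName_inr]
    refine vertexName_eq ?_ ?_
    · rw [finRotate_val, corner_succ p.1.2]
      exact ⟨by omega, Or.inl p.2⟩
    · rintro r ⟨h1, -⟩
      rw [finRotate_val, corner_succ p.1.2] at h1
      omega

lemma vertexName_sameCycle {d e : W.Dart} (h : rotPerm.SameCycle d e) :
    vertexName e = vertexName d :=
  h.induct_of_closed (P := fun e => vertexName e = vertexName d)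
    (fun x hx => (vertexName_rot x).trans hx) rfl

section Count

-- `vertexName` is a complete invariant of vertices: the cycle edge or opening bracket `q` names the
-- vertex at corner `q + 1`, and turning from any dart leads to such a corner.
open Classical in
lemma numCycles_rotPerm : numCycles (rotPerm : Equiv.Perm W.Dart) =
    Fintype.card {q : Fin W.N // (q : ℕ) ∈ W.L ∨ (q : ℕ) < W.σ q} := by
  have hlt : ∀ q : {q : Fin W.N // (q : ℕ) ∈ W.L ∨ (q : ℕ) < W.σ q}, (q.1 : ℕ) + 1 < W.N := by
    rintro ⟨q, h | h⟩
    · exact succ_lt_of_L h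
    · have := σ_lt q.2
      dsimp only
      omega
  refine numCycles_eq_card (fun q => .inl ⟨q.1 + 1, hlt q⟩) ?_ ?_
  · have key : ∀ q : {q : Fin W.N // (q : ℕ) ∈ W.L ∨ (q : ℕ) < W.σ q},
        vertexName (.inl ⟨q.1 + 1, hlt q⟩) = q.1 := by
      rintro ⟨q, hq⟩
      refine vertexName_eq ?_ ?_
      · rw [corner, if_neg (by simp)]
        exact ⟨by simp, hq.imp_right fun h => ⟨h, h⟩⟩
      · rintro r ⟨h, -⟩
        rw [corner, if_neg (by simp)] at h
        exact Nat.le_of_lt_succ h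
    intro a b hab
    have := vertexName_sameCycle hab
    rw [key, key] at this
    exact Subtype.ext (Fin.ext this.symm)
  · have hinr : ∀ p : W.CycleEdge, ∃ q : {q : Fin W.N // (q : ℕ) ∈ W.L ∨ (q : ℕ) < W.σ q},
        rotPerm.SameCycle (.inr p) (.inl ⟨q.1 + 1, hlt q⟩) := by
      intro p
      refine ⟨⟨p.1, Or.inl p.2⟩, 1, ?_⟩
      rw [zpow_one, rotPerm_inr]
      exact congrArg _ (finRotate_eq_mk _)
    have hL : ∀ p : Fin W.N, (p : ℕ) ∈ W.L → ∃ q : {q : Fin W.N // (q : ℕ) ∈ W.L ∨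
        (q : ℕ) < W.σ q}, rotPerm.SameCycle (.inl p) (.inl ⟨q.1 + 1, hlt q⟩) := by
      intro p h
      obtain ⟨q, hq⟩ := hinr (prev ⟨p, h⟩)
      rw [← rotPerm_L h] at hq
      exact ⟨q, (Equiv.Perm.sameCycle_apply_self _ _).trans hq⟩
    -- From a ray or an opening bracket the turn moves to a later position. A closing bracket leads
    -- to the corner after its opening, and the end of the word to letter `0` on the cycle.
    have hinl : ∀ n p, ∀ hp : p < W.N, W.N - p = n → ∃ q : {q : Fin W.N // (q : ℕ) ∈ W.L ∨
        (q : ℕ) < W.σ q}, rotPerm.SameCycle (.inl ⟨p, hp⟩) (.inl ⟨q.1 + 1, hlt q⟩) := by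
      intro n
      induction n using Nat.strong_induction_on with
      | _ n ih =>
      intro p hp hn
      by_cases h : p ∈ W.L
      · exact hL _ h
      · have hs := Equiv.Perm.sameCycle_apply_self rotPerm (.inl ⟨p, hp⟩ : W.Dart)
        rcases rotPerm_cases (p := ⟨p, hp⟩) h with ⟨h', e⟩ | ⟨h', e⟩
        · rw [e] at hs
          rcases lt_or_ge (W.σ p) p with h1 | h1
          · exact ⟨⟨⟨W.σ p, σ_lt hp⟩, Or.inr (by dsimp only; rwa [W.σσ])⟩, hs⟩
          · obtain ⟨q, hq⟩ := ih (W.N - (W.σ p + 1)) (by omega) (W.σ p + 1) h' rfl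
            exact ⟨q, hs.trans hq⟩
        · rw [e] at hs
          obtain ⟨q, hq⟩ := hL ⟨0, W.N_pos⟩ W.zero_mem
          exact ⟨q, hs.trans hq⟩
    rintro (⟨p, hp⟩ | p)
    · exact hinl _ p hp rfl
    · exact hinr p

lemma edgePerm_sameCycle {d e : W.Dart} (h : edgePerm.SameCycle d e) : e = d ∨ e = edgePerm d :=
  h.induct_of_closed (P := fun e => e = d ∨ e = edgePerm d)
    (by
      rintro x (rfl | rfl)
      · exact Or.inr rfl
      · exact Or.inl (edgePerm_edgePerm _)) (Or.inl rfl)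

-- Finite edges are represented by the same letters as the vertices, the cycle edges and opening
-- brackets. With the `k` rays and two faces this yields Euler's formula.
open Classical in
lemma numCycles_edgePerm {k : ℕ} {ρ : Fin k → Fin W.N} (hρ : Function.Injective ρ)
    (hρR : ∀ p : Fin W.N, (p : ℕ) ∈ W.R ↔ ∃ j, ρ j = p) :
    numCycles (edgePerm : Equiv.Perm W.Dart) =
      Fintype.card {q : Fin W.N // (q : ℕ) ∈ W.L ∨ (q : ℕ) < W.σ q} + k := by
  have hR : ∀ j, (ρ j : ℕ) ∈ W.R := fun j => (hρR _).2 ⟨j, rfl⟩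
  have hfix : ∀ j, edgePerm (.inl (ρ j)) = .inl (ρ j) := by
    intro j
    rw [edgePerm_of_not fun h => W.disj _ h (hR j)]
    congr 1
    exact Fin.ext (σ_R (hR j))
  rw [numCycles_eq_card (T := {q : Fin W.N // (q : ℕ) ∈ W.L ∨ (q : ℕ) < W.σ q} ⊕ Fin k)
    (Sum.elim (fun q => .inl q.1) fun j => .inl (ρ j))]
  · rw [Fintype.card_sum, Fintype.card_fin]
  · rintro (⟨a, ha⟩ | a) (⟨b, hb⟩ | b) hab
    · rcases edgePerm_sameCycle hab with h | h
      · simp only [Sum.elim_inl, Sum.inl.injEq] at h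
        simp [h]
      · simp only [Sum.elim_inl] at h
        rcases ha with ha | ha
        · rw [edgePerm_L ha] at h
          simp at h
        · rw [edgePerm_of_not fun h' => by have := σ_L h'; omega, Sum.inl.injEq] at h
          subst h
          rcases hb with hb | hb
          · exact absurd (σ_L hb) (by rw [W.σσ]; exact ha.ne)
          · dsimp only at hb
            rw [W.σσ] at hb
            omega
    · exfalso
      rw [Equiv.Perm.sameCycle_comm] at hab
      rcases edgePerm_sameCycle hab with h | h
      all_goals
        simp only [Sum.elim_inl, Sum.elim_inr, hfix, Sum.inl.injEq] at h
        subst h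
        exact ha.elim (fun ha => W.disj _ ha (hR b)) fun ha => by
          have := σ_R (hR b)
          omega
    · exfalso
      rcases edgePerm_sameCycle hab with h | h
      all_goals
        simp only [Sum.elim_inl, Sum.elim_inr, hfix, Sum.inl.injEq] at h
        subst h
        rcases hb with ha | ha
        · exact W.disj _ ha (hR a)
        · have := σ_R (hR a)
          omega
    · rcases edgePerm_sameCycle hab with h | h
      all_goals
        simp only [Sum.elim_inr, hfix, Sum.inl.injEq] at h
        rw [hρ h]
  · rintro (p | p)
    · rcases cases_letter p.2 with h | h | h | h
      · exact ⟨.inl ⟨p, Or.inl h⟩, Equiv.Perm.SameCycle.refl _ _⟩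
      · obtain ⟨j, hj⟩ := (hρR p).1 h
        exact ⟨.inr j, by rw [Sum.elim_inr, hj]⟩
      · exact ⟨.inl ⟨p, Or.inr h⟩, Equiv.Perm.SameCycle.refl _ _⟩
      · refine ⟨.inl ⟨⟨W.σ p, σ_lt p.2⟩, Or.inr (by dsimp only; rwa [W.σσ])⟩, 1, ?_⟩
        rw [zpow_one, edgePerm_of_not fun h' => by have := σ_L h'; omega]
        rfl
    · exact ⟨.inl ⟨p.1, Or.inl p.2⟩, 1, rfl⟩

lemma facePerm_sameCycle_inl (p : Fin W.N) :
    facePerm.SameCycle (.inl ⟨0, W.N_pos⟩ : W.Dart) (.inl p) := by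
  refine ⟨(p : ℕ), ?_⟩
  rw [zpow_natCast, facePerm_pow_inl]
  congr 1
  apply Fin.ext
  rw [finRotate_pow_val_of_fin]
  simp [Nat.mod_eq_of_lt p.2]

lemma facePerm_sameCycle_inr (p : W.CycleEdge) : facePerm.SameCycle (.inr p : W.Dart)
    (.inr W.start) :=
  (prev_sameCycle p).induct_of_closed (P := fun q => facePerm.SameCycle (.inr p : W.Dart) (.inr q))
    (fun _ hq => hq.trans ⟨1, rfl⟩) (Equiv.Perm.SameCycle.refl _ _)

lemma facePerm_not_sameCycle (p : Fin W.N) (q : W.CycleEdge) :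
    ¬ facePerm.SameCycle (.inl p : W.Dart) (.inr q) := by
  intro h
  have := h.induct_of_closed (P := fun d => d.isLeft = true) (by
    rintro (x | x) hx
    · rfl
    · simp at hx) rfl
  simp at this

lemma numCycles_facePerm : numCycles (facePerm : Equiv.Perm W.Dart) = 2 := by
  rw [numCycles_eq_card (T := Unit ⊕ Unit)
    (Sum.elim (fun _ => .inl ⟨0, W.N_pos⟩) fun _ => .inr W.start)]
  · rfl
  · rintro (⟨⟩ | ⟨⟩) (⟨⟩ | ⟨⟩) h
    · rfl
    · exact absurd h (facePerm_not_sameCycle _ _)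
    · exact absurd h.symm (facePerm_not_sameCycle _ _)
    · rfl
  · rintro (p | p)
    · exact ⟨.inl (), (facePerm_sameCycle_inl p).symm⟩
    · exact ⟨.inr (), facePerm_sameCycle_inr p⟩

end Count

end ContourWord

/-! ### Its unique cycle and its rays -/

namespace ContourWord

variable {W : ContourWord}

section Cycle

/-- The darts of the edges of the cycle. -/
def OnCycle : W.Dart → Prop
  | .inl p => (p : ℕ) ∈ W.L
  | .inr _ => True

/-- A closed path of period `m + 1` that passes through each vertex and each edge at most once. -/
structure ClosedPath (W : ContourWord) (m : ℕ) (a : ℕ → W.Dart) : Prop where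
  period : ∀ t, a (t + (m + 1)) = a t
  next : ∀ t, rotPerm.SameCycle (edgePerm (a t)) (a (t + 1))
  edge_ne : ∀ s t, edgePerm (a s) ≠ a t

/-- The darts beyond the bridge at position `p`. -/
def Above (W : ContourWord) (p : ℕ) : W.Dart → Prop
  | .inl r => p < r ∧ (r : ℕ) ≤ W.σ p
  | .inr _ => False

lemma Above.rot {p : ℕ} {d : W.Dart} (h : W.Above p d) : W.Above p (rotPerm d) := by
  rcases d with r | r
  · obtain ⟨h1, h2⟩ := h
    have hpp := W.σσ p
    have hpN : p < W.N := lt_N_of_ne (by omega)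
    have hσN := σ_lt hpN
    have h3 : (r : ℕ) ∉ W.L := by
      rcases h2.lt_or_eq with h2 | h2
      · exact W.not_L p r h1 h2
      · intro h4
        have := σ_L h4
        rw [h2, hpp] at this
        omega
    have h4 : p ≤ W.σ r ∧ W.σ r < W.σ p := by
      rcases h2.lt_or_eq with h2 | h2
      · have := W.nest p r h1 h2
        omega
      · rw [h2, hpp]
        omega
    rcases rotPerm_cases h3 with ⟨h5, e⟩ | ⟨h5, e⟩
    · rw [e]
      exact ⟨by dsimp only; omega, by dsimp only; omega⟩
    · omega
  · exact h.elim

lemma Above.sameCycle {p : ℕ} {d e : W.Dart} (h : W.Above p d) (hs : rotPerm.SameCycle d e) :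
    W.Above p e :=
  hs.induct_of_closed (P := W.Above p) (fun _ => Above.rot) h

lemma Above.edge {p : Fin W.N} {d : W.Dart} (h : W.Above p d)
    (hd : d ≠ .inl ⟨W.σ p, σ_lt p.2⟩) : W.Above p (edgePerm d) := by
  rcases d with r | r
  · obtain ⟨h1, h2⟩ := h
    have h3 : (r : ℕ) < W.σ p := lt_of_le_of_ne h2 fun h => hd (congrArg _ (Fin.ext h))
    rw [edgePerm_of_not (W.not_L p r h1 h3)]
    have := W.nest p r h1 h3
    exact ⟨this.1, this.2.le⟩
  · exact h.elim

/-- A path that crosses a bridge outwards stays beyond it, since it may not use the bridge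
backwards, and so does not close up. A path that crosses inwards never gets beyond the bridge again.
-/
lemma ClosedPath.onCycle {m : ℕ} {a : ℕ → W.Dart} (h : W.ClosedPath m a) (t : ℕ) :
    OnCycle (a t) := by
  rcases ha : a t with p | p
  · change (p : ℕ) ∈ W.L
    by_contra hp
    have hE := edgePerm_of_not hp
    rcases lt_trichotomy (W.σ p) p with h1 | h1 | h1
    · set q : Fin W.N := ⟨W.σ p, σ_lt p.2⟩ with hq
      have hqp : (⟨W.σ q, σ_lt q.2⟩ : Fin W.N) = p := Fin.ext (W.σσ p)
      have hbelow : ∀ s, ¬ W.Above q (a (t + 1 + s)) := by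
        intro s
        induction s with
        | zero =>
          intro h2
          have h3 := h2.sameCycle (h.next t).symm
          rw [ha, hE] at h3
          exact lt_irrefl _ h3.1
        | succ s ih =>
          intro h2
          have h3 := h2.sameCycle (h.next (t + 1 + s)).symm
          apply ih
          rw [← edgePerm_edgePerm (a (t + 1 + s))]
          refine h3.edge fun h4 => ?_
          rw [hqp, ← ha] at h4
          exact h.edge_ne _ _ h4
      refine hbelow m ?_
      rw [show t + 1 + m = t + (m + 1) by omega, h.period, ha]
      exact ⟨h1, (W.σσ p).ge⟩
    · refine h.edge_ne t t ?_
      rw [ha, hE]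
      exact congrArg _ (Fin.ext h1)
    · have habove : ∀ s, W.Above p (a (t + 1 + s)) := by
        intro s
        induction s with
        | zero =>
          refine Above.sameCycle ?_ (h.next t)
          rw [ha, hE]
          exact ⟨h1, le_rfl⟩
        | succ s ih =>
          refine (ih.edge fun h2 => ?_).sameCycle (h.next _)
          rw [← hE, ← ha] at h2
          exact h.edge_ne _ _ h2.symm
      have h2 := habove m
      rw [show t + 1 + m = t + (m + 1) by omega, h.period, ha] at h2
      exact lt_irrefl _ h2.1
  · trivial

lemma cycleEdge_ext {p q : W.CycleEdge} (h : (p.1 : ℕ) = q.1) : p = q :=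
  Subtype.ext (Fin.ext h)

/-- A vertex of the cycle has only two cycle darts and the path may not turn back, so its next step
is forced. -/
lemma ClosedPath.next_inr {m : ℕ} {a : ℕ → W.Dart} (h : W.ClosedPath m a) {t : ℕ}
    {q : W.CycleEdge} (ha : a t = .inr q) : a (t + 1) = .inr (prev q) := by
  have h1 := vertexName_sameCycle (h.next t)
  rw [ha, edgePerm_inr, vertexName_L q.2] at h1
  have h2 := h.onCycle (t + 1)
  rcases hb : a (t + 1) with p | p
  · rw [hb] at h1 h2
    rw [vertexName_L h2] at h1
    have h3 := prev.injective (cycleEdge_ext h1)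
    refine absurd ?_ (h.edge_ne t (t + 1))
    rw [ha, hb, edgePerm_inr, ← Subtype.ext_iff.1 h3]
  · rw [hb] at h1
    exact congrArg _ (cycleEdge_ext h1)

lemma ClosedPath.next_inl {m : ℕ} {a : ℕ → W.Dart} (h : W.ClosedPath m a) {t : ℕ}
    {q : W.CycleEdge} (ha : a t = .inl q.1) : a (t + 1) = .inl (prev⁻¹ q).1 := by
  have h1 := vertexName_sameCycle (h.next t)
  rw [ha, edgePerm_L q.2, vertexName_inr] at h1
  have h2 := h.onCycle (t + 1)
  rcases hb : a (t + 1) with p | p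
  · rw [hb] at h1 h2
    rw [vertexName_L h2] at h1
    have h3 : prev ⟨p, h2⟩ = q := cycleEdge_ext h1
    rw [← h3]
    simp
  · rw [hb] at h1
    refine absurd ?_ (h.edge_ne t (t + 1))
    rw [ha, hb, edgePerm_L q.2]
    exact (congrArg _ (cycleEdge_ext h1)).symm

lemma ClosedPath.exists_eq {m : ℕ} {a : ℕ → W.Dart} (h : W.ClosedPath m a) (q : W.CycleEdge) :
    ∃ t, a t = .inr q ∨ a t = .inl q.1 := by
  have h0 := h.onCycle 0
  rcases ha : a 0 with p | p
  · rw [ha] at h0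
    have hs : (prev⁻¹ : Equiv.Perm W.CycleEdge).SameCycle ⟨p, h0⟩ q :=
      Equiv.Perm.sameCycle_inv.2 ((prev_sameCycle _).trans (prev_sameCycle q).symm)
    obtain ⟨t, ht⟩ := hs.induct_of_closed (P := fun q => ∃ t, a t = .inl q.1)
      (fun _ ⟨t, ht⟩ => ⟨t + 1, h.next_inl ht⟩) ⟨0, ha⟩
    exact ⟨t, Or.inr ht⟩
  · obtain ⟨t, ht⟩ := ((prev_sameCycle p).trans (prev_sameCycle q).symm).induct_of_closed
      (P := fun q => ∃ t, a t = .inr q) (fun _ ⟨t, ht⟩ => ⟨t + 1, h.next_inr ht⟩) ⟨0, ha⟩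
    exact ⟨t, Or.inl ht⟩

lemma ClosedPath.onCycle_iff {m : ℕ} {a : ℕ → W.Dart} (h : W.ClosedPath m a) (d : W.Dart) :
    OnCycle d ↔ ∃ t, d = a t ∨ d = edgePerm (a t) := by
  constructor
  · intro hd
    obtain ⟨q, hq⟩ : ∃ q : W.CycleEdge, d = .inr q ∨ d = .inl q.1 := by
      rcases d with p | p
      · exact ⟨⟨p, hd⟩, Or.inr rfl⟩
      · exact ⟨p, Or.inl rfl⟩
    obtain ⟨t, ht⟩ := h.exists_eq q
    refine ⟨t, ?_⟩
    have h1 : edgePerm (.inr q : W.Dart) = .inl q.1 := rfl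
    have h2 : edgePerm (.inl q.1 : W.Dart) = .inr q := edgePerm_L q.2
    rcases hq with rfl | rfl <;> rcases ht with ht | ht <;> rw [ht]
    · exact Or.inl rfl
    · exact Or.inr h2.symm
    · exact Or.inr rfl
    · exact Or.inl rfl
  · rintro ⟨t, rfl | rfl⟩
    · exact h.onCycle t
    · have h1 := h.onCycle t
      rcases ha : a t with p | p
      · rw [ha] at h1
        rw [edgePerm_L h1]
        trivial
      · exact p.2

/-- The path along the cycle. -/
noncomputable def cyclePath (W : ContourWord) (t : ℕ) : W.Dart := .inr (prev^[t] W.start)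

lemma cyclePath_next (t : ℕ) :
    rotPerm.SameCycle (edgePerm (W.cyclePath t)) (W.cyclePath (t + 1)) := by
  refine ⟨1, ?_⟩
  rw [zpow_one, cyclePath, edgePerm_inr, rotPerm_L (prev^[t] W.start).2, cyclePath,
    Function.iterate_succ_apply']

lemma exists_cyclePath_eq (q : W.CycleEdge) :
    ∃ t < Function.minimalPeriod prev W.start, prev^[t] W.start = q := by
  obtain ⟨n, h0, h⟩ := (prev_sameCycle q).symm.exists_pow_eq_of_finite
  have hpos : 0 < Function.minimalPeriod prev W.start := by
    obtain ⟨n, h0, h1⟩ := (Equiv.Perm.SameCycle.refl prev W.start).exists_pow_eq_of_finite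
    refine Function.IsPeriodicPt.minimalPeriod_pos h0 ?_
    rw [Function.IsPeriodicPt, Function.IsFixedPt, Equiv.Perm.iterate_eq_pow, h1]
  refine ⟨n % Function.minimalPeriod prev W.start, Nat.mod_lt _ hpos, ?_⟩
  rw [Function.iterate_mod_minimalPeriod_eq, Equiv.Perm.iterate_eq_pow, h]

end Cycle

section Rays

variable {k : ℕ} (hk : W.γ W.N = k) (j₀ : Fin k)
include hk

lemma exists_rayPosition (j : Fin k) :
    ∃ p : Fin W.N, (p : ℕ) ∈ W.R ∧ (finRotate k ^ W.γ p) j₀ = j := by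
  obtain ⟨r, hr, h⟩ := exists_finRotate_pow j₀ j
  obtain ⟨p, hp, hpr⟩ := exists_ray (W := W) (r := r) (by omega)
  exact ⟨⟨p, W.R_lt p hp⟩, hp, by rw [hpr, h]⟩

/-- The position of the ray with label `j`, if the first ray has label `j₀`. -/
noncomputable def rayPosition (j : Fin k) : Fin W.N := (exists_rayPosition hk j₀ j).choose

lemma rayPosition_mem (j : Fin k) : (rayPosition hk j₀ j : ℕ) ∈ W.R :=
  (exists_rayPosition hk j₀ j).choose_spec.1

lemma label_rayPosition (j : Fin k) : (finRotate k ^ W.γ (rayPosition hk j₀ j)) j₀ = j :=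
  (exists_rayPosition hk j₀ j).choose_spec.2

omit hk in
lemma ray_eq_of_γ_eq {p q : ℕ} (hp : p ∈ W.R) (hq : q ∈ W.R) (h : W.γ p = W.γ q) : p = q := by
  rcases lt_trichotomy p q with h1 | h1 | h1
  · have := γ_lt (W := W) hp le_rfl h1
    omega
  · exact h1
  · have := γ_lt (W := W) hq le_rfl h1
    omega

lemma γ_ray_lt {p : ℕ} (hp : p ∈ W.R) : W.γ p < k := by
  rw [← hk]
  exact γ_lt hp le_rfl (W.R_lt p hp)

lemma rayPosition_injective : Function.Injective (rayPosition hk j₀) := by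
  intro i j h
  rw [← label_rayPosition hk j₀ i, h, label_rayPosition]

lemma rayPosition_label {p : Fin W.N} (hp : (p : ℕ) ∈ W.R) :
    rayPosition hk j₀ ((finRotate k ^ W.γ p) j₀) = p :=
  Fin.ext <| ray_eq_of_γ_eq (rayPosition_mem hk j₀ _) hp <|
    finRotate_pow_inj j₀ (γ_ray_lt hk (rayPosition_mem hk j₀ _)) (γ_ray_lt hk hp)
      (label_rayPosition hk j₀ _)

lemma mem_R_iff_rayPosition (p : Fin W.N) : (p : ℕ) ∈ W.R ↔ ∃ j, rayPosition hk j₀ j = p :=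
  ⟨fun h => ⟨_, rayPosition_label hk j₀ h⟩, by rintro ⟨j, rfl⟩; exact rayPosition_mem hk j₀ j⟩

/-- The next ray has `γ` larger by one; from the last ray the rotation wraps around past letter `0`
to the first. -/
lemma rayPosition_order (j : Fin k) :
    ∃ m, 0 < m ∧ (finRotate W.N ^ m) (rayPosition hk j₀ j) = rayPosition hk j₀ (finRotate k j) ∧
      ∀ i, 0 < i → i < m → ((finRotate W.N ^ i) (rayPosition hk j₀ j) : ℕ) ∉ W.R := by
  set p := rayPosition hk j₀ j with hp
  have hpR : (p : ℕ) ∈ W.R := rayPosition_mem hk j₀ j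
  have hlab : (finRotate k ^ W.γ p) j₀ = j := label_rayPosition hk j₀ j
  have hpk := γ_ray_lt hk hpR
  have hpN := p.2
  have hγp := γ_succ_ray hpR
  rcases (Nat.succ_le_of_lt hpk).lt_or_eq with hlt | heq
  · obtain ⟨q, hq, hqr⟩ := exists_ray (W := W) (r := W.γ p + 1) (by omega)
    have hqN := W.R_lt q hq
    have hpq : p < q := lt_of_γ_lt (W := W) (by omega)
    have hnext : rayPosition hk j₀ (finRotate k j) = ⟨q, hqN⟩ := by
      rw [← rayPosition_label hk j₀ (p := ⟨q, hqN⟩) hq, hqr, pow_succ', Equiv.Perm.mul_apply, hlab]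
    refine ⟨q - p, by omega, ?_, fun i h0 h1 h2 => ?_⟩
    · rw [hnext]
      apply Fin.ext
      rw [finRotate_pow_val_of_fin, Nat.mod_eq_of_lt (by omega)]
      dsimp only
      omega
    · rw [finRotate_pow_val_of_fin, Nat.mod_eq_of_lt (by omega)] at h2
      have := γ_lt (W := W) h2 (show (p : ℕ) + 1 ≤ p + i by omega) (show (p : ℕ) + i < q by omega)
      omega
  · obtain ⟨q, hq, hqr⟩ := exists_ray (W := W) (r := 0) (by omega)
    have hqN := W.R_lt q hq
    have hnext : rayPosition hk j₀ (finRotate k j) = ⟨q, hqN⟩ := by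
      rw [← rayPosition_label hk j₀ (p := ⟨q, hqN⟩) hq, hqr, pow_zero, Equiv.Perm.one_apply,
        ← hlab, ← Equiv.Perm.mul_apply, ← pow_succ', ← Nat.succ_eq_add_one, heq, finRotate_pow_self]
    refine ⟨W.N - p + q, by omega, ?_, fun i h0 h1 h2 => ?_⟩
    · rw [hnext]
      apply Fin.ext
      rw [finRotate_pow_val_of_fin, show (p : ℕ) + (W.N - p + q) = q + W.N by omega,
        Nat.add_mod_right, Nat.mod_eq_of_lt hqN]
    · rw [finRotate_pow_val_of_fin] at h2
      rcases lt_or_ge (p + i) W.N with h3 | h3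
      · rw [Nat.mod_eq_of_lt h3] at h2
        have := γ_lt (W := W) h2 (show (p : ℕ) + 1 ≤ p + i by omega) h3
        omega
      · rw [Nat.mod_eq_sub_mod h3, Nat.mod_eq_of_lt (by omega)] at h2
        have := γ_lt (W := W) h2 le_rfl (show (p : ℕ) + i - W.N < q by omega)
        omega

end Rays

end ContourWord

namespace ContourWord

variable (W : ContourWord) {k : ℕ} (hk : W.γ W.N = k) (j₀ : Fin k)

/-- A numbering of the darts. -/
noncomputable def dartEquiv : W.Dart ≃ Fin (Fintype.card W.Dart) := Fintype.equivFin _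

/-- The graph with outer contour `W`. -/
noncomputable def rayGraph : RayGraph k where
  n := Fintype.card W.Dart
  edge := W.dartEquiv.permCongr edgePerm
  rot := W.dartEquiv.permCongr rotPerm
  ray j := W.dartEquiv (.inl (rayPosition hk j₀ j))
  edge_edge d := by
    obtain ⟨d, rfl⟩ := W.dartEquiv.surjective d
    simp [edgePerm_edgePerm]
  ray_injective i j h := rayPosition_injective hk j₀ (Sum.inl_injective (W.dartEquiv.injective h))
  edge_eq_self_iff d := by
    obtain ⟨d, rfl⟩ := W.dartEquiv.surjective d
    rw [Equiv.permCongr_apply, Equiv.symm_apply_apply, W.dartEquiv.injective.eq_iff]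
    simp only [W.dartEquiv.injective.eq_iff]
    rcases d with p | p
    · by_cases h : (p : ℕ) ∈ W.L
      · rw [edgePerm_L h]
        simp only [reduceCtorEq, Sum.inl.injEq, false_iff]
        rw [← mem_R_iff_rayPosition]
        exact W.disj _ h
      · rw [edgePerm_of_not h]
        simp only [Sum.inl.injEq]
        rw [← mem_R_iff_rayPosition, ← Fin.val_inj]
        dsimp only
        rw [W.σ_eq_iff _ p.2]
        tauto
    · simp [edgePerm_inr]

variable {W}

lemma permCongr_apply_apply {X Y : Type*} (e : X ≃ Y) (g : Equiv.Perm X) (x : X) :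
    e.permCongr g (e x) = e (g x) := by simp

variable (W) in
/-- The numbering of the darts. -/
noncomputable def rayDart : W.Dart ≃ Fin (W.rayGraph hk j₀).n := W.dartEquiv

lemma rayGraph_edge_eq : (W.rayGraph hk j₀).edge = (W.rayDart hk j₀).permCongr edgePerm := rfl

lemma rayGraph_rot_eq : (W.rayGraph hk j₀).rot = (W.rayDart hk j₀).permCongr rotPerm := rfl

lemma rayGraph_ray (j : Fin k) :
    (W.rayGraph hk j₀).ray j = W.rayDart hk j₀ (.inl (rayPosition hk j₀ j)) := rfl

lemma rayGraph_edge (d : W.Dart) :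
    (W.rayGraph hk j₀).edge ((W.rayDart hk j₀) d) = (W.rayDart hk j₀) (edgePerm d) :=
  permCongr_apply_apply _ _ _

lemma rayGraph_rot (d : W.Dart) :
    (W.rayGraph hk j₀).rot ((W.rayDart hk j₀) d) = (W.rayDart hk j₀) (rotPerm d) :=
  permCongr_apply_apply _ _ _

lemma rayGraph_face : (W.rayGraph hk j₀).face = (W.rayDart hk j₀).permCongr facePerm := by
  ext1 d
  obtain ⟨d, rfl⟩ := (W.rayDart hk j₀).surjective d
  rw [RayGraph.face_apply, rayGraph_edge, rayGraph_rot, ← Equiv.Perm.mul_apply, rotPerm_edgePerm,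
    permCongr_apply_apply]

lemma rayGraph_face_pow (p : Fin W.N) (n : ℕ) : ((W.rayGraph hk j₀).face ^ n)
    ((W.rayDart hk j₀) (.inl p)) = (W.rayDart hk j₀) (.inl ((finRotate W.N ^ n) p)) := by
  rw [rayGraph_face, Equiv.permCongr_pow_apply, facePerm_pow_inl]

lemma rayGraph_sameVertex {d e : W.Dart} :
    (W.rayGraph hk j₀).SameVertex ((W.rayDart hk j₀) d) ((W.rayDart hk j₀) e) ↔ rotPerm.SameCycle d e :=
  Equiv.permCongr_sameCycle_iff _

lemma numCycles_permCongr {X Y : Type*} [Finite X] (e : X ≃ Y) (g : Equiv.Perm X) :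
    numCycles (e.permCongr g) = numCycles g :=
  (Nat.card_congr (Quotient.congr (ra := Equiv.Perm.SameCycle.setoid g)
    (rb := Equiv.Perm.SameCycle.setoid (e.permCongr g)) e
    fun _ _ => (Equiv.permCongr_sameCycle_iff e).symm)).symm

lemma rayGraph_connected (d e : Fin (W.rayGraph hk j₀).n) :
    ∃ g ∈ Subgroup.closure {(W.rayGraph hk j₀).edge, (W.rayGraph hk j₀).rot}, g d = e := by
  set S := Subgroup.closure {(W.rayGraph hk j₀).edge, (W.rayGraph hk j₀).rot} with hS
  have hE : (W.rayGraph hk j₀).edge ∈ S := Subgroup.subset_closure (by simp)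
  have hR : (W.rayGraph hk j₀).rot ∈ S := Subgroup.subset_closure (by simp)
  have hinl : ∀ p : Fin W.N, ∃ g ∈ S,
      g ((W.rayDart hk j₀) (.inl ⟨0, W.N_pos⟩)) = (W.rayDart hk j₀) (.inl p) := by
    intro p
    refine ⟨(W.rayGraph hk j₀).face ^ (p : ℕ), S.pow_mem (S.mul_mem hR hE) _, ?_⟩
    rw [rayGraph_face_pow]
    congr 2
    apply Fin.ext
    rw [finRotate_pow_val_of_fin]
    simp [Nat.mod_eq_of_lt p.2]
  have key : ∀ d, ∃ g ∈ S, g ((W.rayDart hk j₀) (.inl ⟨0, W.N_pos⟩)) = d := by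
    intro d
    obtain ⟨p | p, rfl⟩ := (W.rayDart hk j₀).surjective d
    · exact hinl p
    · obtain ⟨g, hg, h⟩ := hinl p.1
      refine ⟨(W.rayGraph hk j₀).edge * g, S.mul_mem hE hg, ?_⟩
      rw [Equiv.Perm.mul_apply, h, rayGraph_edge, edgePerm_L p.2]
  obtain ⟨g, hg, rfl⟩ := key d
  obtain ⟨g', hg', rfl⟩ := key e
  exact ⟨g' * g⁻¹, S.mul_mem hg' (S.inv_mem hg), by
    rw [Equiv.Perm.mul_apply, ← Equiv.Perm.mul_apply g⁻¹ g, inv_mul_cancel, Equiv.Perm.one_apply]⟩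

variable (W) in
open Classical in
/-- The darts of the cycle. -/
noncomputable def cycleDarts : Finset (Fin (W.rayGraph hk j₀).n) :=
  Finset.univ.filter fun d => OnCycle ((W.rayDart hk j₀).symm d)

lemma mem_cycleDarts {d : W.Dart} : (W.rayDart hk j₀) d ∈ W.cycleDarts hk j₀ ↔ OnCycle d := by
  simp [cycleDarts]

lemma rayGraph_isCycle : (W.rayGraph hk j₀).IsCycle (W.cycleDarts hk j₀) := by
  set m := Function.minimalPeriod prev W.start - 1 with hm
  have hm1 : m + 1 = Function.minimalPeriod prev W.start := by
    obtain ⟨t, ht, -⟩ := exists_cyclePath_eq W.start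
    omega
  refine ⟨m, fun i => (W.rayDart hk j₀) (W.cyclePath i), ?_, ?_, ?_, ?_⟩
  · intro i
    rw [rayGraph_edge, rayGraph_sameVertex]
    convert cyclePath_next (W := W) i using 1
    rw [cyclePath, cyclePath, Fin.val_add]
    have h0 := Function.iterate_mod_minimalPeriod_eq (f := prev) (x := W.start)
      (n := (i : ℕ) + ((1 : Fin (m + 1)) : ℕ))
    rw [← hm1] at h0
    rw [h0]
    congr 1
    -- For `m = 0` the cycle is a loop: `1` equals `0` in `Fin 1`, and the only cycle edge is its
    -- own predecessor.
    rcases m with _ | m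
    · have h1 : Function.IsPeriodicPt prev 1 W.start := by
        rw [show 1 = Function.minimalPeriod prev W.start by omega]
        exact Function.isPeriodicPt_minimalPeriod _ _
      have h2 : prev W.start = W.start := h1
      rw [Function.iterate_fixed h2, Function.iterate_fixed h2]
    · rfl
  · intro i j h
    rw [rayGraph_sameVertex] at h
    have h1 := cycleEdge_ext (vertexName_sameCycle h)
    exact Fin.ext (Function.iterate_injOn_Iio_minimalPeriod
      (Set.mem_Iio.2 (by omega)) (Set.mem_Iio.2 (by omega)) h1.symm)
  · intro i j h
    rw [rayGraph_edge, (W.rayDart hk j₀).injective.eq_iff] at h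
    simp [cyclePath, edgePerm_inr] at h
  · intro d
    obtain ⟨d, rfl⟩ := (W.rayDart hk j₀).surjective d
    simp only [rayGraph_edge, (W.rayDart hk j₀).injective.eq_iff]
    have hcov : ∀ q : W.CycleEdge, ∃ i : Fin (m + 1), W.cyclePath i = .inr q := by
      intro q
      obtain ⟨t, ht, h⟩ := exists_cyclePath_eq q
      exact ⟨⟨t, by omega⟩, by rw [cyclePath, h]⟩
    refine (mem_cycleDarts hk j₀).trans ⟨fun h => ?_, ?_⟩
    · rcases d with p | p
      · obtain ⟨i, hi⟩ := hcov ⟨p, h⟩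
        exact ⟨i, Or.inr (by rw [hi, edgePerm_inr])⟩
      · obtain ⟨i, hi⟩ := hcov p
        exact ⟨i, Or.inl hi.symm⟩
    · rintro ⟨i, rfl | rfl⟩
      · trivial
      · exact (prev^[(i : ℕ)] W.start).2

lemma rayGraph_isCycle_iff (L : Finset (Fin (W.rayGraph hk j₀).n)) :
    (W.rayGraph hk j₀).IsCycle L ↔ L = W.cycleDarts hk j₀ := by
  constructor
  · rintro ⟨m, c, h1, -, h3, h4⟩
    -- The cyclic enumeration is unrolled to a periodic path.
    let a : ℕ → W.Dart := fun t => (W.rayDart hk j₀).symm (c ⟨t % (m + 1), Nat.mod_lt _ (by omega)⟩)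
    have hc : ∀ t, (W.rayDart hk j₀) (a t) = c ⟨t % (m + 1), Nat.mod_lt _ (by omega)⟩ := fun t =>
      (W.rayDart hk j₀).apply_symm_apply _
    have ha : W.ClosedPath m a := by
      refine ⟨fun t => ?_, fun t => ?_, fun s t h => ?_⟩
      · simp only [a, Nat.add_mod_right]
      · rw [← rayGraph_sameVertex hk j₀, ← rayGraph_edge, hc, hc]
        convert h1 _ using 2
        apply Fin.ext
        rw [Fin.val_add]
        simp
      · refine h3 ⟨s % (m + 1), Nat.mod_lt _ (by omega)⟩ ⟨t % (m + 1), Nat.mod_lt _ (by omega)⟩ ?_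
        rw [← hc, ← hc, rayGraph_edge, h]
    ext d
    rw [h4]
    obtain ⟨d, rfl⟩ := (W.rayDart hk j₀).surjective d
    refine Iff.trans ?_ (mem_cycleDarts hk j₀).symm
    rw [ha.onCycle_iff]
    have key : ∀ t, (d = a t ∨ d = edgePerm (a t)) ↔
        ((W.rayDart hk j₀) d = c ⟨t % (m + 1), Nat.mod_lt _ (by omega)⟩ ∨
          (W.rayDart hk j₀) d = (W.rayGraph hk j₀).edge (c ⟨t % (m + 1), Nat.mod_lt _ (by omega)⟩)) := by
      intro t
      rw [← hc, rayGraph_edge, (W.rayDart hk j₀).injective.eq_iff, (W.rayDart hk j₀).injective.eq_iff]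
    simp only [key]
    constructor
    · rintro ⟨i, hi⟩
      refine ⟨i, ?_⟩
      have : (⟨(i : ℕ) % (m + 1), Nat.mod_lt _ (by omega)⟩ : Fin (m + 1)) = i :=
        Fin.ext (Nat.mod_eq_of_lt i.2)
      rwa [this]
    · rintro ⟨t, ht⟩
      exact ⟨_, ht⟩
  · rintro rfl
    exact rayGraph_isCycle hk j₀

variable (W) in
/-- The plane graph with outer contour `W`. -/
noncomputable def planeType : PlaneType k where
  toRayGraph := W.rayGraph hk j₀
  connected := rayGraph_connected hk j₀
  three_le_valence d := by
    obtain ⟨d, rfl⟩ := (W.rayDart hk j₀).surjective d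
    have := rotPerm_ne d
    rw [rayGraph_rot, rayGraph_rot, ne_eq, ne_eq, (W.rayDart hk j₀).injective.eq_iff,
      (W.rayDart hk j₀).injective.eq_iff]
    exact this
  euler := by
    classical
    rw [rayGraph_face]
    rw [rayGraph_edge_eq, rayGraph_rot_eq, numCycles_permCongr, numCycles_permCongr, numCycles_permCongr, numCycles_rotPerm,
      numCycles_edgePerm (rayPosition_injective hk j₀) (mem_R_iff_rayPosition hk j₀),
      numCycles_facePerm]
    push_cast
    ring
  ray_order j := by
    obtain ⟨m, h0, h1, h2⟩ := rayPosition_order hk j₀ j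
    refine ⟨m, h0, ?_, ⟨_, rfl⟩, fun i hi him => ?_⟩
    · rw [rayGraph_ray, rayGraph_ray, rayGraph_face_pow, h1]
    · rintro ⟨j', hj'⟩
      rw [rayGraph_ray, rayGraph_ray, rayGraph_face_pow, (W.rayDart hk j₀).injective.eq_iff, Sum.inl.injEq] at hj'
      exact h2 i hi him (by rw [← hj']; exact rayPosition_mem hk j₀ j')
  cycle := W.cycleDarts hk j₀
  isCycle_iff := rayGraph_isCycle_iff hk j₀

end ContourWord

/-! ### The metric graph of a word with lengths -/

namespace ContourWord

open PlaneType

lemma eq_of_fields {W W' : ContourWord} (hN : W.N = W'.N) (hσ : W.σ = W'.σ) (hL : W.L = W'.L)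
    (hR : W.R = W'.R) : W = W' := by
  cases W
  cases W'
  simp only at hN hσ hL hR
  subst hN hσ hL hR
  rfl

variable {W : ContourWord} {k : ℕ} (hk : W.γ W.N = k) (j₀ : Fin k)

variable (W) in
/-- The darts of the plane graph with outer contour `W`. -/
noncomputable def planeDart : W.Dart ≃ Fin (W.planeType hk j₀).n := W.rayDart hk j₀

lemma planeType_edge (d : W.Dart) :
    (W.planeType hk j₀).edge (W.planeDart hk j₀ d) = W.planeDart hk j₀ (edgePerm d) :=
  rayGraph_edge hk j₀ d

lemma planeType_ray (j : Fin k) :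
    (W.planeType hk j₀).ray j = W.planeDart hk j₀ (.inl (rayPosition hk j₀ j)) := rfl

lemma mem_planeType_cycle {d : W.Dart} :
    W.planeDart hk j₀ d ∈ (W.planeType hk j₀).cycle ↔ OnCycle d :=
  mem_cycleDarts hk j₀

lemma planeType_face_pow (p : Fin W.N) (n : ℕ) : ((W.planeType hk j₀).face ^ n)
    (W.planeDart hk j₀ (.inl p)) = W.planeDart hk j₀ (.inl ((finRotate W.N ^ n) p)) :=
  rayGraph_face_pow hk j₀ p n

variable (W) in
/-- The dart of the plane graph where the contour `W` starts. -/
noncomputable def firstDart : Fin (W.planeType hk j₀).n :=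
  W.planeDart hk j₀ (.inl ⟨0, W.N_pos⟩)

lemma firstDart_mem_cycle : W.firstDart hk j₀ ∈ (W.planeType hk j₀).cycle :=
  (mem_planeType_cycle hk j₀).2 W.zero_mem

lemma letter_firstDart (p : ℕ) : letter (W.firstDart hk j₀) p =
    W.planeDart hk j₀ (.inl ⟨p % W.N, Nat.mod_lt _ W.N_pos⟩) := by
  rw [letter, firstDart, planeType_face_pow]
  congr 2
  apply Fin.ext
  rw [finRotate_pow_val_of_fin]
  simp

lemma letter_firstDart_of_lt {p : ℕ} (hp : p < W.N) : letter (W.firstDart hk j₀) p =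
    W.planeDart hk j₀ (.inl ⟨p, hp⟩) := by
  rw [letter_firstDart]
  congr 2
  exact Fin.ext (Nat.mod_eq_of_lt hp)

lemma contourLength_firstDart : contourLength (W.firstDart hk j₀) = W.N := by
  refine le_antisymm ?_ ?_
  · refine Function.IsPeriodicPt.minimalPeriod_le W.N_pos ?_
    rw [Function.IsPeriodicPt, Function.IsFixedPt, ← letter_eq_iterate, letter_firstDart, firstDart]
    congr 2
    exact Fin.ext (Nat.mod_self _)
  · have h1 := letter_length (W.firstDart hk j₀)
    rw [letter_firstDart, firstDart, (W.planeDart hk j₀).injective.eq_iff, Sum.inl.injEq,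
      ← Fin.val_inj] at h1
    exact Nat.le_of_dvd (contourLength_pos _) (Nat.dvd_of_mod_eq_zero h1)

lemma letter_mem_cycle {p : ℕ} (hp : p < W.N) :
    letter (W.firstDart hk j₀) p ∈ (W.planeType hk j₀).cycle ↔ p ∈ W.L := by
  rw [letter_firstDart_of_lt hk j₀ hp]
  exact mem_planeType_cycle hk j₀

lemma letter_mem_range_ray {p : ℕ} (hp : p < W.N) :
    letter (W.firstDart hk j₀) p ∈ Set.range (W.planeType hk j₀).ray ↔ p ∈ W.R := by
  rw [letter_firstDart_of_lt hk j₀ hp]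
  refine Iff.trans (exists_congr fun j => ?_) (mem_R_iff_rayPosition hk j₀ ⟨p, hp⟩).symm
  rw [planeType_ray, (W.planeDart hk j₀).injective.eq_iff, Sum.inl.injEq]

lemma nextRay_firstDart : (W.planeType hk j₀).NextRay (W.firstDart hk j₀) j₀ := by
  obtain ⟨q, hq, hqr⟩ := exists_ray (W := W) (r := 0) (by rw [hk]; exact j₀.pos)
  have hqN := W.R_lt q hq
  have h1 := rayPosition_label hk j₀ (p := ⟨q, hqN⟩) hq
  dsimp only at h1
  rw [hqr, pow_zero, Equiv.Perm.one_apply] at h1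
  refine ⟨q, ?_, fun l hl h2 => ?_⟩
  · rw [planeType_ray, h1]
    exact letter_firstDart_of_lt hk j₀ hqN
  · have h3 := (letter_mem_range_ray hk j₀ (hl.trans hqN)).1 h2
    have := γ_lt (W := W) h3 le_rfl hl
    omega

lemma outer_firstDart : (W.planeType hk j₀).Outer (W.firstDart hk j₀) :=
  ⟨j₀, (nextRay_firstDart hk j₀).sameFace⟩

variable [NeZero k]

/-- With this, statements about words of graphs, such as `isValley_word`, apply to the graph built
from `W`. -/
lemma word_firstDart :
    word (W.firstDart hk j₀) (outer_firstDart hk j₀) (firstDart_mem_cycle hk j₀) = W := by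
  have hN := contourLength_firstDart hk j₀
  refine eq_of_fields hN ?_ ?_ ?_
  · funext p
    by_cases hp : p < W.N
    · by_cases hL : p ∈ W.L
      · exact (partner_of_mem ((letter_mem_cycle hk j₀ hp).2 hL)).trans (σ_L hL).symm
      · obtain ⟨h1, h2⟩ := partner_spec (outer_firstDart hk j₀) (hN.symm ▸ hp)
          (fun h => hL ((letter_mem_cycle hk j₀ hp).1 h))
        refine letter_inj h1 (by rw [hN]; exact σ_lt hp) ?_
        change letter _ (partner _ p) = _
        rw [h2, letter_firstDart_of_lt hk j₀ hp, planeType_edge,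
          letter_firstDart_of_lt hk j₀ (σ_lt hp), edgePerm_of_not hL]
    · exact (partner_of_ge (by omega)).trans (W.σ_ge p (by omega)).symm
  · ext p
    change p < contourLength _ ∧ _ ↔ _
    rw [hN]
    constructor
    · rintro ⟨h1, h2⟩
      exact (letter_mem_cycle hk j₀ h1).1 h2
    · exact fun h => ⟨W.L_lt p h, (letter_mem_cycle hk j₀ (W.L_lt p h)).2 h⟩
  · ext p
    change p < contourLength _ ∧ _ ↔ _
    rw [hN]
    constructor
    · rintro ⟨h1, h2⟩
      exact (letter_mem_range_ray hk j₀ h1).1 h2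
    · exact fun h => ⟨W.R_lt p h, (letter_mem_range_ray hk j₀ (W.R_lt p h)).2 h⟩

variable {l : ℕ → ℝ}

variable (W) in
/-- The lengths of the edges of the plane graph with contour `W` whose letters have lengths `l`. -/
noncomputable def dartLength (l : ℕ → ℝ) (d : Fin (W.planeType hk j₀).n) : ℝ :=
  Sum.elim (fun p : Fin W.N => l p) (fun p : W.CycleEdge => l p.1) ((W.planeDart hk j₀).symm d)

omit [NeZero k] in
lemma dartLength_apply (d : W.Dart) : W.dartLength hk j₀ l (W.planeDart hk j₀ d) =
    Sum.elim (fun p : Fin W.N => l p) (fun p : W.CycleEdge => l p.1) d := by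
  rw [dartLength, Equiv.symm_apply_apply]

open Classical in
omit [NeZero k] in
lemma sum_cycle_dartLength : ∑ d ∈ (W.planeType hk j₀).cycle, W.dartLength hk j₀ l d =
    2 * ∑ p ∈ Finset.range W.N with p ∈ W.L, l p := by
  have h1 : ∑ d ∈ (W.planeType hk j₀).cycle, W.dartLength hk j₀ l d =
      ∑ d : W.Dart with OnCycle d, Sum.elim (fun p : Fin W.N => l p) (fun p : W.CycleEdge => l p.1) d := by
    symm
    refine Finset.sum_equiv (W.planeDart hk j₀) (fun d => ?_) fun d _ => ?_
    · rw [mem_planeType_cycle]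
      simp
    · rw [dartLength_apply]
  have h2 : ∑ p : W.CycleEdge, l p.1 = ∑ p ∈ Finset.range W.N with p ∈ W.L, l p := by
    refine Finset.sum_bij (fun p _ => (p.1 : ℕ)) ?_ ?_ ?_ ?_
    · intro p _
      rw [Finset.mem_filter, Finset.mem_range]
      exact ⟨p.1.2, p.2⟩
    · intro p _ q _ h
      exact cycleEdge_ext h
    · intro p hp
      rw [Finset.mem_filter, Finset.mem_range] at hp
      exact ⟨⟨⟨p, hp.1⟩, hp.2⟩, Finset.mem_univ _, rfl⟩
    · intro p _
      rfl
  have h3 : (∑ p ∈ Finset.univ.filter (fun p : Fin W.N => (p : ℕ) ∈ W.L), l p) =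
      ∑ p : W.CycleEdge, l p.1 := by
    rw [Finset.sum_subtype (p := fun p : Fin W.N => (p : ℕ) ∈ W.L)
      (Finset.univ.filter fun p : Fin W.N => (p : ℕ) ∈ W.L) (fun p => by simp)]
  rw [h1, Finset.sum_filter, Fintype.sum_sum_type, two_mul, ← h2]
  congr 1
  · rw [← h3, Finset.sum_filter]
    rfl
  · refine Finset.sum_congr rfl fun p _ => ?_
    rw [if_pos (show OnCycle (.inr p : W.Dart) from trivial)]
    rfl

section Length

variable (hl : ∀ p, 0 ≤ l p) (hlσ : ∀ p, l (W.σ p) = l p) (hlR : ∀ p ∈ W.R, l p = 0)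
  (hlN : ∀ p, W.N ≤ p → l p = 0)
include hl hlσ hlR

open Classical in
omit [NeZero k] in
lemma isLength_dartLength {τ : ℝ} (hτ : ∑ p ∈ Finset.range W.N with p ∈ W.L, l p = τ) :
    IsLength (W.planeType hk j₀) τ (W.dartLength hk j₀ l) where
  nonneg d := by
    obtain ⟨p | p, rfl⟩ := (W.planeDart hk j₀).surjective d <;> rw [dartLength_apply] <;>
      exact hl _
  edge d := by
    obtain ⟨p | p, rfl⟩ := (W.planeDart hk j₀).surjective d <;>
      rw [planeType_edge, dartLength_apply, dartLength_apply]
    · by_cases h : (p : ℕ) ∈ W.L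
      · rw [edgePerm_L h]
        rfl
      · rw [edgePerm_of_not h]
        exact hlσ p
    · rfl
  ray j := by
    rw [planeType_ray, dartLength_apply]
    exact hlR _ (rayPosition_mem hk j₀ j)
  cycle := by rw [sum_cycle_dartLength, hτ]

omit hl hlσ hlR in
include hlN in
omit [NeZero k] in
lemma wordLength_firstDart : wordLength (W.firstDart hk j₀) (W.dartLength hk j₀ l) = l := by
  funext p
  have hN := contourLength_firstDart hk j₀
  by_cases hp : p < W.N
  · rw [wordLength_of_lt (by omega), letter_firstDart_of_lt hk j₀ hp, dartLength_apply]
    rfl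
  · rw [wordLength, if_neg (by omega), hlN p (by omega)]

-- Both sides are the least height in the same gap of the same word.
omit hlσ hlR in
include hlN in
lemma valley_planeType {h : ℕ → ℝ} (hv : W.IsValley l h) {r : ℕ} (hr : r ≤ k) :
    (W.planeType hk j₀).valley (W.dartLength hk j₀ l) ((finRotate k ^ r) j₀) = h r := by
  have hnn : ∀ d, 0 ≤ W.dartLength hk j₀ l d := fun d => by
    obtain ⟨p | p, rfl⟩ := (W.planeDart hk j₀).surjective d <;> rw [dartLength_apply] <;>
      exact hl _
  have h1 := isValley_word (outer_firstDart hk j₀) (firstDart_mem_cycle hk j₀) hnn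
    (nextRay_firstDart hk j₀)
  rw [word_firstDart, wordLength_firstDart hk j₀ hlN] at h1
  exact (h1 r (by omega)).unique (hv r (by omega))

end Length

lemma nextRay_letter_firstDart {p : ℕ} (hp : p < W.N) : (W.planeType hk j₀).NextRay
    (letter (W.firstDart hk j₀) p) ((finRotate k ^ W.γ p) j₀) := by
  have h1 := nextRay_letter (outer_firstDart hk j₀) (firstDart_mem_cycle hk j₀)
    (nextRay_firstDart hk j₀) (p := p) (by rw [contourLength_firstDart]; omega)
  rwa [word_firstDart] at h1

lemma cycleGap_planeType {p : ℕ} (hp : p ∈ W.L) : (W.planeType hk j₀).cycleGap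
    (W.dartLength hk j₀ l) ((finRotate k ^ W.γ p) j₀) = l p := by
  have hpN := W.L_lt p hp
  rw [cycleGap_eq ((letter_mem_cycle hk j₀ hpN).2 hp) (nextRay_letter_firstDart hk j₀ hpN),
    letter_firstDart_of_lt hk j₀ hpN, dartLength_apply]
  rfl

include hk j₀ in
lemma γ_lt_of_mem_L {p : ℕ} (hp : p ∈ W.L) : W.γ p < k := by
  have hpN := W.L_lt p hp
  have h1 := PlaneType.γ_L_lt (outer_firstDart hk j₀) (firstDart_mem_cycle hk j₀) (p := p)
    (by rw [contourLength_firstDart]; omega) ((letter_mem_cycle hk j₀ hpN).2 hp)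
  rwa [word_firstDart] at h1

lemma cycleGap_planeType_of_forall {r : ℕ} (hr : r < k) (h : ∀ p ∈ W.L, W.γ p ≠ r) :
    (W.planeType hk j₀).cycleGap (W.dartLength hk j₀ l) ((finRotate k ^ r) j₀) = 0 := by
  by_contra h0
  obtain ⟨d, hd, hdr⟩ := exists_of_cycleGap_ne_zero h0
  obtain ⟨p, hp, rfl⟩ := exists_letter (outer_firstDart hk j₀) (d := d) ⟨_, hdr.sameFace⟩
  rw [contourLength_firstDart] at hp
  have hpL := (letter_mem_cycle hk j₀ hp).1 hd
  exact h p hpL (finRotate_pow_inj j₀ (γ_lt_of_mem_L hk j₀ hpL) hr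
    ((nextRay_letter_firstDart hk j₀ hp).unique hdr))

include hk in
open Classical in
/-- The metric graph with a given outer contour. -/
theorem exists_metricCells {τ : ℝ} {l h x : ℕ → ℝ} (hl : ∀ p, 0 ≤ l p) (hlσ : ∀ p, l (W.σ p) = l p)
    (hlR : ∀ p ∈ W.R, l p = 0) (hlN : ∀ p, W.N ≤ p → l p = 0)
    (hpos : ∀ p < W.N, p ∉ W.R → 0 < l p)
    (hτ : ∑ p ∈ (Finset.range W.N).filter (· ∈ W.L), l p = τ) (hv : W.IsValley l h)
    (hxL : ∀ p ∈ W.L, x (W.γ p) = l p - h (W.γ p))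
    (hx : ∀ r < k, (∀ p ∈ W.L, W.γ p ≠ r) → x r = - h r) :
    ∃ G : MetricCells k τ, G.1.n ≤ 2 * W.N ∧ (∀ d, d ∈ G.kept) ∧
      ∀ r < k, G.coord ((finRotate k ^ r) j₀) = x r := by
  refine ⟨⟨W.planeType hk j₀, W.dartLength hk j₀ l, isLength_dartLength hk j₀ hl hlσ hlR hτ⟩,
    ?_, fun d => ?_, fun r hr => ?_⟩
  -- The bound on the number of darts later reduces everything to finitely many cells.
  · change Fintype.card W.Dart ≤ _
    rw [Fintype.card_sum, two_mul]
    refine add_le_add (Fintype.card_fin _).le ?_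
    exact (Fintype.card_le_of_injective Subtype.val Subtype.val_injective).trans
      (Fintype.card_fin W.N).le
  · obtain ⟨d, rfl⟩ := (W.planeDart hk j₀).surjective d
    change (W.planeType hk j₀).edge _ = _ ∨ 0 < W.dartLength hk j₀ l _
    rw [dartLength_apply]
    rcases d with p | p
    · by_cases hp : (p : ℕ) ∈ W.R
      · left
        rw [planeType_edge, edgePerm_of_not fun h => W.disj _ h hp]
        congr 2
        exact Fin.ext (σ_R hp)
      · exact Or.inr (hpos p p.2 hp)
    · exact Or.inr (hpos p.1 p.1.2 (W.disj _ p.2))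
  · change (W.planeType hk j₀).cycleGap (W.dartLength hk j₀ l) _ -
      (W.planeType hk j₀).valley (W.dartLength hk j₀ l) _ = _
    rw [valley_planeType hk j₀ hl hlN hv hr.le]
    by_cases hex : ∃ p ∈ W.L, W.γ p = r
    · obtain ⟨p, hp, rfl⟩ := hex
      rw [cycleGap_planeType hk j₀ hp, hxL p hp]
    · push Not at hex
      rw [cycleGap_planeType_of_forall hk j₀ hr hex, hx r hr hex, zero_sub]

end ContourWord

/-! ### The word of a profile -/

namespace Finset

variable {α : Type*} (T : Finset α) (key : α → ℕ)

/-- The position of `x` when the elements of `T` are listed by increasing keys. -/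
def position (x : α) : ℕ := (T.filter fun y => key y < key x).card

variable {T key} {x y : α}

lemma position_lt (hx : x ∈ T) : T.position key x < T.card :=
  card_lt_card <| (filter_ssubset).2 ⟨x, hx, lt_irrefl _⟩

lemma position_lt_position (hx : x ∈ T) (h : key x < key y) :
    T.position key x < T.position key y := by
  refine card_lt_card <| (ssubset_iff_of_subset ?_).2 ⟨x, by simp [hx, h], by simp⟩
  intro z hz
  rw [mem_filter] at hz ⊢
  exact ⟨hz.1, hz.2.trans h⟩

lemma position_lt_position_iff (hx : x ∈ T) (hy : y ∈ T) :
    T.position key x < T.position key y ↔ key x < key y := by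
  refine ⟨fun h => ?_, position_lt_position hx⟩
  by_contra h'
  rcases (not_lt.1 h').lt_or_eq with h1 | h1
  · have := position_lt_position hy h1
    omega
  · rw [position, position, h1] at h
    exact lt_irrefl _ h

lemma position_injOn (hkey : Set.InjOn key T) : Set.InjOn (T.position key) T := by
  intro x hx y hy h
  apply hkey hx hy
  rcases lt_trichotomy (key x) (key y) with h1 | h1 | h1
  · have := position_lt_position (y := y) hx h1
    omega
  · exact h1
  · have := position_lt_position (y := x) hy h1
    omega

lemma exists_position_eq (hkey : Set.InjOn key T) {p : ℕ} (hp : p < T.card) :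
    ∃ x ∈ T, T.position key x = p := by
  have h1 : T.image (T.position key) = range T.card := by
    refine eq_of_subset_of_card_le (fun p hp => ?_) ?_
    · obtain ⟨x, hx, rfl⟩ := mem_image.1 hp
      exact mem_range.2 (position_lt hx)
    · rw [card_range, card_image_of_injOn (position_injOn hkey)]
  have h2 := mem_range.2 hp
  rw [← h1, mem_image] at h2
  exact h2

end Finset

/-- Heights `h r` of the lowest points of the gaps between the rays of a plane graph with a unique
cycle, and the set `E` of the gaps in which an edge of the cycle is seen. -/
structure Profile (k : ℕ) where
  h : ℕ → ℝ
  E : Set ℕ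
  h_zero : h 0 = 0
  h_last : h k = 0
  nonneg : ∀ r, 0 ≤ h r
  zero_mem : 0 ∈ E
  lt_of_mem : ∀ r ∈ E, r < k
  h_of_mem : ∀ r ∈ E, h r = 0

namespace Profile

variable {k : ℕ} (P : Profile k)

/-- The gaps `a` and `b` lie below all gaps between them. -/
def Vis (a b : ℕ) : Prop := a < b ∧ b ≤ k ∧ ∀ l, a < l → l < b → P.h a < P.h l ∧ P.h b < P.h l

/-- A letter `(a, b)` of the contour lies in gap `a`.  It is an edge of the cycle if `b = a`, the
ray after gap `a` if `b = a + 1`, and otherwise one side of the bridge whose other side lies in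
gap `b`. -/
def IsLetter (x : ℕ × ℕ) : Prop :=
  x.1 ≤ k ∧ x.2 ≤ k ∧
    (P.Vis x.1 x.2 ∨ (x.2 + 1 < x.1 ∧ P.Vis x.2 x.1) ∨ (x.1 = x.2 ∧ x.1 ∈ P.E))

open Classical in
/-- The letters of the contour. -/
noncomputable def letters : Finset (ℕ × ℕ) :=
  (Finset.range (k + 1) ×ˢ Finset.range (k + 1)).filter P.IsLetter

/-- The key by which the letters are ordered. -/
def key (k : ℕ) (x : ℕ × ℕ) : ℕ := x.1 * (2 * k + 4) + ContourWord.rank k x.1 x.2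

variable {P}

open Classical in
lemma mem_letters {x : ℕ × ℕ} : x ∈ P.letters ↔ P.IsLetter x := by
  unfold letters
  rw [Finset.mem_filter, Finset.mem_product, Finset.mem_range, Finset.mem_range]
  refine ⟨fun h => h.2, fun h => ⟨⟨?_, ?_⟩, h⟩⟩
  · exact Nat.lt_succ_of_le h.1
  · exact Nat.lt_succ_of_le h.2.1

open Classical in
lemma card_letters_le : P.letters.card ≤ (k + 1) * (k + 1) := by
  unfold letters
  refine (Finset.card_le_card (Finset.filter_subset _ _)).trans ?_
  rw [Finset.card_product, Finset.card_range]

/-- The factor `2 * k + 4` exceeds every rank, so keys compare lexicographically, first by gap and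
then by rank. -/
lemma key_lt_iff {a b c d : ℕ} (ha : a ≤ k) (hb : b ≤ k) (hc : c ≤ k) (hd : d ≤ k) :
    key k (a, b) < key k (c, d) ↔ a < c ∨ a = c ∧
      ((b < a ∧ (d < b ∨ a ≤ d)) ∨ (b = a ∧ a < d) ∨ (a < b ∧ a < d ∧ d < b)) := by
  have hr : ∀ a b, a ≤ k → b ≤ k → ContourWord.rank k a b < 2 * k + 4 := by
    intro a b ha hb
    unfold ContourWord.rank
    split_ifs <;> omega
  have h1 := hr a b ha hb
  have h2 := hr c d hc hd
  unfold key
  dsimp only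
  rcases lt_trichotomy a c with h | rfl | h
  · have : (a + 1) * (2 * k + 4) ≤ c * (2 * k + 4) := Nat.mul_le_mul_right _ h
    rw [add_mul] at this
    refine iff_of_true (by omega) (Or.inl h)
  · simp only [lt_irrefl, false_or, true_and, add_lt_add_iff_left]
    unfold ContourWord.rank
    split_ifs <;> omega
  · have : (c + 1) * (2 * k + 4) ≤ a * (2 * k + 4) := Nat.mul_le_mul_right _ h
    rw [add_mul] at this
    refine iff_of_false (by omega) (by omega)

lemma key_injOn : Set.InjOn (key k) P.letters := by
  rintro ⟨a, b⟩ hx ⟨c, d⟩ hy h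
  obtain ⟨h1, h2, -⟩ := mem_letters.1 hx
  obtain ⟨h3, h4, -⟩ := mem_letters.1 hy
  dsimp only at h1 h2 h3 h4
  have h5 := (key_lt_iff h1 h2 h3 h4).not.1 (by omega)
  have h6 := (key_lt_iff h3 h4 h1 h2).not.1 (by omega)
  rw [Prod.mk.injEq]
  omega

variable (P) in
/-- The position of a letter. -/
noncomputable def pos (x : ℕ × ℕ) : ℕ := P.letters.position (key k) x

lemma pos_lt {x : ℕ × ℕ} (hx : P.IsLetter x) : P.pos x < P.letters.card :=
  Finset.position_lt (mem_letters.2 hx)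

lemma pos_lt_pos_iff {a b c d : ℕ} (hx : P.IsLetter (a, b)) (hy : P.IsLetter (c, d)) :
    P.pos (a, b) < P.pos (c, d) ↔ a < c ∨ a = c ∧
      ((b < a ∧ (d < b ∨ a ≤ d)) ∨ (b = a ∧ a < d) ∨ (a < b ∧ a < d ∧ d < b)) :=
  (Finset.position_lt_position_iff (mem_letters.2 hx) (mem_letters.2 hy)).trans
    (key_lt_iff hx.1 hx.2.1 hy.1 hy.2.1)

lemma pos_inj {x y : ℕ × ℕ} (hx : P.IsLetter x) (hy : P.IsLetter y) (h : P.pos x = P.pos y) :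
    x = y :=
  Finset.position_injOn key_injOn (mem_letters.2 hx) (mem_letters.2 hy) h

lemma exists_pos {p : ℕ} (hp : p < P.letters.card) : ∃ x, P.IsLetter x ∧ P.pos x = p := by
  obtain ⟨x, hx, h⟩ := Finset.exists_position_eq (key_injOn (P := P)) hp
  exact ⟨x, mem_letters.1 hx, h⟩

/-- The other side of a letter. -/
def swap (x : ℕ × ℕ) : ℕ × ℕ := if x.1 + 1 < x.2 ∨ x.2 + 1 < x.1 then (x.2, x.1) else x

lemma swap_of {a b : ℕ} (h : a + 1 < b ∨ b + 1 < a) : swap (a, b) = (b, a) := if_pos h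

lemma swap_of_not {a b : ℕ} (h : ¬ (a + 1 < b ∨ b + 1 < a)) : swap (a, b) = (a, b) := if_neg h

lemma swap_swap (x : ℕ × ℕ) : swap (swap x) = x := by
  obtain ⟨a, b⟩ := x
  by_cases h : a + 1 < b ∨ b + 1 < a
  · rw [swap_of h, swap_of h.symm]
  · rw [swap_of_not h, swap_of_not h]

lemma IsLetter.swap {x : ℕ × ℕ} (hx : P.IsLetter x) : P.IsLetter (swap x) := by
  obtain ⟨a, b⟩ := x
  by_cases h : a + 1 < b ∨ b + 1 < a
  · rw [swap_of h]
    obtain ⟨h1, h2, h3 | h3 | h3⟩ := hx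
    · exact ⟨h2, h1, Or.inr (Or.inl ⟨by have := h3.1; dsimp only at this ⊢; omega, h3⟩)⟩
    · exact ⟨h2, h1, Or.inl h3.2⟩
    · have := h3.1
      dsimp only at this
      omega
  · rwa [swap_of_not h]

lemma IsLetter.ne_pred {a b : ℕ} (hx : P.IsLetter (a, b)) : b + 1 ≠ a := by
  obtain ⟨-, -, h | h | h⟩ := hx
  · have := h.1
    dsimp only at this
    omega
  · have := h.1
    dsimp only at this
    omega
  · have := h.1
    dsimp only at this
    omega

lemma IsLetter.vis {a b : ℕ} (hx : P.IsLetter (a, b)) (h : a < b) : P.Vis a b := by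
  obtain ⟨-, -, h' | h' | h'⟩ := hx
  · exact h'
  · have := h'.1
    dsimp only at this
    omega
  · have := h'.1
    dsimp only at this
    omega

lemma IsLetter.vis' {a b : ℕ} (hx : P.IsLetter (a, b)) (h : b < a) : P.Vis b a := by
  obtain ⟨-, -, h' | h' | h'⟩ := hx
  · have := h'.1
    dsimp only at this
    omega
  · exact h'.2
  · have := h'.1
    dsimp only at this
    omega

lemma IsLetter.mem {a : ℕ} (hx : P.IsLetter (a, a)) : a ∈ P.E := by
  obtain ⟨-, -, h' | h' | h'⟩ := hx
  · exact absurd h'.1 (lt_irrefl _)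
  · exact absurd h'.2.1 (lt_irrefl _)
  · exact h'.2

lemma Vis.isLetter {a b : ℕ} (h : P.Vis a b) : P.IsLetter (a, b) :=
  ⟨h.1.le.trans h.2.1, h.2.1, Or.inl h⟩

lemma Vis.isLetter' {a b : ℕ} (h : P.Vis b a) (hba : b + 1 < a) : P.IsLetter (a, b) :=
  ⟨h.2.1, h.1.le.trans h.2.1, Or.inr (Or.inl ⟨hba, h⟩)⟩

/-- Neighbouring gaps see each other vacuously, which makes every ray a letter. -/
lemma isLetter_ray {r : ℕ} (hr : r < k) : P.IsLetter (r, r + 1) :=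
  Vis.isLetter ⟨Nat.lt_succ_self r, hr, fun l h1 h2 => by omega⟩

lemma isLetter_cycle {r : ℕ} (hr : r ∈ P.E) : P.IsLetter (r, r) :=
  ⟨(P.lt_of_mem r hr).le, (P.lt_of_mem r hr).le, Or.inr (Or.inr ⟨rfl, hr⟩)⟩

variable (P) in
open Classical in
/-- The position of the other side of a letter. -/
noncomputable def partner (p : ℕ) : ℕ :=
  if h : ∃ x, P.IsLetter x ∧ P.pos x = p then P.pos (swap h.choose) else p

lemma partner_pos {x : ℕ × ℕ} (hx : P.IsLetter x) : P.partner (P.pos x) = P.pos (swap x) := by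
  have h : ∃ y, P.IsLetter y ∧ P.pos y = P.pos x := ⟨x, hx, rfl⟩
  rw [partner, dif_pos h, pos_inj h.choose_spec.1 hx h.choose_spec.2]

lemma partner_of_ge {p : ℕ} (hp : P.letters.card ≤ p) : P.partner p = p := by
  rw [partner, dif_neg]
  rintro ⟨x, hx, rfl⟩
  have := pos_lt hx
  omega

lemma exists_of_lt_partner {p : ℕ} (h : p < P.partner p) :
    ∃ a b, P.IsLetter (a, b) ∧ P.IsLetter (b, a) ∧ P.pos (a, b) = p ∧ P.pos (b, a) = P.partner p ∧
      a + 1 < b := by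
  have hp : p < P.letters.card := by
    by_contra h'
    have := partner_of_ge (P := P) (not_lt.1 h')
    omega
  obtain ⟨⟨a, b⟩, hx, rfl⟩ := exists_pos hp
  rw [partner_pos hx] at h ⊢
  by_cases hab : a + 1 < b ∨ b + 1 < a
  · have hs := hx.swap
    rw [swap_of hab] at h hs ⊢
    rw [pos_lt_pos_iff hx hs] at h
    exact ⟨a, b, hx, hs, rfl, rfl, by omega⟩
  · rw [swap_of_not hab] at h
    omega

/-- A letter between the two sides of a bridge. -/
lemma between {a b c d : ℕ} (hab : a + 1 < b) (hx : P.IsLetter (a, b)) (hy : P.IsLetter (b, a))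
    (hz : P.IsLetter (c, d)) (h1 : P.pos (a, b) < P.pos (c, d))
    (h2 : P.pos (c, d) < P.pos (b, a)) :
    a ≤ c ∧ c ≤ b ∧ a ≤ d ∧ d ≤ b ∧ c ≠ d ∧ (c = a → d < b) ∧ (c = b → a < d) ∧
      (d = a → c < b) ∧ (d = b → a < c) := by
  rw [pos_lt_pos_iff hx hz] at h1
  rw [pos_lt_pos_iff hz hy] at h2
  have hv := (hx.vis (by omega)).2.2
  have hne := hz.ne_pred
  have hc1 : a ≤ c := by omega
  have hc2 : c ≤ b := by omega
  -- A gap with a cycle edge has height zero, but the gaps between `a` and `b` are strictly higher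
  -- than gap `a`.
  have hcd : c ≠ d := by
    rintro rfl
    have h3 := P.h_of_mem c hz.mem
    have h4 := P.nonneg a
    have h5 : a < c := by omega
    have h6 : c < b := by omega
    linarith [(hv c h5 h6).1]
  -- A letter crossing the bracket would see over gap `a`, so gap `a` would be higher than gap `c`;
  -- but gap `c` is higher than gap `a`.
  have hd1 : a ≤ d := by
    by_contra h3
    have h5 : a < c := by omega
    have h6 : c < b := by omega
    have h7 := (hz.vis' (by omega)).2.2 a (by omega) h5
    linarith [(hv c h5 h6).1]
  have hd2 : d ≤ b := by
    by_contra h3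
    have h5 : a < c := by omega
    have h6 : c < b := by omega
    have h7 := (hz.vis (by omega)).2.2 b h6 (by omega)
    linarith [(hv c h5 h6).2]
  omega

lemma σ_bound {a b c d : ℕ} (hab : a + 1 < b) (hx : P.IsLetter (a, b)) (hy : P.IsLetter (b, a))
    (hz : P.IsLetter (c, d)) (h1 : P.pos (a, b) < P.pos (c, d))
    (h2 : P.pos (c, d) < P.pos (b, a)) :
    P.pos (a, b) < P.pos (swap (c, d)) ∧ P.pos (swap (c, d)) < P.pos (b, a) := by
  have h3 := between hab hx hy hz h1 h2
  by_cases hcd : c + 1 < d ∨ d + 1 < c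
  · have hs := hz.swap
    rw [swap_of hcd] at hs ⊢
    rw [pos_lt_pos_iff hx hs, pos_lt_pos_iff hs hy]
    omega
  · rw [swap_of_not hcd]
    exact ⟨h1, h2⟩

variable (P) in
/-- The contour with a given profile. -/
noncomputable def word : ContourWord where
  N := P.letters.card
  σ := P.partner
  L := {p | ∃ a, P.IsLetter (a, a) ∧ P.pos (a, a) = p}
  R := {p | ∃ a, P.IsLetter (a, a + 1) ∧ P.pos (a, a + 1) = p}
  zero_mem := by
    refine ⟨0, isLetter_cycle P.zero_mem, ?_⟩
    by_contra h
    obtain ⟨⟨a, b⟩, hx, h0⟩ := exists_pos (P := P) (p := 0)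
      ((Nat.zero_le _).trans_lt (pos_lt (isLetter_cycle P.zero_mem)))
    have h1 := (pos_lt_pos_iff hx (isLetter_cycle P.zero_mem)).1 (by omega)
    omega
  L_lt := by
    rintro p ⟨a, ha, rfl⟩
    exact pos_lt ha
  R_lt := by
    rintro p ⟨a, ha, rfl⟩
    exact pos_lt ha
  disj := by
    rintro p ⟨a, ha, rfl⟩ ⟨b, hb, h⟩
    have := pos_inj hb ha h
    rw [Prod.mk.injEq] at this
    omega
  σ_ge _ hp := partner_of_ge hp
  σσ p := by
    by_cases hp : p < P.letters.card
    · obtain ⟨x, hx, rfl⟩ := exists_pos hp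
      rw [partner_pos hx, partner_pos hx.swap, swap_swap]
    · rw [partner_of_ge (not_lt.1 hp), partner_of_ge (not_lt.1 hp)]
  σ_eq_iff p hp := by
    obtain ⟨⟨a, b⟩, hx, rfl⟩ := exists_pos hp
    rw [partner_pos hx]
    constructor
    · intro h
      have h1 := pos_inj hx.swap hx h
      by_cases hab : a + 1 < b ∨ b + 1 < a
      · rw [swap_of hab, Prod.mk.injEq] at h1
        omega
      · have := hx.ne_pred
        rcases (show b = a ∨ b = a + 1 by omega) with rfl | rfl
        · exact Or.inl ⟨_, hx, rfl⟩
        · exact Or.inr ⟨_, hx, rfl⟩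
    · rintro (⟨c, hc, h⟩ | ⟨c, hc, h⟩)
      all_goals
        have h1 := pos_inj hc hx h
        rw [Prod.mk.injEq] at h1
        rw [swap_of_not (by omega)]
  nest := by
    intro p q h1 h2
    obtain ⟨a, b, hx, hy, rfl, e, hab⟩ := exists_of_lt_partner (h1.trans h2)
    rw [← e] at h2 ⊢
    obtain ⟨⟨c, d⟩, hz, rfl⟩ := exists_pos (h2.trans (pos_lt hy))
    rw [partner_pos hz]
    exact σ_bound hab hx hy hz h1 h2
  not_L := by
    rintro p q h1 h2 ⟨c, hz, rfl⟩
    obtain ⟨a, b, hx, hy, rfl, e, hab⟩ := exists_of_lt_partner (h1.trans h2)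
    rw [← e] at h2
    exact (between hab hx hy hz h1 h2).2.2.2.2.1 rfl
  -- The ray that ends gap `a` lies inside the bracket.
  v1 := by
    intro p h
    obtain ⟨a, b, hx, hy, rfl, e, hab⟩ := exists_of_lt_partner (P := P) (p := p) (by omega)
    have hb := hx.2.1
    dsimp only at hb
    have hr := isLetter_ray (P := P) (r := a) (by omega)
    have h1 := (pos_lt_pos_iff hx hr).2 (by omega)
    have h2 := (pos_lt_pos_iff hr hy).2 (by omega)
    omega
  -- The rays that end the gaps `a` and `b - 1` both lie inside. A bracket opened right after `p` is
  -- closed before the second of them.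
  v2 := by
    intro p hp h
    obtain ⟨a, b, hx, hy, rfl, e, hab⟩ := exists_of_lt_partner hp
    have hb := hx.2.1
    dsimp only at hb
    have hr := isLetter_ray (P := P) (r := a) (by omega)
    have hr' := isLetter_ray (P := P) (r := b - 1) (by omega)
    have h1 := (pos_lt_pos_iff hx hr).2 (by omega)
    have h2 := (pos_lt_pos_iff hr hy).2 (by omega)
    have h3 := (pos_lt_pos_iff hr hr').2 (by omega)
    have h4 := (pos_lt_pos_iff hr' hy).2 (by omega)
    have hN := pos_lt hr
    obtain ⟨⟨c, d⟩, hz, hpz⟩ := exists_pos (P := P) (p := P.pos (a, b) + 1) (by omega)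
    have h5 := (pos_lt_pos_iff hx hz).1 (by omega)
    have h6 := (pos_lt_pos_iff hr hz).not.1 (by omega)
    rw [← hpz, partner_pos hz] at h
    by_cases hcd : c + 1 < d ∨ d + 1 < c
    · have hs := hz.swap
      rw [swap_of hcd] at h hs
      have h7 := (pos_lt_pos_iff hs hr').2 (by omega)
      omega
    · rw [swap_of_not hcd] at h
      omega
  -- The ray that ends gap `a` comes after its cycle edge and before any later one.
  v3 := by
    rintro p ⟨a, ha, rfl⟩
    have hr := isLetter_ray (P := P) (r := a) (P.lt_of_mem a ha.mem)
    have h1 := (pos_lt_pos_iff ha hr).2 (by omega)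
    have h2 := pos_lt hr
    refine ⟨?_, by omega⟩
    rintro ⟨c, hc, h⟩
    have h3 := (pos_lt_pos_iff ha hc).1 (by omega)
    have h4 := (pos_lt_pos_iff hr hc).not.1 (by omega)
    omega

end Profile

/-! ### Heights and valleys of the word of a profile -/

namespace Profile

variable {k : ℕ} {P : Profile k}

lemma mem_word_L {a b : ℕ} (hx : P.IsLetter (a, b)) : P.pos (a, b) ∈ P.word.L ↔ a = b := by
  constructor
  · rintro ⟨c, hc, h⟩
    have := pos_inj hc hx h
    rw [Prod.mk.injEq] at this
    omega
  · rintro rfl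
    exact ⟨a, hx, rfl⟩

lemma mem_word_R {a b : ℕ} (hx : P.IsLetter (a, b)) : P.pos (a, b) ∈ P.word.R ↔ b = a + 1 := by
  constructor
  · rintro ⟨c, hc, h⟩
    have := pos_inj hc hx h
    rw [Prod.mk.injEq] at this
    omega
  · rintro rfl
    exact ⟨a, hx, rfl⟩

lemma γ_eq_card {p m : ℕ} (hm : m ≤ k) (h : ∀ r < k, P.pos (r, r + 1) < p ↔ r < m) :
    P.word.γ p = m := by
  classical
  rw [ContourWord.γ, Nat.count_eq_card_filter_range]
  refine Eq.trans (Eq.symm ?_) (Finset.card_range m)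
  refine Finset.card_bij (fun r _ => P.pos (r, r + 1)) ?_ ?_ ?_
  · intro r hr
    rw [Finset.mem_range] at hr
    rw [Finset.mem_filter, Finset.mem_range, h r (by omega)]
    exact ⟨hr, r, isLetter_ray (by omega), rfl⟩
  · intro r hr s hs hrs
    rw [Finset.mem_range] at hr hs
    have := pos_inj (isLetter_ray (P := P) (r := r) (by omega))
      (isLetter_ray (P := P) (r := s) (by omega)) hrs
    rw [Prod.mk.injEq] at this
    omega
  · rintro p hp
    obtain ⟨h1, r, hr, rfl⟩ := Finset.mem_filter.1 hp
    rw [Finset.mem_range] at h1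
    have h2 := hr.2.1
    dsimp only at h2
    exact ⟨r, by rw [Finset.mem_range, ← h r (by omega)]; exact h1, rfl⟩

lemma γ_pos {a b : ℕ} (hx : P.IsLetter (a, b)) : P.word.γ (P.pos (a, b)) = a := by
  refine γ_eq_card hx.1 fun r hr => ?_
  rw [pos_lt_pos_iff (isLetter_ray hr) hx]
  have := hx.2.1
  dsimp only at this
  omega

lemma γ_word : P.word.γ P.word.N = k := by
  refine γ_eq_card le_rfl fun r hr => iff_of_true ?_ hr
  exact pos_lt (isLetter_ray hr)

variable (P) in
/-- The lowest height between two gaps. -/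
noncomputable def top (a b : ℕ) : ℝ :=
  -- The default `0` plays no role, because no letter `(a, b)` has `b + 1 = a`.
  if h : (Finset.Ioo a b).Nonempty then (Finset.Ioo a b).inf' h P.h else 0

lemma top_le {a b l : ℕ} (h1 : a < l) (h2 : l < b) : P.top a b ≤ P.h l := by
  have h : l ∈ Finset.Ioo a b := Finset.mem_Ioo.2 ⟨h1, h2⟩
  rw [top, dif_pos ⟨l, h⟩]
  exact Finset.inf'_le _ h

lemma exists_top {a b : ℕ} (hab : a + 1 < b) : ∃ l, a < l ∧ l < b ∧ P.h l = P.top a b := by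
  have h : (Finset.Ioo a b).Nonempty := ⟨a + 1, Finset.mem_Ioo.2 ⟨by omega, hab⟩⟩
  obtain ⟨l, hl, e⟩ := Finset.exists_mem_eq_inf' h P.h
  rw [Finset.mem_Ioo] at hl
  exact ⟨l, hl.1, hl.2, by rw [top, dif_pos h, e]⟩

lemma top_eq {a b l : ℕ} (h1 : a < l) (h2 : l < b) (h : ∀ j, a < j → j < b → P.h l ≤ P.h j) :
    P.top a b = P.h l := by
  refine le_antisymm (top_le h1 h2) ?_
  obtain ⟨j, h3, h4, e⟩ := exists_top (P := P) (a := a) (b := b) (by omega)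
  rw [← e]
  exact h j h3 h4

lemma Vis.lt_top {a b : ℕ} (h : P.Vis a b) (hab : a + 1 < b) :
    max (P.h a) (P.h b) < P.top a b := by
  obtain ⟨l, h3, h4, e⟩ := exists_top (P := P) (a := a) (b := b) (by omega)
  rw [← e]
  exact max_lt (h.2.2 l h3 h4).1 (h.2.2 l h3 h4).2

variable (P) in
/-- The height of the start of a letter. -/
noncomputable def startHeight (x : ℕ × ℕ) : ℝ :=
  if x.1 = x.2 then 0 else if x.1 < x.2 then max (P.h x.1) (P.h x.2) else P.top x.2 x.1

variable (P) in
/-- The height of the end of a letter. -/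
noncomputable def endHeight (x : ℕ × ℕ) : ℝ :=
  if x.1 = x.2 then 0 else if x.1 + 1 < x.2 then P.top x.1 x.2 else max (P.h x.1) (P.h x.2)

lemma startHeight_self (a : ℕ) : P.startHeight (a, a) = 0 := if_pos rfl

lemma startHeight_up {a b : ℕ} (h : a < b) : P.startHeight (a, b) = max (P.h a) (P.h b) := by
  rw [startHeight, if_neg (by dsimp only; omega), if_pos h]

lemma startHeight_down {a b : ℕ} (h : b < a) : P.startHeight (a, b) = P.top b a := by
  rw [startHeight, if_neg (by dsimp only; omega), if_neg (by dsimp only; omega)]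

lemma endHeight_self (a : ℕ) : P.endHeight (a, a) = 0 := if_pos rfl

lemma endHeight_up {a b : ℕ} (h : a + 1 < b) : P.endHeight (a, b) = P.top a b := by
  rw [endHeight, if_neg (by dsimp only; omega), if_pos h]

lemma endHeight_of {a b : ℕ} (h : b = a + 1 ∨ b < a) :
    P.endHeight (a, b) = max (P.h a) (P.h b) := by
  rw [endHeight, if_neg (by dsimp only; omega), if_neg (by dsimp only; omega)]

variable (P) in
/-- The letter `y` follows on the letter `x`. -/
def Follows (x y : ℕ × ℕ) : Prop :=
  P.IsLetter y ∧ P.pos x < P.pos y ∧ (∀ z, P.IsLetter z → P.pos x < P.pos z → P.pos y ≤ P.pos z) ∧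
    P.startHeight y = P.endHeight x

/-- The first letter of a gap that goes up or is a ray. -/
lemma exists_first_up {c : ℕ} (hc : c < k) : ∃ d, P.IsLetter (c, d) ∧ c < d ∧
    P.startHeight (c, d) = P.h c ∧ ∀ d', P.IsLetter (c, d') → d' ≤ d := by
  classical
  -- The first later gap that is not higher; gap `k`, of height zero, bounds the search.
  have hex : ∃ d, c < d ∧ P.h d ≤ P.h c := ⟨k, hc, by rw [P.h_last]; exact P.nonneg c⟩
  obtain ⟨h1, h2⟩ := Nat.find_spec hex
  have h3 := fun l (hl : l < Nat.find hex) => Nat.find_min hex hl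
  have h4 : Nat.find hex ≤ k := Nat.find_min' hex ⟨hc, by rw [P.h_last]; exact P.nonneg c⟩
  set d := Nat.find hex with hd
  refine ⟨d, Vis.isLetter ⟨h1, h4, fun l h5 h6 => ?_⟩, h1, ?_, fun d' h5 => ?_⟩
  · have := h3 l h6
    push Not at this
    have := this h5
    exact ⟨this, h2.trans_lt this⟩
  · rw [startHeight_up h1, max_eq_left h2]
  · by_contra h7
    push Not at h7
    have := ((h5.vis (by omega)).2.2 d h1 h7).1
    linarith

/-- The first letter of a gap that does not go down. -/
lemma exists_first_level {c : ℕ} (hc : c < k) : ∃ d, P.IsLetter (c, d) ∧ c ≤ d ∧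
    P.startHeight (c, d) = P.h c ∧
    ∀ d', P.IsLetter (c, d') → c ≤ d' → P.pos (c, d) ≤ P.pos (c, d') := by
  by_cases hE : c ∈ P.E
  · refine ⟨c, isLetter_cycle hE, le_rfl, by rw [startHeight_self, P.h_of_mem c hE], ?_⟩
    intro d' h1 h2
    rw [← not_lt, pos_lt_pos_iff h1 (isLetter_cycle hE)]
    omega
  · obtain ⟨d, h1, h2, h3, h4⟩ := exists_first_up (P := P) hc
    refine ⟨d, h1, h2.le, h3, fun d' h5 h6 => ?_⟩
    have : d' ≠ c := by
      rintro rfl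
      exact hE h5.mem
    have := h4 d' h5
    rw [← not_lt, pos_lt_pos_iff h5 h1]
    omega

/-- The next letter that goes down in gap `a` after the letters that come from gap `c` or later
gaps, if the contour is at height `h c`. -/
lemma exists_next_down {a c : ℕ} (hca : c < a) (hak : a ≤ k) (hlt : P.h a < P.h c)
    (hv : ∀ l, c < l → l < a → P.h c < P.h l) : ∃ b, P.IsLetter (a, b) ∧ b < c ∧
      P.startHeight (a, b) = P.h c ∧ ∀ b', P.IsLetter (a, b') → b' < c → b' ≤ b := by
  classical
  have h0 : P.h 0 < P.h c := by
    rw [P.h_zero]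
    exact (P.nonneg a).trans_lt hlt
  have hc0 : 0 < c := by
    rcases Nat.eq_zero_or_pos c with rfl | h
    · exact absurd h0 (lt_irrefl _)
    · exact h
  -- The last gap before `c` that is strictly lower; gap `0` is such a gap.
  have h1 := Nat.findGreatest_spec (P := fun b => P.h b < P.h c) (n := c - 1) (Nat.zero_le _) h0
  have h2 := Nat.findGreatest_le (P := fun b => P.h b < P.h c) (c - 1)
  have h3 := fun b (hb : Nat.findGreatest (fun b => P.h b < P.h c) (c - 1) < b) (hb' : b ≤ c - 1) =>
    Nat.findGreatest_is_greatest (P := fun b => P.h b < P.h c) hb hb'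
  set b := Nat.findGreatest (fun b => P.h b < P.h c) (c - 1) with hb
  have hle : ∀ l, b < l → l < a → P.h c ≤ P.h l := by
    intro l h4 h5
    rcases lt_trichotomy l c with h6 | rfl | h6
    · exact not_lt.1 (h3 l h4 (by omega))
    · exact le_rfl
    · exact (hv l h6 h5).le
  refine ⟨b, Vis.isLetter' ⟨by omega, hak, fun l h4 h5 => ?_⟩ (by omega), by omega, ?_, ?_⟩
  · have := hle l h4 h5
    exact ⟨by linarith, by linarith⟩
  · rw [startHeight_down (by omega)]
    exact top_eq (by omega) hca hle
  · intro b' h4 h5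
    by_contra h6
    have h7 := ((h4.vis' (by omega)).2.2 c h5 hca).1
    linarith [hle b' (by omega) (by omega)]

/-- The induction step for `height_pos`: the height predicted at the end of a letter is the one
predicted at the start of its successor. Which letter comes next depends on which of the gaps
concerned is lower. -/
lemma exists_follows {x : ℕ × ℕ} (hx : P.IsLetter x) :
    (∃ y, P.Follows x y) ∨ ∀ z, P.IsLetter z → P.pos z ≤ P.pos x := by
  obtain ⟨a, b⟩ := x
  have hak := hx.1
  have hbk := hx.2.1
  have hne := hx.ne_pred
  dsimp only at hak hbk
  -- after the last letter that goes down in gap `c`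
  have level : ∀ c, c ≤ k → (∀ d, P.IsLetter (c, d) → c ≤ d → P.pos (a, b) < P.pos (c, d)) →
      (∀ z, P.IsLetter z → P.pos (a, b) < P.pos z → c ≤ z.1 ∧ (z.1 = c → c ≤ z.2)) →
      P.endHeight (a, b) = P.h c →
      (∃ y, P.Follows (a, b) y) ∨ ∀ z, P.IsLetter z → P.pos z ≤ P.pos (a, b) := by
    intro c hc h1 h2 h3
    rcases hc.lt_or_eq with h4 | rfl
    · left
      obtain ⟨d, h5, h6, h7, h8⟩ := exists_first_level (P := P) h4
      refine ⟨(c, d), h5, h1 d h5 h6, ?_, h7.trans h3.symm⟩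
      rintro ⟨e, f⟩ h9 h10
      obtain ⟨h11, h12⟩ := h2 _ h9 h10
      rcases h11.lt_or_eq with h13 | h13
      · exact ((pos_lt_pos_iff h5 h9).2 (Or.inl h13)).le
      · dsimp only at h13 h12
        subst h13
        exact h8 f h9 (h12 rfl)
    · right
      rintro ⟨e, f⟩ h9
      by_contra h10
      obtain ⟨h11, h12⟩ := h2 _ h9 (not_le.1 h10)
      have h13 := h9.1
      have h14 := h9.2.1
      dsimp only at h11 h12 h13 h14
      obtain rfl : e = c := by omega
      obtain rfl : f = e := by omega
      exact lt_irrefl _ (P.lt_of_mem _ h9.mem)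
  rcases lt_trichotomy a b with hab | rfl | hab
  · rcases (Nat.succ_le_of_lt hab).lt_or_eq with hab' | rfl
    · -- a letter that goes up
      left
      have hv := hx.vis hab
      -- The next letter leads to the first of the lowest gaps inside the bracket.
      have hex : ∃ d, a < d ∧ d < b ∧ P.h d = P.top a b := exists_top hab'
      classical
      obtain ⟨h1, h2, h3⟩ := Nat.find_spec hex
      have h4 := fun l (hl : l < Nat.find hex) => Nat.find_min hex hl
      set d := Nat.find hex with hd
      have hlt : P.h a < P.h d := (hv.2.2 d h1 h2).1
      have hmin : ∀ l, a < l → l < d → P.h d < P.h l := by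
        intro l h5 h6
        refine lt_of_le_of_ne (by rw [h3]; exact top_le h5 (by omega)) fun h7 => ?_
        exact h4 l h6 ⟨h5, by omega, by rw [← h7, h3]⟩
      have hy : P.IsLetter (a, d) := Vis.isLetter ⟨h1, by omega, fun l h5 h6 =>
        ⟨hlt.trans (hmin l h5 h6), hmin l h5 h6⟩⟩
      refine ⟨(a, d), hy, (pos_lt_pos_iff hx hy).2 (by omega), ?_, ?_⟩
      · rintro ⟨e, f⟩ hz h5
        rw [pos_lt_pos_iff hx hz] at h5
        by_contra h6
        rw [not_le, pos_lt_pos_iff hz hy] at h6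
        obtain rfl : a = e := by omega
        have h7 := ((hz.vis (by omega)).2.2 d h1 (by omega)).2
        have h8 := top_le (P := P) (a := a) (b := b) (l := f) (by omega) (by omega)
        linarith
      · rw [startHeight_up h1, endHeight_up hab', max_eq_right hlt.le, h3]
    · -- a ray
      rw [Nat.succ_eq_add_one] at *
      have hend : P.endHeight (a, a + 1) = max (P.h a) (P.h (a + 1)) := endHeight_of (Or.inl rfl)
      -- If the next gap is lower, the contour now descends in it; otherwise it already stands at
      -- the lowest point of that gap.
      by_cases hlt : P.h (a + 1) < P.h a
      · left
        obtain ⟨c, h1, h2, h3, h4⟩ := exists_next_down (P := P) (Nat.lt_succ_self a) hbk hlt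
          (fun l h5 h6 => by omega)
        refine ⟨(a + 1, c), h1, (pos_lt_pos_iff hx h1).2 (by omega), ?_, ?_⟩
        · rintro ⟨e, f⟩ hz h5
          rw [pos_lt_pos_iff hx hz] at h5
          by_contra h6
          rw [not_le, pos_lt_pos_iff hz h1] at h6
          obtain rfl : e = a + 1 := by omega
          have h7 := hz.ne_pred
          have := h4 f hz (by omega)
          omega
        · rw [h3, hend, max_eq_left hlt.le]
      · refine level (a + 1) hbk (fun d h1 _ => (pos_lt_pos_iff hx h1).2 (by omega)) ?_ ?_
        · rintro ⟨e, f⟩ hz h5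
          rw [pos_lt_pos_iff hx hz] at h5
          dsimp only
          refine ⟨by omega, ?_⟩
          rintro rfl
          by_contra h6
          have h7 := hz.ne_pred
          have := ((hz.vis' (by omega)).2.2 a (by omega) (by omega)).2
          linarith
        · rw [hend, max_eq_right (not_lt.1 hlt)]
  · -- an edge of the cycle
    left
    obtain ⟨d, h1, h2, h3, h4⟩ := exists_first_up (P := P) (P.lt_of_mem a hx.mem)
    refine ⟨(a, d), h1, (pos_lt_pos_iff hx h1).2 (by omega), ?_, ?_⟩
    · rintro ⟨e, f⟩ hz h5
      rw [pos_lt_pos_iff hx hz] at h5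
      rw [← not_lt, pos_lt_pos_iff hz h1]
      intro h6
      obtain rfl : a = e := by omega
      have := h4 f hz
      omega
    · rw [h3, endHeight_self, P.h_of_mem a hx.mem]
  · -- a letter that goes down
    have hend : P.endHeight (a, b) = max (P.h a) (P.h b) := endHeight_of (Or.inr hab)
    have hv := hx.vis' hab
    by_cases hlt : P.h a < P.h b
    · left
      obtain ⟨c, h1, h2, h3, h4⟩ := exists_next_down (P := P) hab hak hlt
        (fun l h5 h6 => (hv.2.2 l h5 h6).1)
      refine ⟨(a, c), h1, (pos_lt_pos_iff hx h1).2 (by omega), ?_, ?_⟩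
      · rintro ⟨e, f⟩ hz h5
        rw [pos_lt_pos_iff hx hz] at h5
        rw [← not_lt, pos_lt_pos_iff hz h1]
        intro h6
        obtain rfl : a = e := by omega
        have := h4 f hz (by omega)
        omega
      · rw [h3, hend, max_eq_right hlt.le]
    · refine level a hak (fun d h1 _ => (pos_lt_pos_iff hx h1).2 (by omega)) ?_ ?_
      · rintro ⟨e, f⟩ hz h5
        rw [pos_lt_pos_iff hx hz] at h5
        dsimp only
        refine ⟨by omega, ?_⟩
        rintro rfl
        by_contra h6
        have := ((hz.vis' (by omega)).2.2 b (by omega) (by omega)).2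
        linarith
      · rw [hend, max_eq_left (not_lt.1 hlt)]

lemma Follows.pos_eq {x y : ℕ × ℕ} (h : P.Follows x y) :
    P.pos y = P.pos x + 1 := by
  obtain ⟨h1, h2, h3, -⟩ := h
  by_contra h4
  have := pos_lt h1
  obtain ⟨z, hz, e⟩ := exists_pos (P := P) (p := P.pos x + 1) (by omega)
  have := h3 z hz (by omega)
  omega

variable (P) in
/-- The length of a letter, where the lengths of the edges of the cycle are given by `c`. -/
noncomputable def letterLength (c : ℕ → ℝ) (x : ℕ × ℕ) : ℝ :=
  if x.1 = x.2 then c x.1 else if x.1 + 1 < x.2 then P.top x.1 x.2 - max (P.h x.1) (P.h x.2)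
  else if x.2 + 1 < x.1 then P.top x.2 x.1 - max (P.h x.1) (P.h x.2) else 0

variable {c : ℕ → ℝ}

lemma letterLength_self (a : ℕ) : P.letterLength c (a, a) = c a := if_pos rfl

lemma letterLength_up {a b : ℕ} (h : a + 1 < b) :
    P.letterLength c (a, b) = P.top a b - max (P.h a) (P.h b) := by
  rw [letterLength, if_neg (by dsimp only; omega), if_pos h]

lemma letterLength_down {a b : ℕ} (h : b + 1 < a) :
    P.letterLength c (a, b) = P.top b a - max (P.h a) (P.h b) := by
  rw [letterLength, if_neg (by dsimp only; omega), if_neg (by dsimp only; omega), if_pos h]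

lemma letterLength_ray (a : ℕ) : P.letterLength c (a, a + 1) = 0 := by
  rw [letterLength, if_neg (by dsimp only; omega), if_neg (by dsimp only; omega),
    if_neg (by dsimp only; omega)]

lemma letterLength_swap (x : ℕ × ℕ) : P.letterLength c (swap x) = P.letterLength c x := by
  obtain ⟨a, b⟩ := x
  by_cases h : a + 1 < b ∨ b + 1 < a
  · rw [swap_of h]
    rcases h with h | h
    · rw [letterLength_down h, letterLength_up h, max_comm]
    · rw [letterLength_down h, letterLength_up h, max_comm]
  · rw [swap_of_not h]

lemma letterLength_pos (hc : ∀ r ∈ P.E, 0 < c r) {a b : ℕ} (hx : P.IsLetter (a, b))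
    (hab : b ≠ a + 1) : 0 < P.letterLength c (a, b) := by
  have hne := hx.ne_pred
  rcases lt_trichotomy a b with h | rfl | h
  · rw [letterLength_up (by omega), sub_pos]
    exact (hx.vis h).lt_top (by omega)
  · rw [letterLength_self]
    exact hc _ hx.mem
  · rw [letterLength_down (by omega), sub_pos, max_comm]
    exact (hx.vis' h).lt_top (by omega)

open Classical in
variable (P) in
/-- The lengths of the letters of the contour. -/
noncomputable def wordLength (c : ℕ → ℝ) (p : ℕ) : ℝ :=
  if h : ∃ x, P.IsLetter x ∧ P.pos x = p then P.letterLength c h.choose else 0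

lemma wordLength_pos {x : ℕ × ℕ} (hx : P.IsLetter x) :
    P.wordLength c (P.pos x) = P.letterLength c x := by
  have h : ∃ y, P.IsLetter y ∧ P.pos y = P.pos x := ⟨x, hx, rfl⟩
  rw [wordLength, dif_pos h, pos_inj h.choose_spec.1 hx h.choose_spec.2]

lemma wordLength_of_ge {p : ℕ} (hp : P.word.N ≤ p) : P.wordLength c p = 0 := by
  rw [wordLength, dif_neg]
  rintro ⟨x, hx, rfl⟩
  exact absurd (pos_lt hx) (not_lt.2 hp)

lemma wordLength_σ (p : ℕ) : P.wordLength c (P.word.σ p) = P.wordLength c p := by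
  by_cases hp : p < P.letters.card
  · obtain ⟨x, hx, rfl⟩ := exists_pos hp
    change P.wordLength c (P.partner _) = _
    rw [partner_pos hx, wordLength_pos hx, wordLength_pos hx.swap, letterLength_swap]
  · rw [P.word.σ_ge _ (not_lt.1 hp)]

lemma height_succ {x : ℕ × ℕ} (hx : P.IsLetter x)
    (h : P.word.height (P.wordLength c) (P.pos x) = P.startHeight x) :
    P.word.height (P.wordLength c) (P.pos x + 1) = P.endHeight x := by
  obtain ⟨a, b⟩ := x
  have hne := hx.ne_pred
  have hσ : P.word.σ (P.pos (a, b)) = P.pos (swap (a, b)) := partner_pos hx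
  have hs := hx.swap
  rcases lt_trichotomy a b with hab | rfl | hab
  · rcases (Nat.succ_le_of_lt hab).lt_or_eq with hab' | rfl
    · rw [swap_of (Or.inl hab')] at hσ hs
      have h1 := (pos_lt_pos_iff hx hs).2 (Or.inl hab)
      rw [ContourWord.height_up (by omega), h, wordLength_pos hx, letterLength_up hab',
        startHeight_up hab, endHeight_up hab']
      ring
    · rw [Nat.succ_eq_add_one] at *
      rw [ContourWord.height_same (ContourWord.σ_R ((mem_word_R hx).2 rfl)), h,
        startHeight_up hab, endHeight_of (Or.inl rfl)]
  · rw [ContourWord.height_same (ContourWord.σ_L ((mem_word_L hx).2 rfl)), h,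
      startHeight_self, endHeight_self]
  · rw [swap_of (by omega)] at hσ hs
    have h1 := (pos_lt_pos_iff hs hx).2 (Or.inl hab)
    have h2 := ContourWord.height_down (W := P.word) (l := P.wordLength c) (p := P.pos (a, b))
      (by omega)
    rw [hσ, wordLength_pos hs, letterLength_up (by omega), h, startHeight_down hab] at h2
    rw [endHeight_of (Or.inr hab), max_comm]
    linarith

lemma height_pos {x : ℕ × ℕ} (hx : P.IsLetter x) :
    P.word.height (P.wordLength c) (P.pos x) = P.startHeight x := by
  induction hp : P.pos x generalizing x with
  | zero =>
    obtain ⟨a, ha, h0⟩ := P.word.zero_mem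
    rw [ContourWord.height_L P.word.zero_mem, pos_inj hx ha (hp.trans h0.symm), startHeight_self]
  | succ p ih =>
    obtain ⟨y, hy, rfl⟩ := exists_pos (P := P) (p := p) (by have := pos_lt hx; omega)
    rcases exists_follows hy with ⟨z, hz⟩ | h
    · have h1 := hz.pos_eq
      rw [height_succ hy (ih hy rfl), pos_inj hx hz.1 (hp.trans h1.symm), hz.2.2.2]
    · have := h x hx
      omega

/-- The first letter of a gap that does not go down starts at height `h`, and the formula for
`startHeight` gives at least this for every letter of the gap. -/
lemma isValley_word : P.word.IsValley (P.wordLength c) P.h := by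
  intro r hr
  rw [γ_word] at hr
  constructor
  · rcases hr.lt_or_eq with h | rfl
    · obtain ⟨d, h1, h2, h3, -⟩ := exists_first_level (P := P) h
      exact ⟨_, (pos_lt h1).le, γ_pos h1, by rw [height_pos h1, h3]⟩
    · exact ⟨_, le_rfl, γ_word, by rw [ContourWord.height_N, P.h_last]⟩
  · rintro x ⟨p, hp, hγ, rfl⟩
    rcases hp.lt_or_eq with h | rfl
    · obtain ⟨⟨a, b⟩, hx, rfl⟩ := exists_pos (P := P) h
      rw [γ_pos hx] at hγ
      subst hγ
      rw [height_pos hx]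
      have hne := hx.ne_pred
      rcases lt_trichotomy a b with hab | rfl | hab
      · rw [startHeight_up hab]
        exact le_max_left _ _
      · rw [startHeight_self, P.h_of_mem _ hx.mem]
      · rw [startHeight_down hab]
        exact ((le_max_right _ _).trans_lt ((hx.vis' hab).lt_top (by omega))).le
    · rw [γ_word] at hγ
      rw [ContourWord.height_N, ← hγ, P.h_last]

open Classical in
lemma sum_word_L : ∑ p ∈ (Finset.range P.word.N).filter (· ∈ P.word.L), P.wordLength c p =
    ∑ r ∈ (Finset.range k).filter (· ∈ P.E), c r := by
  symm
  refine Finset.sum_bij (fun r _ => P.pos (r, r)) ?_ ?_ ?_ ?_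
  · intro r hr
    rw [Finset.mem_filter] at hr ⊢
    have h1 := isLetter_cycle hr.2
    exact ⟨Finset.mem_range.2 (pos_lt h1), (mem_word_L h1).2 rfl⟩
  · intro r hr s hs h
    rw [Finset.mem_filter] at hr hs
    exact (Prod.mk.inj (pos_inj (isLetter_cycle hr.2) (isLetter_cycle hs.2) h)).1
  · intro p hp
    rw [Finset.mem_filter] at hp
    obtain ⟨-, a, ha, rfl⟩ := hp
    exact ⟨a, Finset.mem_filter.2 ⟨Finset.mem_range.2 (P.lt_of_mem a ha.mem), ha.mem⟩, rfl⟩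
  · intro r hr
    rw [Finset.mem_filter] at hr
    rw [wordLength_pos (isLetter_cycle hr.2), letterLength_self]

open Classical in
/-- The metric graph with a given profile. -/
theorem exists_metricCells [NeZero k] (P : Profile k) (j₀ : Fin k) {x : ℕ → ℝ} {τ : ℝ}
    (hx : ∀ r < k, x r = if r ∈ P.E then c r else - P.h r) (hc : ∀ r ∈ P.E, 0 < c r)
    (hτ : ∑ r ∈ (Finset.range k).filter (· ∈ P.E), c r = τ) :
    ∃ G : MetricCells k τ, G.1.n ≤ 2 * ((k + 1) * (k + 1)) ∧ (∀ d, d ∈ G.kept) ∧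
      ∀ r < k, G.coord ((finRotate k ^ r) j₀) = x r := by
  have h0 : ∀ p, 0 ≤ P.wordLength c p := by
    intro p
    by_cases hp : p < P.letters.card
    · obtain ⟨⟨a, b⟩, hx, rfl⟩ := exists_pos hp
      rw [wordLength_pos hx]
      by_cases hab : b = a + 1
      · rw [hab, letterLength_ray]
      · exact (letterLength_pos hc hx hab).le
    · rw [wordLength_of_ge (not_lt.1 hp)]
  have hR : ∀ p ∈ P.word.R, P.wordLength c p = 0 := by
    rintro p ⟨a, ha, rfl⟩
    rw [wordLength_pos ha, letterLength_ray]
  have hpos : ∀ p < P.word.N, p ∉ P.word.R → 0 < P.wordLength c p := by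
    intro p hp hR
    obtain ⟨⟨a, b⟩, hx, rfl⟩ := exists_pos (P := P) hp
    rw [wordLength_pos hx]
    exact letterLength_pos hc hx fun h => hR ((mem_word_R hx).2 h)
  have hL : ∀ p ∈ P.word.L, x (P.word.γ p) = P.wordLength c p - P.h (P.word.γ p) := by
    rintro p ⟨a, ha, rfl⟩
    rw [γ_pos ha, hx a (P.lt_of_mem a ha.mem), if_pos ha.mem, wordLength_pos ha,
      letterLength_self, P.h_of_mem a ha.mem, sub_zero]
  have hnL : ∀ r < k, (∀ p ∈ P.word.L, P.word.γ p ≠ r) → x r = - P.h r := by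
    intro r hr h
    rw [hx r hr, if_neg]
    intro hE
    exact h _ ⟨r, isLetter_cycle hE, rfl⟩ (γ_pos (isLetter_cycle hE))
  obtain ⟨G, h1, h2, h3⟩ := ContourWord.exists_metricCells γ_word j₀ h0 wordLength_σ hR
    (fun p => wordLength_of_ge) hpos ((sum_word_L (P := P)).trans hτ) isValley_word hL hnL
  exact ⟨G, h1.trans (Nat.mul_le_mul_left 2 card_letters_le), h2, h3⟩

end Profile

/-! ### Every admissible vector is realised -/

namespace MetricCells

open PlaneType

variable {k : ℕ} [NeZero k] {τ : ℝ}

/-- Every admissible vector is the vector of coordinates of a metric graph without edges of length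
zero, whose number of edges is bounded. -/
theorem exists_coord_eq (hτ : 0 < τ) {x : Fin k → ℝ} (hx : ∑ j, max (x j) 0 = τ) :
    ∃ G : MetricCells k τ, G.1.n ≤ 2 * ((k + 1) * (k + 1)) ∧ (∀ d, d ∈ G.kept) ∧ G.coord = x := by
  classical
  -- The contour is to start in a gap that shows a cycle edge, so the labels are rotated to put a
  -- positive entry first.
  obtain ⟨j₀, hj₀⟩ : ∃ j, 0 < x j := by
    by_contra h
    push Not at h
    rw [Finset.sum_eq_zero fun j _ => max_eq_right (h j)] at hx
    exact hτ.ne hx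
  let y : ℕ → ℝ := fun r => x ((finRotate k ^ r) j₀)
  have hy0 : y 0 = x j₀ := rfl
  have hyk : y k = x j₀ := congrArg x (finRotate_pow_self j₀)
  let P : Profile k :=
    { h := fun r => max (- y r) 0
      E := {r | r < k ∧ 0 < y r}
      h_zero := max_eq_right (by rw [hy0]; linarith)
      h_last := max_eq_right (by rw [hyk]; linarith)
      nonneg := fun r => le_max_right _ _
      zero_mem := ⟨Nat.pos_of_ne_zero (NeZero.ne k), hj₀⟩
      lt_of_mem := fun r hr => hr.1
      h_of_mem := fun r hr => max_eq_right (by linarith [hr.2]) }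
  have hyx : ∀ r < k, y r = if r ∈ P.E then y r else - P.h r := by
    intro r hr
    split_ifs with hE
    · rfl
    · have : y r ≤ 0 := not_lt.1 fun h => hE ⟨hr, h⟩
      change y r = - max (- y r) 0
      rw [max_eq_left (by linarith), neg_neg]
  have hsum : ∑ r ∈ (Finset.range k).filter (· ∈ P.E), y r = τ := by
    rw [← hx, Finset.sum_filter]
    refine Finset.sum_bij (fun r _ => (finRotate k ^ r) j₀) (fun _ _ => Finset.mem_univ _) ?_ ?_ ?_
    · intro r hr s hs h
      exact finRotate_pow_inj j₀ (Finset.mem_range.1 hr) (Finset.mem_range.1 hs) h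
    · intro j _
      obtain ⟨r, hr, h⟩ := exists_finRotate_pow j₀ j
      exact ⟨r, Finset.mem_range.2 hr, h⟩
    · intro r hr
      change (if r < k ∧ 0 < y r then y r else 0) = max (y r) 0
      rw [Finset.mem_range] at hr
      split_ifs with h
      · rw [max_eq_left h.2.le]
      · rw [max_eq_right (not_lt.1 fun h' => h ⟨hr, h'⟩)]
  obtain ⟨G, h1, h2, h3⟩ := P.exists_metricCells j₀ (x := y) (c := y) (τ := τ)
    (fun r hr => by convert hyx r hr) (fun r hr => hr.2) (by convert hsum)
  refine ⟨G, h1, h2, funext fun j => ?_⟩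
  obtain ⟨r, hr, rfl⟩ := exists_finRotate_pow j₀ j
  exact h3 r hr

end MetricCells

/-! ### Topology of the cells and of the admissible vectors -/

namespace PlaneType

variable {k : ℕ}

lemma continuous_ht (Γ : PlaneType k) (e : Fin Γ.n) : Continuous fun ℓ => Γ.ht ℓ e := by
  classical
  unfold ht
  fun_prop

lemma continuous_coord (Γ : PlaneType k) : Continuous Γ.coord := by
  classical
  refine continuous_pi fun j => Continuous.sub ?_ ?_
  · unfold cycleGap
    fun_prop
  · unfold valley
    exact Continuous.finset_inf'_apply _ fun e _ => continuous_ht Γ e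

lemma isClosed_isLength (Γ : PlaneType k) (τ : ℝ) : IsClosed {ℓ | IsLength Γ τ ℓ} := by
  have h : {ℓ | IsLength Γ τ ℓ} = {ℓ | ∀ d, 0 ≤ ℓ d} ∩ {ℓ | ∀ d, ℓ (Γ.edge d) = ℓ d} ∩
      {ℓ | ∀ i, ℓ (Γ.ray i) = 0} ∩ {ℓ | ∑ d ∈ Γ.cycle, ℓ d = 2 * τ} := by
    ext ℓ
    exact ⟨fun h => ⟨⟨⟨h.nonneg, h.edge⟩, h.ray⟩, h.cycle⟩,
      fun ⟨⟨⟨h1, h2⟩, h3⟩, h4⟩ => ⟨h1, h2, h3, h4⟩⟩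
  rw [h]
  refine ((IsClosed.inter ?_ ?_).inter ?_).inter ?_
  · simp only [Set.ofPred_forall]
    exact isClosed_iInter fun d => isClosed_le continuous_const (continuous_apply d)
  · simp only [Set.ofPred_forall]
    exact isClosed_iInter fun d => isClosed_eq (continuous_apply _) (continuous_apply d)
  · simp only [Set.ofPred_forall]
    exact isClosed_iInter fun d => isClosed_eq (continuous_apply _) continuous_const
  · exact isClosed_eq (by fun_prop) continuous_const

/-- A type is determined by its two permutations, its rays and its cycle; the remaining fields are
propositions. -/
lemma finite_n_le (k M : ℕ) : {Γ : PlaneType k | Γ.n ≤ M}.Finite := by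
  let T := Σ n : Fin (M + 1),
    Equiv.Perm (Fin n) × Equiv.Perm (Fin n) × (Fin k → Fin n) × Finset (Fin n)
  let F : {Γ : PlaneType k | Γ.n ≤ M} → T := fun Γ =>
    ⟨⟨Γ.1.n, Nat.lt_succ_of_le Γ.2⟩, Γ.1.edge, Γ.1.rot, Γ.1.ray, Γ.1.cycle⟩
  refine Set.finite_coe_iff.1 (Finite.of_injective F ?_)
  rintro ⟨⟨⟨n, e, r, ρ, _, _, _⟩, _, _, _, _, L, _⟩, h⟩
    ⟨⟨⟨n', e', r', ρ', _, _, _⟩, _, _, _, _, L', _⟩, h'⟩ hF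
  obtain ⟨h1, h2⟩ := Sigma.mk.inj hF
  obtain rfl : n = n' := Fin.mk.inj h1
  simp only [heq_eq_eq, Prod.mk.injEq] at h2
  obtain ⟨rfl, rfl, rfl, rfl⟩ := h2
  rfl

end PlaneType

/-- Differences between the coordinates and the last coordinate. -/
noncomputable def lastDifference (k : ℕ) [NeZero k] (x : Fin k → ℝ) :
    EuclideanSpace ℝ (Fin (k - 1)) :=
  WithLp.toLp 2 fun i => x (Fin.castLE (Nat.sub_le k 1) i) - x (Fin.rev 0)

section LastDifference

variable {k : ℕ} [NeZero k] {τ : ℝ}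

lemma continuous_lastDifference : Continuous (lastDifference k) := by
  unfold lastDifference
  fun_prop

lemma rev_zero_val : ((Fin.rev 0 : Fin k) : ℕ) = k - 1 := by
  simp [Fin.val_rev]

lemma lastDifference_apply (x : Fin k → ℝ) (i : Fin (k - 1)) :
    lastDifference k x i = x (Fin.castLE (Nat.sub_le k 1) i) - x (Fin.rev 0) := rfl

lemma eq_rev_zero_or (j : Fin k) :
    j = Fin.rev 0 ∨ ∃ i : Fin (k - 1), Fin.castLE (Nat.sub_le k 1) i = j := by
  have := j.2
  by_cases h : (j : ℕ) = k - 1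
  · exact Or.inl (Fin.ext (h.trans rev_zero_val.symm))
  · exact Or.inr ⟨⟨j, by omega⟩, rfl⟩

/-- Intermediate value theorem along the diagonal: the sum of positive parts vanishes at `t = -∑ j,
|z j|` and is at least `τ` at `t = τ`, because the last entry of `z` is `0`. -/
lemma exists_lastDifference_eq (hτ : 0 < τ) (y : EuclideanSpace ℝ (Fin (k - 1))) :
    ∃ x : Fin k → ℝ, ∑ j, max (x j) 0 = τ ∧ lastDifference k x = y := by
  let z : Fin k → ℝ := fun j => if h : (j : ℕ) < k - 1 then y ⟨j, h⟩ else 0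
  have hz : ∀ i : Fin (k - 1), z (Fin.castLE (Nat.sub_le k 1) i) = y i := fun i => dif_pos i.2
  have hz0 : z (Fin.rev 0) = 0 := dif_neg (by rw [rev_zero_val]; omega)
  have hcont : Continuous fun t : ℝ => ∑ j, max (z j + t) 0 := by fun_prop
  obtain ⟨t, ht⟩ : τ ∈ Set.range fun t : ℝ => ∑ j, max (z j + t) 0 := by
    refine mem_range_of_exists_le_of_exists_ge hcont ⟨- ∑ j, |z j|, ?_⟩ ⟨τ, ?_⟩
    · refine le_trans (le_of_eq (Finset.sum_eq_zero fun j _ => max_eq_right ?_)) hτ.le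
      have h1 := Finset.single_le_sum (f := fun j => |z j|) (fun j _ => abs_nonneg (z j))
        (Finset.mem_univ j)
      linarith [le_abs_self (z j)]
    · have h1 := Finset.single_le_sum (f := fun j => max (z j + τ) 0)
        (fun j _ => le_max_right _ _) (Finset.mem_univ (Fin.rev 0))
      refine le_trans ?_ h1
      rw [hz0, zero_add]
      exact le_max_left _ _
  refine ⟨fun j => z j + t, ht, ?_⟩
  ext i
  rw [lastDifference_apply, hz, hz0]
  ring

lemma lastDifference_sub (i j : Fin k) :
    ∃ c : EuclideanSpace ℝ (Fin (k - 1)) → ℝ, Continuous c ∧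
      ∀ x : Fin k → ℝ, x i - x j = c (lastDifference k x) := by
  have key : ∀ i : Fin k, ∃ c : EuclideanSpace ℝ (Fin (k - 1)) → ℝ, Continuous c ∧
      ∀ x : Fin k → ℝ, x i - x (Fin.rev 0) = c (lastDifference k x) := by
    intro i
    rcases eq_rev_zero_or i with rfl | ⟨i, rfl⟩
    · exact ⟨fun _ => 0, continuous_const, fun x => sub_self _⟩
    · exact ⟨fun y => y i, by fun_prop, fun x => rfl⟩
  obtain ⟨c, hc, h⟩ := key i
  obtain ⟨c', hc', h'⟩ := key j
  exact ⟨fun y => c y - c' y, hc.sub hc', fun x => by beta_reduce; rw [← h, ← h']; ring⟩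

/-- Vectors with the same differences differ by a multiple of the diagonal, along which the sum of
positive parts is strictly increasing as long as it is positive. -/
lemma lastDifference_injOn (hτ : 0 < τ) :
    Set.InjOn (lastDifference k) {x | ∑ j, max (x j) 0 = τ} := by
  have hdiff : ∀ x y : Fin k → ℝ, lastDifference k x = lastDifference k y →
      ∀ i j, x i - x j = y i - y j := by
    intro x y h i j
    obtain ⟨c, -, hc⟩ := lastDifference_sub i j
    rw [hc, hc, h]
  have hle : ∀ x y : Fin k → ℝ, ∑ j, max (x j) 0 = τ → ∑ j, max (y j) 0 = τ →
      lastDifference k x = lastDifference k y → ∀ j, y j ≤ x j := by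
    intro x y hx hy h j
    by_contra hj
    obtain ⟨i, hi⟩ : ∃ i, 0 < x i := by
      by_contra h
      push Not at h
      rw [Finset.sum_eq_zero fun j _ => max_eq_right (h j)] at hx
      exact hτ.ne hx
    have hlt : ∀ i, x i < y i := fun i => by
      have := hdiff x y h i j
      linarith
    refine absurd (hx.trans hy.symm) (Finset.sum_lt_sum (fun i _ => ?_) ⟨i, Finset.mem_univ i, ?_⟩).ne
    · exact max_le_max_right _ (hlt i).le
    · rw [max_eq_left hi.le]
      exact (hlt i).trans_le (le_max_left _ _)
  intro x hx y hy h
  exact funext fun j => le_antisymm (hle y x hy hx h.symm j) (hle x y hx hy h j)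

/-- Admissible vectors are bounded in terms of the differences of their entries. -/
lemma exists_abs_le (hτ : 0 < τ) {K : Set (EuclideanSpace ℝ (Fin (k - 1)))} (hK : IsCompact K) :
    ∃ R, ∀ x : Fin k → ℝ, ∑ j, max (x j) 0 = τ → lastDifference k x ∈ K → ∀ j, |x j| ≤ R := by
  have key : ∀ i j : Fin k, ∃ R, ∀ x : Fin k → ℝ, lastDifference k x ∈ K → |x i - x j| ≤ R := by
    intro i j
    obtain ⟨c, hc, h⟩ := lastDifference_sub i j
    obtain ⟨R, hR⟩ := (hK.image hc).isBounded.exists_norm_le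
    exact ⟨R, fun x hx => by rw [h]; exact hR _ ⟨_, hx, rfl⟩⟩
  choose R hR using key
  refine ⟨τ + ∑ i, ∑ j, |R i j|, fun x hx hxK j => ?_⟩
  have hxle : ∀ j, x j ≤ τ := fun j => by
    rw [← hx]
    exact (le_max_left _ _).trans (Finset.single_le_sum (f := fun j => max (x j) 0)
      (fun j _ => le_max_right _ _) (Finset.mem_univ j))
  -- Entries are at most `τ`, and comparison with a positive entry bounds them from below.
  obtain ⟨i, hi⟩ : ∃ i, 0 < x i := by
    by_contra h
    push Not at h
    rw [Finset.sum_eq_zero fun j _ => max_eq_right (h j)] at hx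
    exact hτ.ne hx
  have h1 := abs_le.1 (hR i j x hxK)
  have h2 := Finset.single_le_sum (f := fun j => |R i j|) (fun j _ => abs_nonneg _)
    (Finset.mem_univ j)
  have h3 := Finset.single_le_sum (f := fun i => ∑ j, |R i j|)
    (fun i _ => Finset.sum_nonneg fun j _ => abs_nonneg _) (Finset.mem_univ i)
  have h4 := le_abs_self (R i j)
  have h5 := abs_nonneg (R i j)
  rw [abs_le]
  constructor
  · linarith
  · linarith [hxle j]

end LastDifference

namespace MetricCells

open PlaneType

variable {k : ℕ} [NeZero k] {τ : ℝ}

/-- The coordinates of a metric graph, up to a common summand. -/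
noncomputable def chart (G : MetricCells k τ) : EuclideanSpace ℝ (Fin (k - 1)) :=
  lastDifference k G.coord

lemma sum_max_coord (G : MetricCells k τ) : ∑ j, max (G.coord j) 0 = τ :=
  PlaneType.sum_max_coord G.2.2

lemma continuous_chart : Continuous (chart (k := k) (τ := τ)) :=
  continuous_sigma fun Γ =>
    continuous_lastDifference.comp ((continuous_coord Γ).comp continuous_subtype_val)

/-- The preimage of a compact set is closed in a closed subset of Euclidean space, and its lengths
are bounded by `length_le` and `exists_abs_le`. -/
lemma isProperMap_chart (hτ : 0 < τ) (Γ : PlaneType k) :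
    IsProperMap fun ℓ : {ℓ : Fin Γ.n → ℝ // IsLength Γ τ ℓ} => chart ⟨Γ, ℓ⟩ := by
  have hcont : Continuous fun ℓ : {ℓ : Fin Γ.n → ℝ // IsLength Γ τ ℓ} => chart ⟨Γ, ℓ⟩ :=
    continuous_chart.comp continuous_sigmaMk
  refine isProperMap_iff_isCompact_preimage.2 ⟨hcont, fun K hK => ?_⟩
  have hemb := (isClosed_isLength Γ τ).isClosedEmbedding_subtypeVal
  obtain ⟨R, hR⟩ := exists_abs_le hτ hK
  rw [hemb.isEmbedding.isCompact_iff]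
  refine isCompact_Icc.of_isClosed_subset (s := Set.Icc (fun _ => 0) fun _ => R)
    (hemb.isClosedMap _ (hK.isClosed.preimage hcont)) ?_
  rintro _ ⟨ℓ, hℓ, rfl⟩
  refine ⟨ℓ.2.nonneg, fun d => ?_⟩
  obtain ⟨j, hj⟩ := length_le ℓ.2 d
  exact hj.trans (hR _ (PlaneType.sum_max_coord ℓ.2) hℓ j)

end MetricCells

/-! ### The homeomorphism -/

namespace MetricGraphSpace

open MetricCells

variable {k : ℕ} [NeZero k] {τ : ℝ}

/-- The global chart of the space of metric graphs. -/
noncomputable def chart (k : ℕ) [NeZero k] (τ : ℝ) :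
    MetricGraphSpace k τ → EuclideanSpace ℝ (Fin (k - 1)) :=
  Quot.lift MetricCells.chart fun _ _ h => congrArg (lastDifference k) h.coord_eq

lemma continuous_chart : Continuous (chart k τ) := continuous_quot_lift _ MetricCells.continuous_chart

/-- Every class contains a metric graph without edges of length zero. -/
lemma exists_kept (hτ : 0 < τ) (G : MetricCells k τ) : ∃ H : MetricCells k τ,
    H.1.n ≤ 2 * ((k + 1) * (k + 1)) ∧ (∀ d, d ∈ H.kept) ∧ H.coord = G.coord ∧
      (Quot.mk _ H : MetricGraphSpace k τ) = Quot.mk _ G := by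
  obtain ⟨H, h1, h2, h3⟩ := exists_coord_eq hτ G.sum_max_coord
  exact ⟨H, h1, h2, h3, (Quot.sound (collapses_of_coord_eq hτ h2 h3.symm)).symm⟩

/-- Both graphs collapse to one and the same graph `C` without edges of length zero. -/
lemma chart_injective (hτ : 0 < τ) : Function.Injective (chart k τ) := by
  rintro ⟨G⟩ ⟨H⟩ h
  obtain ⟨C, h1, h2, h3, h4⟩ := exists_kept hτ G
  have h5 : G.coord = H.coord := lastDifference_injOn hτ G.sum_max_coord H.sum_max_coord h
  exact h4.symm.trans (Quot.sound (collapses_of_coord_eq hτ h2 (h5.symm.trans h3.symm))).symm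

lemma chart_surjective (hτ : 0 < τ) : Function.Surjective (chart k τ) := by
  intro y
  obtain ⟨x, hx, rfl⟩ := exists_lastDifference_eq hτ y
  obtain ⟨G, -, -, rfl⟩ := exists_coord_eq hτ hx
  exact ⟨Quot.mk _ G, rfl⟩

/-- Each class has a representative with a bounded number of darts, so the image of a closed set is
a finite union of images of closed sets under proper maps. -/
lemma isClosedMap_chart (hτ : 0 < τ) : IsClosedMap (chart k τ) := by
  intro K hK
  have hfin := PlaneType.finite_n_le k (2 * ((k + 1) * (k + 1)))
  have h1 : chart k τ '' K = ⋃ Γ ∈ {Γ : PlaneType k | Γ.n ≤ 2 * ((k + 1) * (k + 1))},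
      (fun ℓ : {ℓ : Fin Γ.n → ℝ // IsLength Γ τ ℓ} => MetricCells.chart ⟨Γ, ℓ⟩) ''
        {ℓ | (Quot.mk _ ⟨Γ, ℓ⟩ : MetricGraphSpace k τ) ∈ K} := by
    ext y
    simp only [Set.mem_iUnion]
    constructor
    · rintro ⟨⟨G⟩, hG, rfl⟩
      obtain ⟨H, h1, -, h3, h4⟩ := exists_kept hτ G
      exact ⟨H.1, h1, H.2, by change Quot.mk _ H ∈ K; rw [h4]; exact hG,
        congrArg (lastDifference k) h3⟩
    · rintro ⟨Γ, -, ℓ, hℓ, rfl⟩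
      exact ⟨_, hℓ, rfl⟩
  rw [h1]
  refine hfin.isClosed_biUnion fun Γ _ => (isProperMap_chart hτ Γ).isClosedMap _ ?_
  exact hK.preimage (continuous_quot_mk.comp continuous_sigmaMk)

end MetricGraphSpace

theorem mainTheorem8 (k : ℕ) (hk : 2 ≤ k) (τ : ℝ) (hτ : 0 < τ) :
    Nonempty (MetricGraphSpace k τ ≃ₜ EuclideanSpace ℝ (Fin (k - 1))) := by
  have : NeZero k := ⟨by omega⟩
  exact ⟨(Equiv.ofBijective (MetricGraphSpace.chart k τ) ⟨MetricGraphSpace.chart_injective hτ,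
    MetricGraphSpace.chart_surjective hτ⟩).toHomeomorphOfContinuousClosed
    MetricGraphSpace.continuous_chart (MetricGraphSpace.isClosedMap_chart hτ)⟩
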